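/- **Theorem (Soundness of enforcement).** *Setting.* Let $C_{in},C_{out}$ be sets of input and output channels, each channel having a level $L$ or $H$. Values are booleans and non-negative integers. An item $(c=v)$ is a channel with a value; queues are finite sequences of items. For a queue $Q$, $Q|_l$ and $Q|_c$ are its subsequences of items on channels of level $l$, resp. on channel $c$, and $Q=_LQ'$ means $Q|_L=Q'|_L$. Programs are built from $x:=e$, $\pi;\pi$, $\mathbf{if}$, $\mathbf{while}$, $\mathbf{skip}$, $\mathbf{input}\ x\ \mathbf{from}\ c$ and $\mathbf{output}\ e\ \mathbf{to}\ c$, where expressions are (possibly partial) functions of the memory; $m_0$ is a fixed initial memory, and $\delta$ assigns a default value to each channel. *Mechanism.* $EM_\delta(\pi)$ has a stack $\pi[0],\pi[1],\dots$ of local executions (initially two copies of $\pi$ with memory $m_0$, empty local input and output queues, executing), components MAP and REDUCE (initially $\mathbf{skip}$), tables $T_M,T_R$ giving local execution $i$ on channel $c$ a subset of the privileges $a$ (ask), $t$ (tell), a global input queue (initially $I$) and a global output queue (initially empty). Its steps are arbitrary interleavings of atomic steps of local executions (only if executing, not asleep), MAP and REDUCE. A local input from $c$ takes the first item on $c$ in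 the local input queue; if there is none, the execution falls asleep with an input signal on $c$. A local output to $c$ appends the item to the local output queue, and the execution moves past the instruction and falls asleep with an output signal on $c$. When MAP (REDUCE) is $\mathbf{skip}$, it may take, and thereby clear, any pending input (output) signal, from $\pi[i]$ on $c$ say, and runs its program for $(i,c)$ from memory $m_0$. MAP's instruction $\mathbf{input}\ x\ \mathbf{from}\ c$ is enabled only if the first item of the global input queue is on $c$, and consumes it. *Broadcast*$(c)$ is: input $x$ from $c$; append $(c=x)$ to the local input queues of all $j$ with $t\in T_M[j][c]$; append $(c=\delta(c))$ to those of all other $j$; wake all executions that sleep on an input from $c$ and have an item on $c$ in their local input queue. *Default*$(i,c)$ is: append $(c=\delta(c))$ to the local input queue of $\pi[i]$; wake $\pi[i]$. Waking makes the execution executing and clears its signal. The MAP programs for $(i,c)$ are: - RI: if $a\in T_M[i][c]$ then Broadcast$(c)$, else skip. - NI: if $a\in T_M[i][c]$ then Broadcast$(c)$; else if $t\notin T_M[i][c]$ then Default$(i,c)$; else skip. - DI: first, if $c$ is high and $i=0$, push a sleeping clone of $\pi[0]$ on the stack; then, if $a\in T_M[i][c]$, do Broadcast$(c)$ if $t\in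 T_M[i][c]$ and Default$(i,c)$ otherwise; if $a\notin T_M[i][c]$, skip. $T_M$ on high channels is $at$ for $\pi[0]$, and for $\pi[1]$ it is $a$ (RI, DI) or empty (NI); on low channels it is $t$ for $\pi[0]$ and $at$ for $\pi[1]$; DI clones have $a$ on high and $t$ on low channels. The REDUCE program for $(i,c)$ in all three configurations is: $x:=\delta(c)$; if $a\in T_R[i][c]$, read into $x$ the first value on $c$ in the local output queue of $\pi[i]$; if $t\in T_R[i][c]$, append $(c=x)$ to the global output; remove the first item on $c$ from the local output queue of $\pi[i]$; wake $\pi[i]$. $T_R$ is $at$ for $\pi[0]$ on high and for $\pi[1]$ on low channels, and empty otherwise. *Behaviour.* $EM_\delta(\pi),I\Downarrow O$ means that some run reaches a configuration with empty global input and global output $O$ in which MAP, REDUCE and all local executions are $\mathbf{skip}$ and no local execution is asleep. *Properties* of a family of relations $I\Downarrow_\delta O$ ("default" means carrying the value $\delta(c)$ of its channel $c$): - RI: for all $I,\delta,O$ with $I\Downarrow_\delta O$ there are $I',O'$ such that $I'=_LI$, all high items of $I'$ are default, $|I'|_c|\le|I|_c|$ for all $c\in C_{in}$, $I'\Downarrow_\delta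 O'$ and $O'=_LO$. - DI: for all $I,\delta,O$ with $I\Downarrow_\delta O$ and $I=I_1.(c=v).I_2$, where $c$ is high and all high items of $I_2$ are default, there are $I',I_2',O'$ such that $I'=I_1.(c=\delta(c)).I_2'$, $I'=_LI$, all high items of $I_2'$ are default, $I'\Downarrow_\delta O'$ and $O'=_LO$. - TINI: for all $\delta,I,I',O,O'$, if $I'=_LI$, $I\Downarrow_\delta O$ and $I'\Downarrow_\delta O'$, then $O'=_LO$. *Claim.* For every program $\pi$: the relations $EM_\delta(\pi),I\Downarrow O$ of the RI configuration satisfy RI, those of the DI configuration satisfy DI, and those of the NI configuration satisfy TINI (termination-insensitive non-interference). -/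

import Mathlib

namespace MapReduce

universe u v w

/-! ### Values, memories, channels, queues -/

/-- Values are booleans or non-negative integers. -/
inductive Val where
  | bool (b : Bool)
  | nat (n : ℕ)

abbrev Var := ℕ

abbrev Mem := Var → Val

/-- An expression is given by its meaning: a partial function from memories to values
(evaluation may be undefined, e.g. on ill-typed arguments). This covers every
deterministic expression language. -/
abbrev Expr := Mem → Option Val

inductive Level where
  | low
  | high
  deriving DecidableEq

/-- Every input/output vector is defined on exactly one channel, so it is represented by this
channel and the value it carries there. -/
abbrev Item (C : Type u) := C × Val

abbrev Queue (C : Type u) := List (Item C)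

/-- The restriction `Q|_l` of a queue to a security level. -/
def Queue.atLevel {C : Type u} (lvl : C → Level) (l : Level) (Q : Queue C) : Queue C :=
  Q.filter (fun q => decide (lvl q.1 = l))

/-- The restriction `Q|_c` of a queue to a channel. -/
def Queue.onChan {C : Type u} [DecidableEq C] (c : C) (Q : Queue C) : Queue C :=
  Q.filter (fun q => decide (q.1 = c))

/-- Low equivalence of queues: the same sequence of low items. -/
def LowEq {C : Type u} (lvl : C → Level) (Q Q' : Queue C) : Prop :=
  Queue.atLevel lvl .low Q = Queue.atLevel lvl .low Q'

/-- The first value on channel `c` in the queue together with the queue from which that item has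
been removed; `none` if there is no item on channel `c`. -/
def dequeue {C : Type u} [DecidableEq C] (c : C) : Queue C → Option (Val × Queue C)
  | [] => none
  | (d, x) :: Q =>
      if d = c then some (x, Q) else (dequeue c Q).map (fun r => (r.1, (d, x) :: r.2))

/-- Remove the first item on channel `c`, if there is one. -/
def remove {C : Type u} [DecidableEq C] (c : C) (Q : Queue C) : Queue C :=
  Q.eraseP (fun q => decide (q.1 = c))

/-! ### The command language, shared by controlled programs, MAP and REDUCE -/

/-- Commands over a type `E` of expressions and a type `A` of further atomic instructions. -/
inductive Cmd (E : Type u) (A : Type v) where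
  | skip
  | assign (x : Var) (e : E)
  | seq (p q : Cmd E A)
  | ite (e : E) (p q : Cmd E A)
  | while (e : E) (p : Cmd E A)
  | atom (a : A)

infixr:60 " ⨾ " => Cmd.seq

/-- The atomic instruction that the command executes next, if its next instruction is one. -/
def Cmd.head {E : Type u} {A : Type v} : Cmd E A → Option A
  | .seq p _ => p.head
  | .atom a => some a
  | _ => none

/-- Small-step semantics of commands on states `σ`; `act a s p' s'` says that instruction `a`
executed in state `s` leaves the command `p'` and the state `s'`. -/
inductive Cmd.Step {E : Type u} {A : Type v} {σ : Type w}
    (eval : σ → E → Option Val) (store : σ → Var → Val → σ)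
    (act : A → σ → Cmd E A → σ → Prop) : Cmd E A → σ → Cmd E A → σ → Prop
  | assign {s x e y} (h : eval s e = some y) :
      Step eval store act (.assign x e) s .skip (store s x y)
  | comp {p p' q s s'} (h : Step eval store act p s p' s') :
      Step eval store act (p ⨾ q) s (p' ⨾ q) s'
  | ifT {s e p q} (h : eval s e = some (.bool true)) :
      Step eval store act (.ite e p q) s p s
  | ifF {s e p q} (h : eval s e = some (.bool false)) :
      Step eval store act (.ite e p q) s q s
  | whileT {s e p} (h : eval s e = some (.bool true)) :
      Step eval store act (.while e p) s (p ⨾ .while e p) s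
  | whileF {s e p} (h : eval s e = some (.bool false)) :
      Step eval store act (.while e p) s .skip s
  | skip {s p} : Step eval store act (.skip ⨾ p) s p s
  | atom {a s p' s'} (h : act a s p' s') : Step eval store act (.atom a) s p' s'

/-! ### Controlled programs -/

inductive IOInstr (CIn : Type u) (COut : Type v) where
  | input (x : Var) (c : CIn)
  | output (e : Expr) (c : COut)

abbrev Prog (CIn : Type u) (COut : Type v) := Cmd Expr (IOInstr CIn COut)

structure ProgState (CIn : Type u) (COut : Type v) where
  mem : Mem
  inp : Queue CIn
  out : Queue COut

inductive ProgAct {CIn : Type u} {COut : Type v} :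
    IOInstr CIn COut → ProgState CIn COut → Prog CIn COut → ProgState CIn COut → Prop
  | input {x c y I s} (h : s.inp = (c, y) :: I) :
      ProgAct (.input x c) s .skip { s with mem := Function.update s.mem x y, inp := I }
  | output {e c y s} (h : e s.mem = some y) :
      ProgAct (.output e c) s .skip { s with out := s.out ++ [(c, y)] }

def ProgStep {CIn : Type u} {COut : Type v}
    (γ γ' : Prog CIn COut × ProgState CIn COut) : Prop :=
  Cmd.Step (fun s e => e s.mem) (fun s x y => { s with mem := Function.update s.mem x y })
    ProgAct γ.1 γ.2 γ'.1 γ'.2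

/-- The choice of the default value `val_def` for every channel. -/
structure Defaults (CIn : Type u) (COut : Type v) where
  inp : CIn → Val
  out : COut → Val

/-- The big-step behaviour of a program or of an enforcement mechanism: `B δ I O` says that, for
the choice `δ` of default values, some execution on the input `I` consumes `I` completely and
terminates with the output `O`. -/
abbrev Behaviour (CIn : Type u) (COut : Type v) :=
  Defaults CIn COut → Queue CIn → Queue COut → Prop

/-- The behaviour of a controlled program; it does not depend on the default values. -/
def progBehaviour {CIn : Type u} {COut : Type v} (m₀ : Mem) (π : Prog CIn COut) :
    Behaviour CIn COut :=
  fun _ I O => ∃ m, Relation.ReflTransGen ProgStep (π, ⟨m₀, I, []⟩) (.skip, ⟨m, [], O⟩)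

/-! ### Information flow properties -/

/-- All items of the queue carry the default value of their channel. -/
def DefSeq {CIn : Type u} {COut : Type v} (δ : Defaults CIn COut) (Q : Queue CIn) : Prop :=
  ∀ q ∈ Q, q.2 = δ.inp q.1

/-- Removal of inputs. -/
def RI {CIn : Type u} {COut : Type v} [DecidableEq CIn]
    (lvlIn : CIn → Level) (lvlOut : COut → Level) (B : Behaviour CIn COut) : Prop :=
  ∀ (I : Queue CIn) (δ : Defaults CIn COut) (O : Queue COut), B δ I O →
    ∃ (I' : Queue CIn) (O' : Queue COut),
      LowEq lvlIn I' I ∧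
      DefSeq δ (Queue.atLevel lvlIn .high I') ∧
      (∀ c, (Queue.onChan c I').length ≤ (Queue.onChan c I).length) ∧
      B δ I' O' ∧ LowEq lvlOut O' O

/-- Deletion of inputs: a high item `(c, y)` after which all high items are default ones can be
replaced by the default item of its channel, where default high items may be inserted or removed
behind it. -/
def DI {CIn : Type u} {COut : Type v}
    (lvlIn : CIn → Level) (lvlOut : COut → Level) (B : Behaviour CIn COut) : Prop :=
  ∀ (I : Queue CIn) (δ : Defaults CIn COut) (O : Queue COut)
    (I₁ I₂ : Queue CIn) (c : CIn) (y : Val),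
    I = I₁ ++ (c, y) :: I₂ → lvlIn c = .high → DefSeq δ (Queue.atLevel lvlIn .high I₂) →
    B δ I O →
    ∃ (I' I₁' I₂' : Queue CIn) (O' : Queue COut),
      I' = I₁' ++ I₂' ∧
      I₁' = I₁ ++ [(c, δ.inp c)] ∧
      LowEq lvlIn I' I ∧
      DefSeq δ (Queue.atLevel lvlIn .high I₂') ∧
      B δ I' O' ∧ LowEq lvlOut O' O

/-- Termination-insensitive non-interference. -/
def TINI {CIn : Type u} {COut : Type v}
    (lvlIn : CIn → Level) (lvlOut : COut → Level) (B : Behaviour CIn COut) : Prop :=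
  ∀ (δ : Defaults CIn COut) (I I' : Queue CIn) (O O' : Queue COut),
    LowEq lvlIn I' I → B δ I O → B δ I' O' → LowEq lvlOut O' O

/-! ### Local executions -/

inductive Status where
  | executing
  | sleeping
  deriving DecidableEq

/-- Interrupt signals for input and for output requests. -/
inductive Signal (CIn : Type u) (COut : Type v) where
  | inp (c : CIn)
  | out (c : COut)

structure LocalConf (CIn : Type u) (COut : Type v) where
  stt : Status
  int : Option (Signal CIn COut)
  prg : Prog CIn COut
  mem : Mem
  inp : Queue CIn
  out : Queue COut

/-- Input and output instructions of local executions. An input whose item is not in the local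
queue raises a signal and is left to be executed again; an output is put into the local output
queue and raises a signal. (The field `prg` is handled by `LocalStep`.) -/
inductive LocalAct {CIn : Type u} {COut : Type v} [DecidableEq CIn] :
    IOInstr CIn COut → LocalConf CIn COut → Prog CIn COut → LocalConf CIn COut → Prop
  | inp₁ {x c y I s} (h : dequeue c s.inp = some (y, I)) :
      LocalAct (.input x c) s .skip { s with mem := Function.update s.mem x y, inp := I }
  | inp₂ {x c s} (h : dequeue c s.inp = none) (hint : s.int = none) :
      LocalAct (.input x c) s (.atom (.input x c))
        { s with stt := .sleeping, int := some (.inp c) }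
  | outp {e c y s} (h : e s.mem = some y) (hint : s.int = none) :
      LocalAct (.output e c) s .skip
        { s with stt := .sleeping, int := some (.out c), out := s.out ++ [(c, y)] }

/-- A step of a local execution; only executions in the executing state move. -/
def LocalStep {CIn : Type u} {COut : Type v} [DecidableEq CIn]
    (e e' : LocalConf CIn COut) : Prop :=
  e.stt = .executing ∧ ∃ p' s',
    Cmd.Step (fun s a => a s.mem) (fun s x y => { s with mem := Function.update s.mem x y })
      LocalAct e.prg e p' s' ∧
    e' = { s' with prg := p' }

/-! ### MAP, REDUCE and the enforcement mechanism -/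

/-- The privileges ask and tell. -/
inductive Priv where
  | ask
  | tell
  deriving DecidableEq

/-- A table has one column of privileges for every local execution. -/
abbrev Table (C : Type u) := List (C → Finset Priv)

/-- The entry `T[i][c]` (no privileges if there is no column `i`). -/
def Table.priv {C : Type u} (T : Table C) (i : ℕ) (c : C) : Finset Priv :=
  match T[i]? with
  | some col => col c
  | none => ∅

/-- Expressions of MAP and REDUCE programs, which can also inspect `T_M` and `T_R`. -/
abbrev CExpr (CIn : Type u) (COut : Type v) := Table CIn → Table COut → Mem → Option Val

/-- Predicates on local executions (given by their index). -/
abbrev LPred (CIn : Type u) (COut : Type v) :=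
  Table CIn → Table COut → List (LocalConf CIn COut) → ℕ → Bool

inductive MapInstr (CIn : Type u) (COut : Type v) where
  | input (x : Var) (c : CIn)
  | map (e : CExpr CIn COut) (c : CIn) (P : LPred CIn COut)
  | wake (P : LPred CIn COut)
  | clone (P : LPred CIn COut) (privM : CIn → Finset Priv) (privR : COut → Finset Priv)

inductive RedInstr (CIn : Type u) (COut : Type v) where
  | retrieve (x : Var) (i : ℕ) (c : COut)
  | output (e : CExpr CIn COut) (c : COut)
  | wake (P : LPred CIn COut)
  | clean (c : COut) (P : LPred CIn COut)

abbrev MapProg (CIn : Type u) (COut : Type v) := Cmd (CExpr CIn COut) (MapInstr CIn COut)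

abbrev RedProg (CIn : Type u) (COut : Type v) := Cmd (CExpr CIn COut) (RedInstr CIn COut)

/-- A configuration of the enforcement mechanism; `ex` is the stack of local executions
`π[0], …, π[TOP]`. -/
structure EMConf (CIn : Type u) (COut : Type v) where
  tm : Table CIn
  tr : Table COut
  ex : List (LocalConf CIn COut)
  mapPrg : MapProg CIn COut
  mapMem : Mem
  redPrg : RedProg CIn COut
  redMem : Mem
  inp : Queue CIn
  out : Queue COut

/-- The truth value of a predicate on the local execution `i` of a configuration. -/
def EMConf.sat {CIn : Type u} {COut : Type v} (γ : EMConf CIn COut) (P : LPred CIn COut)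
    (i : ℕ) : Bool :=
  P γ.tm γ.tr γ.ex i

/-- Apply `f` to all local executions that satisfy `P`. -/
def EMConf.modify {CIn : Type u} {COut : Type v} (γ : EMConf CIn COut) (P : LPred CIn COut)
    (f : LocalConf CIn COut → LocalConf CIn COut) : EMConf CIn COut :=
  { γ with ex := γ.ex.mapIdx (fun i e => if γ.sat P i then f e else e) }

/-- The copies, made by a clone instruction, of the local executions that satisfy `P`. -/
def EMConf.forks {CIn : Type u} {COut : Type v} (γ : EMConf CIn COut) (P : LPred CIn COut) :
    List (LocalConf CIn COut) :=
  (γ.ex.mapIdx (fun i e =>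
    if γ.sat P i then some { e with stt := Status.sleeping } else none)).reduceOption

/-- All local executions that satisfy `P` are asleep. -/
def EMConf.Asleep {CIn : Type u} {COut : Type v} (γ : EMConf CIn COut) (P : LPred CIn COut) :
    Prop :=
  ∀ i e, γ.ex[i]? = some e → γ.sat P i = true → e.stt = .sleeping

inductive MapAct {CIn : Type u} {COut : Type v} :
    MapInstr CIn COut → EMConf CIn COut → MapProg CIn COut → EMConf CIn COut → Prop
  | input {x c y I γ} (h : γ.inp = (c, y) :: I) :
      MapAct (.input x c) γ .skip
        { γ with inp := I, mapMem := Function.update γ.mapMem x y }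
  | map {e c P y γ} (h : e γ.tm γ.tr γ.mapMem = some y) :
      MapAct (.map e c P) γ .skip (γ.modify P (fun l => { l with inp := l.inp ++ [(c, y)] }))
  | wake {P γ} (h : γ.Asleep P) :
      MapAct (.wake P) γ .skip (γ.modify P (fun l => { l with int := none, stt := .executing }))
  | clone {P privM privR γ} :
      MapAct (.clone P privM privR) γ .skip
        { γ with
          ex := γ.ex ++ γ.forks P
          tm := γ.tm ++ List.replicate (γ.forks P).length privM
          tr := γ.tr ++ List.replicate (γ.forks P).length privR }

inductive RedAct {CIn : Type u} {COut : Type v} [DecidableEq COut] :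
    RedInstr CIn COut → EMConf CIn COut → RedProg CIn COut → EMConf CIn COut → Prop
  | retrieve {x i c e y Q γ} (he : γ.ex[i]? = some e) (h : dequeue c e.out = some (y, Q)) :
      RedAct (.retrieve x i c) γ .skip { γ with redMem := Function.update γ.redMem x y }
  | output {e c y γ} (h : e γ.tm γ.tr γ.redMem = some y) :
      RedAct (.output e c) γ .skip { γ with out := γ.out ++ [(c, y)] }
  | wake {P γ} (h : γ.Asleep P) :
      RedAct (.wake P) γ .skip (γ.modify P (fun l => { l with int := none, stt := .executing }))
  | clean {c P γ} :
      RedAct (.clean c P) γ .skip (γ.modify P (fun l => { l with out := remove c l.out }))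

/-- A configuration of the framework: the programs run by MAP and REDUCE on a request from the
local execution `i` on channel `c`, and the initial tables `T_M` and `T_R`. -/
structure Mechanism (CIn : Type u) (COut : Type v) where
  mapProg : ℕ → CIn → MapProg CIn COut
  redProg : ℕ → COut → RedProg CIn COut
  tm : Table CIn
  tr : Table COut

/-- A step of the enforcement mechanism: a step of a local execution, of MAP or of REDUCE, or the
activation of MAP or REDUCE by the signal of a sleeping local execution. (An output signal shows
that the execution sleeps on an output instruction: that instruction has already been replaced
by `skip` when the signal is sent.) -/
inductive EMStep {CIn : Type u} {COut : Type v} [DecidableEq CIn] [DecidableEq COut]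
    (m₀ : Mem) (M : Mechanism CIn COut) : EMConf CIn COut → EMConf CIn COut → Prop
  | exec {γ i e e'} (hi : γ.ex[i]? = some e) (h : LocalStep e e') :
      EMStep m₀ M γ { γ with ex := γ.ex.set i e' }
  | map {γ p' γ'}
      (h : Cmd.Step (fun s a => a s.tm s.tr s.mapMem)
        (fun s x y => { s with mapMem := Function.update s.mapMem x y })
        MapAct γ.mapPrg γ p' γ') :
      EMStep m₀ M γ { γ' with mapPrg := p' }
  | red {γ p' γ'}
      (h : Cmd.Step (fun s a => a s.tm s.tr s.redMem)
        (fun s x y => { s with redMem := Function.update s.redMem x y })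
        RedAct γ.redPrg γ p' γ') :
      EMStep m₀ M γ { γ' with redPrg := p' }
  | mapActivate {γ i e c x} (hp : γ.mapPrg = .skip) (hi : γ.ex[i]? = some e)
      (hs : e.stt = .sleeping) (hint : e.int = some (.inp c))
      (hprg : e.prg.head = some (.input x c)) :
      EMStep m₀ M γ
        { γ with ex := γ.ex.set i { e with int := none }
                 mapPrg := M.mapProg i c
                 mapMem := m₀ }
  | redActivate {γ i e c} (hp : γ.redPrg = .skip) (hi : γ.ex[i]? = some e)
      (hs : e.stt = .sleeping) (hint : e.int = some (.out c)) :
      EMStep m₀ M γ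
        { γ with ex := γ.ex.set i { e with int := none }
                 redPrg := M.redProg i c
                 redMem := m₀ }

/-- The initial configuration: one fresh instance of `π` for every column of `T_M`. -/
def EMConf.init {CIn : Type u} {COut : Type v} (m₀ : Mem) (M : Mechanism CIn COut)
    (π : Prog CIn COut) (I : Queue CIn) : EMConf CIn COut where
  tm := M.tm
  tr := M.tr
  ex := List.replicate M.tm.length
    { stt := .executing, int := none, prg := π, mem := m₀, inp := [], out := [] }
  mapPrg := .skip
  mapMem := m₀
  redPrg := .skip
  redMem := m₀
  inp := I
  out := []

/-- Final configurations. A local execution that still sleeps after an output instruction (its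
output has not been handled by REDUCE yet) has not terminated. -/
def EMConf.Final {CIn : Type u} {COut : Type v} (γ : EMConf CIn COut) : Prop :=
  γ.inp = [] ∧ γ.mapPrg = .skip ∧ γ.redPrg = .skip ∧
    ∀ e ∈ γ.ex, e.prg = .skip ∧ e.stt = .executing

/-- The behaviour of the enforcement mechanism on `π`. The framework configuration may use the
default values. -/
def emBehaviour {CIn : Type u} {COut : Type v} [DecidableEq CIn] [DecidableEq COut]
    (m₀ : Mem) (M : Defaults CIn COut → Mechanism CIn COut) (π : Prog CIn COut) :
    Behaviour CIn COut :=
  fun δ I O => ∃ γ, Relation.ReflTransGen (EMStep m₀ (M δ)) (EMConf.init m₀ (M δ) π I) γ ∧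
    γ.Final ∧ γ.out = O

/-- An enforcement mechanism is sound for a property if, for every program, the mechanism executed
on it satisfies the property. -/
def Sound {CIn : Type u} {COut : Type v} [DecidableEq CIn] [DecidableEq COut]
    (m₀ : Mem) (M : Defaults CIn COut → Mechanism CIn COut)
    (P : Behaviour CIn COut → Prop) : Prop :=
  ∀ π : Prog CIn COut, P (emBehaviour m₀ M π)

/-! ### The selected configurations -/

/-- The variable `x` of the MAP and REDUCE programs. -/
def varX : Var := 0

def readX {CIn : Type u} {COut : Type v} : CExpr CIn COut := fun _ _ m => some (m varX)

def const {CIn : Type u} {COut : Type v} (y : Val) : CExpr CIn COut := fun _ _ _ => some y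

/-- The condition `p ∈ T_M[i][c]`. -/
def inTM {CIn : Type u} {COut : Type v} (p : Priv) (i : ℕ) (c : CIn) : CExpr CIn COut :=
  fun tm _ _ => some (.bool (decide (p ∈ tm.priv i c)))

/-- The condition `p ∉ T_M[i][c]`. -/
def notInTM {CIn : Type u} {COut : Type v} (p : Priv) (i : ℕ) (c : CIn) : CExpr CIn COut :=
  fun tm _ _ => some (.bool (decide (p ∉ tm.priv i c)))

/-- The condition `p ∈ T_R[i][c]`. -/
def inTR {CIn : Type u} {COut : Type v} (p : Priv) (i : ℕ) (c : COut) : CExpr CIn COut :=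
  fun _ tr _ => some (.bool (decide (p ∈ tr.priv i c)))

def canTell {CIn : Type u} {COut : Type v} (c : CIn) : LPred CIn COut :=
  fun tm _ _ i => decide (Priv.tell ∈ tm.priv i c)

def notCanTell {CIn : Type u} {COut : Type v} (c : CIn) : LPred CIn COut :=
  fun tm _ _ i => decide (Priv.tell ∉ tm.priv i c)

def identical {CIn : Type u} {COut : Type v} (j : ℕ) : LPred CIn COut :=
  fun _ _ _ i => decide (i = j)

/-- The next instruction is an input from `c`. -/
def nextIsInput {CIn : Type u} {COut : Type v} [DecidableEq CIn] (c : CIn)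
    (p : Prog CIn COut) : Bool :=
  match p.head with
  | some (.input _ d) => decide (d = c)
  | _ => false

/-- The local execution sleeps on an input from `c`, and an item on `c` is in its queue. -/
def isReady {CIn : Type u} {COut : Type v} [DecidableEq CIn] (c : CIn) : LPred CIn COut :=
  fun _ _ ex i =>
    match ex[i]? with
    | some e => decide (e.stt = .sleeping) && nextIsInput c e.prg && (dequeue c e.inp).isSome
    | none => false

/-- The column with privileges `h` on high channels and `l` on low channels. -/
def column {C : Type u} (lvl : C → Level) (h l : Finset Priv) : C → Finset Priv :=
  fun c => match lvl c with
    | .high => h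
    | .low => l

/-- Read an item from the environment, distribute it (or the default value), wake up. -/
def mapBroadcast {CIn : Type u} {COut : Type v} [DecidableEq CIn]
    (δ : Defaults CIn COut) (c : CIn) : MapProg CIn COut :=
  .atom (.input varX c) ⨾
  .atom (.map readX c (canTell c)) ⨾
  .atom (.map (const (δ.inp c)) c (notCanTell c)) ⨾
  .atom (.wake (isReady c))

/-- Send the default value to the local execution `i` only, wake it up. -/
def mapDefault {CIn : Type u} {COut : Type v}
    (δ : Defaults CIn COut) (i : ℕ) (c : CIn) : MapProg CIn COut :=
  .atom (.map (const (δ.inp c)) c (identical i)) ⨾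
  .atom (.wake (identical i))

def mapRI {CIn : Type u} {COut : Type v} [DecidableEq CIn]
    (δ : Defaults CIn COut) (i : ℕ) (c : CIn) : MapProg CIn COut :=
  .ite (inTM .ask i c) (mapBroadcast δ c) .skip

def mapNI {CIn : Type u} {COut : Type v} [DecidableEq CIn]
    (δ : Defaults CIn COut) (i : ℕ) (c : CIn) : MapProg CIn COut :=
  .ite (inTM .ask i c)
    (mapBroadcast δ c)
    (.ite (notInTM .tell i c) (mapDefault δ i c) .skip)

def mapDI {CIn : Type u} {COut : Type v} [DecidableEq CIn]
    (lvlIn : CIn → Level) (lvlOut : COut → Level)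
    (δ : Defaults CIn COut) (i : ℕ) (c : CIn) : MapProg CIn COut :=
  .ite (const (.bool (decide (lvlIn c = .high ∧ i = 0))))
    (.atom (.clone (identical i) (column lvlIn {.ask} {.tell}) (column lvlOut ∅ ∅)))
    .skip ⨾
  .ite (inTM .ask i c)
    (.ite (inTM .tell i c) (mapBroadcast δ c) (mapDefault δ i c))
    .skip

/-- The REDUCE program, common to all three configurations. -/
def reduceAll {CIn : Type u} {COut : Type v}
    (δ : Defaults CIn COut) (i : ℕ) (c : COut) : RedProg CIn COut :=
  .assign varX (const (δ.out c)) ⨾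
  .ite (inTR .ask i c) (.atom (.retrieve varX i c)) .skip ⨾
  .ite (inTR .tell i c) (.atom (.output readX c)) .skip ⨾
  .atom (.clean c (identical i)) ⨾
  .atom (.wake (identical i))

/-- The table `T_R` (for the executions 0 and 1), common to all three configurations. -/
def tableR {COut : Type v} (lvlOut : COut → Level) : Table COut :=
  [column lvlOut {.ask, .tell} ∅, column lvlOut ∅ {.ask, .tell}]

def mechRI {CIn : Type u} {COut : Type v} [DecidableEq CIn]
    (lvlIn : CIn → Level) (lvlOut : COut → Level) (δ : Defaults CIn COut) :
    Mechanism CIn COut where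
  mapProg := mapRI δ
  redProg := reduceAll δ
  tm := [column lvlIn {.ask, .tell} {.tell}, column lvlIn {.ask} {.ask, .tell}]
  tr := tableR lvlOut

def mechDI {CIn : Type u} {COut : Type v} [DecidableEq CIn]
    (lvlIn : CIn → Level) (lvlOut : COut → Level) (δ : Defaults CIn COut) :
    Mechanism CIn COut where
  mapProg := mapDI lvlIn lvlOut δ
  redProg := reduceAll δ
  tm := [column lvlIn {.ask, .tell} {.tell}, column lvlIn {.ask} {.ask, .tell}]
  tr := tableR lvlOut

def mechNI {CIn : Type u} {COut : Type v} [DecidableEq CIn]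
    (lvlIn : CIn → Level) (lvlOut : COut → Level) (δ : Defaults CIn COut) :
    Mechanism CIn COut where
  mapProg := mapNI δ
  redProg := reduceAll δ
  tm := [column lvlIn {.ask, .tell} {.tell}, column lvlIn ∅ {.ask, .tell}]
  tr := tableR lvlOut

end MapReduce

/-! The low behaviour of the mechanism is that of local execution 1 alone. Only its low outputs
reach the environment, only it asks for low items, and on high channels it is given nothing but
default values. Projecting a terminating run of the mechanism onto execution 1 therefore yields a
run of the bare program, a `Halts` trace, that reads the low items of the input in their order,
reads defaults on high channels, and sends the low output of the mechanism (`emBehaviour_halts`).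
Programs are deterministic up to the values they receive, so the outputs of such a trace depend on
its low inputs only (`Halts.outs_eq`), and this is TINI.

RI and DI also require the existence of a run on a new input. Such a run is scheduled sequentially:
execution 1 goes to its end, after it execution 0, after it each clone (`Quiet.finish`). The danger
is that MAP blocks when the first item of the environment is not on the requested channel, so the
new input is ordered exactly as this schedule requests it. For RI it is the sequence that execution
1 has read: execution 1 asks for the items one by one, and execution 0 later finds copies of them in
its own queue.

For DI the given run is cut where MAP is about to consume the item to be replaced (`Inv.split`). The
requester is execution 0, and a clone in exactly its state is on the stack. The given run also
terminates the clone, which reads only defaults on high channels, beginning with the one it waits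
for. Hence execution 0 can follow the trace of its clone once the environment offers this default
item. The remaining input consists of the low items still to come, for execution 1, followed by the
high items of the clone's trace, for execution 0. High requests of all other executions are answered
by MAP without consuming anything.

Two invariants make the bookkeeping possible. The execution that asks for the items of a level holds
at most one unread item of it (`Served`), so it reads them in the order of the environment; for the
others only the order on each channel is known. And requests do not get lost: an execution asleep on
an input has a pending signal, or MAP is dealing with it, or it is one whose low requests are
ignored (`MapInv.signal`). -/

namespace MapReduce

universe u v

/-! ### Queues: taking items and restricting to levels and channels -/

section Queues

variable {C : Type u} [DecidableEq C]

/-- The queue has an item on the channel. -/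
def Has (c : C) (Q : Queue C) : Prop := ∃ y, (c, y) ∈ Q

theorem dequeue_eq_none {c : C} {Q : Queue C} : dequeue c Q = none ↔ ¬ Has c Q := by
  induction Q with
  | nil => simp [dequeue, Has]
  | cons q Q ih =>
    obtain ⟨d, x⟩ := q
    by_cases h : d = c
    · subst h; simp [dequeue, Has]
    · have h' : ¬ c = d := fun e => h e.symm
      simp [dequeue, h, ih, Has, h']

theorem dequeue_eq_some {c : C} {Q Q' : Queue C} {y : Val} (h : dequeue c Q = some (y, Q')) :
    ∃ A B, Q = A ++ (c, y) :: B ∧ Q' = A ++ B ∧ ∀ q ∈ A, q.1 ≠ c := by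
  induction Q generalizing Q' with
  | nil => simp [dequeue] at h
  | cons q Q ih =>
    obtain ⟨d, x⟩ := q
    by_cases hd : d = c
    · simp only [dequeue, hd, if_true, Option.some.injEq, Prod.mk.injEq] at h
      obtain ⟨rfl, rfl⟩ := h
      exact ⟨[], Q, by simp [hd], rfl, by simp⟩
    · simp only [dequeue, hd, if_false, Option.map_eq_some_iff, Prod.mk.injEq] at h
      obtain ⟨⟨y', R⟩, hr, rfl, rfl⟩ := h
      obtain ⟨A, B, rfl, rfl, hA⟩ := ih hr
      refine ⟨(d, x) :: A, B, rfl, rfl, ?_⟩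
      intro q hq
      rcases List.mem_cons.1 hq with rfl | hq
      · exact hd
      · exact hA q hq

theorem exists_dequeue {c : C} {Q : Queue C} (h : Has c Q) :
    ∃ y Q', dequeue c Q = some (y, Q') := by
  rcases hd : dequeue c Q with _ | ⟨y, Q'⟩
  · exact absurd h (dequeue_eq_none.1 hd)
  · exact ⟨y, Q', rfl⟩

omit [DecidableEq C] in
@[simp] theorem Has.append {c : C} {Q R : Queue C} : Has c (Q ++ R) ↔ Has c Q ∨ Has c R := by
  simp [Has, exists_or]

omit [DecidableEq C] in
@[simp] theorem Has.singleton {c d : C} {v : Val} : Has c [(d, v)] ↔ c = d := by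
  simp [Has]

omit [DecidableEq C] in
@[simp] theorem Has.nil {c : C} : ¬ Has c ([] : Queue C) := by
  simp [Has]

omit [DecidableEq C] in
theorem atLevel_append (lvl : C → Level) (l : Level) (Q R : Queue C) :
    Queue.atLevel lvl l (Q ++ R) = Queue.atLevel lvl l Q ++ Queue.atLevel lvl l R := by
  simp [Queue.atLevel]

omit [DecidableEq C] in
theorem atLevel_cons_of_eq {lvl : C → Level} {l : Level} {c : C} (h : lvl c = l) (y : Val)
    (Q : Queue C) : Queue.atLevel lvl l ((c, y) :: Q) = (c, y) :: Queue.atLevel lvl l Q := by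
  simp [Queue.atLevel, h]

omit [DecidableEq C] in
theorem atLevel_cons_of_ne {lvl : C → Level} {l : Level} {c : C} (h : lvl c ≠ l) (y : Val)
    (Q : Queue C) : Queue.atLevel lvl l ((c, y) :: Q) = Queue.atLevel lvl l Q := by
  simp [Queue.atLevel, h]

omit [DecidableEq C] in
@[simp] theorem atLevel_nil (lvl : C → Level) (l : Level) :
    Queue.atLevel lvl l ([] : Queue C) = [] := rfl

theorem onChan_append (c : C) (Q R : Queue C) :
    Queue.onChan c (Q ++ R) = Queue.onChan c Q ++ Queue.onChan c R := by
  simp [Queue.onChan]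

theorem onChan_cons_self (c : C) (y : Val) (Q : Queue C) :
    Queue.onChan c ((c, y) :: Q) = (c, y) :: Queue.onChan c Q := by
  simp [Queue.onChan]

theorem onChan_cons_of_ne {c d : C} (h : d ≠ c) (y : Val) (Q : Queue C) :
    Queue.onChan c ((d, y) :: Q) = Queue.onChan c Q := by
  simp [Queue.onChan, h]

theorem onChan_eq_nil {c : C} {Q : Queue C} (h : ∀ q ∈ Q, q.1 ≠ c) : Queue.onChan c Q = [] := by
  simpa [Queue.onChan] using h

theorem onChan_eq_nil_of_not_has {c : C} {Q : Queue C} (h : ¬ Has c Q) :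
    Queue.onChan c Q = [] :=
  onChan_eq_nil fun q hq e => h ⟨q.2, by rw [← e]; exact hq⟩

theorem onChan_atLevel {lvl : C → Level} {c : C} {l : Level} (h : lvl c = l) (Q : Queue C) :
    Queue.onChan c (Queue.atLevel lvl l Q) = Queue.onChan c Q := by
  simp only [Queue.onChan, Queue.atLevel, List.filter_filter]
  congr 1
  funext q
  by_cases hq : q.1 = c <;> simp [hq, h]

/-- Needed for RI, where MAP may replace values by defaults but keeps the channels. -/
theorem length_onChan_eq_of_map_fst {Q R : Queue C} (h : Q.map Prod.fst = R.map Prod.fst) (c : C) :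
    (Queue.onChan c Q).length = (Queue.onChan c R).length := by
  have key : ∀ Q : Queue C, (Queue.onChan c Q).length = (Q.map Prod.fst).countP (fun d => decide (d = c)) := by
    intro Q
    rw [List.countP_map, List.countP_eq_length_filter]; rfl
  rw [key, key, h]

theorem dequeue_onChan_self {c : C} {Q Q' : Queue C} {y : Val} (h : dequeue c Q = some (y, Q')) :
    Queue.onChan c Q = (c, y) :: Queue.onChan c Q' := by
  obtain ⟨A, B, rfl, rfl, hA⟩ := dequeue_eq_some h
  simp [onChan_append, onChan_cons_self, onChan_eq_nil hA]

theorem dequeue_onChan_of_ne {c d : C} {Q Q' : Queue C} {y : Val}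
    (h : dequeue c Q = some (y, Q')) (hd : c ≠ d) : Queue.onChan d Q = Queue.onChan d Q' := by
  obtain ⟨A, B, rfl, rfl, hA⟩ := dequeue_eq_some h
  simp [onChan_append, onChan_cons_of_ne hd]

theorem dequeue_atLevel_of_ne {lvl : C → Level} {l : Level} {c : C} {Q Q' : Queue C} {y : Val}
    (h : dequeue c Q = some (y, Q')) (hc : lvl c ≠ l) :
    Queue.atLevel lvl l Q = Queue.atLevel lvl l Q' := by
  obtain ⟨A, B, rfl, rfl, hA⟩ := dequeue_eq_some h
  simp [atLevel_append, atLevel_cons_of_ne hc]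

/-- A lone item of the level has no rival on another channel of that level. Together with `Served`
this turns the order on a channel, which is all that a local queue respects, into the order on the
level. -/
theorem dequeue_atLevel_of_singleton {lvl : C → Level} {l : Level} {c d : C} {Q Q' : Queue C}
    {y v : Val} (h : dequeue c Q = some (y, Q')) (hc : lvl c = l)
    (hs : Queue.atLevel lvl l Q = [(d, v)]) :
    d = c ∧ v = y ∧ Queue.atLevel lvl l Q' = [] := by
  obtain ⟨A, B, rfl, rfl, hA⟩ := dequeue_eq_some h
  rw [atLevel_append, atLevel_cons_of_eq hc] at hs
  rw [atLevel_append]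
  rcases hA' : Queue.atLevel lvl l A with _ | ⟨a, A'⟩
  · rw [hA'] at hs; simp at hs; simp [hs.1, hs.2]
  · rw [hA'] at hs; simp at hs

theorem dequeue_subset {c : C} {Q Q' : Queue C} {y : Val}
    (h : dequeue c Q = some (y, Q')) : ∀ q ∈ Q', q ∈ Q := by
  obtain ⟨A, B, rfl, rfl, hA⟩ := dequeue_eq_some h
  intro q hq
  simp only [List.mem_append, List.mem_cons] at hq ⊢
  tauto

theorem dequeue_mem {c : C} {Q Q' : Queue C} {y : Val}
    (h : dequeue c Q = some (y, Q')) : (c, y) ∈ Q := by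
  obtain ⟨A, B, rfl, rfl, hA⟩ := dequeue_eq_some h
  simp

theorem dequeue_cons_self (c : C) (y : Val) (Q : Queue C) :
    dequeue c ((c, y) :: Q) = some (y, Q) := by
  simp [dequeue]

omit [DecidableEq C] in
theorem atLevel_eq_nil_of_subset {lvl : C → Level} {l : Level} {Q Q' : Queue C}
    (h : ∀ q ∈ Q', q ∈ Q) (hQ : Queue.atLevel lvl l Q = []) : Queue.atLevel lvl l Q' = [] := by
  simp only [Queue.atLevel, List.filter_eq_nil_iff, decide_eq_true_eq] at hQ ⊢
  exact fun q hq => hQ q (h q hq)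

omit [DecidableEq C] in
theorem atLevel_atLevel_self (lvl : C → Level) (l : Level) (Q : Queue C) :
    Queue.atLevel lvl l (Queue.atLevel lvl l Q) = Queue.atLevel lvl l Q := by
  simp [Queue.atLevel]

omit [DecidableEq C] in
theorem atLevel_atLevel_of_ne (lvl : C → Level) {l l' : Level} (h : l' ≠ l) (Q : Queue C) :
    Queue.atLevel lvl l (Queue.atLevel lvl l' Q) = [] := by
  simp only [Queue.atLevel, List.filter_filter, List.filter_eq_nil_iff, Bool.and_eq_true,
    decide_eq_true_eq]
  rintro q _ ⟨h1, h2⟩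
  exact h (h2.symm.trans h1)

omit [DecidableEq C] in
theorem atLevel_ne_nil_of_mem {lvl : C → Level} {c : C} {y : Val} {Q : Queue C}
    (h : (c, y) ∈ Q) : Queue.atLevel lvl (lvl c) Q ≠ [] := by
  apply List.ne_nil_of_mem (a := (c, y))
  simp [Queue.atLevel, h]

end Queues

/-! ### Programs as open systems: labelled steps, traces, determinism -/

section Programs

variable {CIn : Type u} {COut : Type v}

/-- What a step of a program does on its channels. -/
inductive Lab (CIn : Type u) (COut : Type v) where
  | tau
  | inp (c : CIn) (y : Val)
  | out (c : COut) (y : Val)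

/-- The steps of a program that may receive any values. -/
inductive TStep : Prog CIn COut → Mem → Lab CIn COut → Prog CIn COut → Mem → Prop
  | assign {m x e y} (h : e m = some y) :
      TStep (.assign x e) m .tau .skip (Function.update m x y)
  | comp {p p' q m m' l} (h : TStep p m l p' m') : TStep (p ⨾ q) m l (p' ⨾ q) m'
  | ifT {m} {e : Expr} {p q} (h : e m = some (.bool true)) : TStep (.ite e p q) m .tau p m
  | ifF {m} {e : Expr} {p q} (h : e m = some (.bool false)) : TStep (.ite e p q) m .tau q m
  | whileT {m} {e : Expr} {p} (h : e m = some (.bool true)) :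
      TStep (.while e p) m .tau (p ⨾ .while e p) m
  | whileF {m} {e : Expr} {p} (h : e m = some (.bool false)) : TStep (.while e p) m .tau .skip m
  | skip {m p} : TStep (.skip ⨾ p) m .tau p m
  | inp {m x c y} : TStep (.atom (.input x c)) m (.inp c y) .skip (Function.update m x y)
  | out {m} {e : Expr} {c y} (h : e m = some y) : TStep (.atom (.output e c)) m (.out c y) .skip m

/-- The program runs to its end from the memory, receiving `ins` and sending `outs`. -/
inductive Halts : Prog CIn COut → Mem → Queue CIn → Queue COut → Prop
  | done {m} : Halts .skip m [] []
  | tau {p m p' m' i o} (h : TStep p m .tau p' m') (r : Halts p' m' i o) : Halts p m i o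
  | inp {p m p' m' c y i o} (h : TStep p m (.inp c y) p' m') (r : Halts p' m' i o) :
      Halts p m ((c, y) :: i) o
  | out {p m p' m' c y i o} (h : TStep p m (.out c y) p' m') (r : Halts p' m' i o) :
      Halts p m i ((c, y) :: o)

theorem TStep.not_skip {m m' : Mem} {l : Lab CIn COut} {p' : Prog CIn COut}
    (h : TStep .skip m l p' m') : False := by
  cases h

/-- Two labels that agree up to the value of an input. -/
def Lab.Similar : Lab CIn COut → Lab CIn COut → Prop
  | .tau, .tau => True
  | .inp c _, .inp d _ => c = d
  | .out c x, .out d y => c = d ∧ x = y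
  | _, _ => False

/-- Command and memory leave only the received value open. The two rules for sequences do not
overlap because `skip` has no step. -/
theorem TStep.det {p p₁ p₂ : Prog CIn COut} {m m₁ m₂ : Mem} {l₁ l₂ : Lab CIn COut}
    (h₁ : TStep p m l₁ p₁ m₁) (h₂ : TStep p m l₂ p₂ m₂) :
    l₁.Similar l₂ ∧ (l₁ = l₂ → p₁ = p₂ ∧ m₁ = m₂) := by
  induction h₁ generalizing p₂ m₂ with
  | comp h ih =>
    cases h₂ with
    | comp h' =>
      obtain ⟨a, b⟩ := ih h'
      refine ⟨a, fun e => ?_⟩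
      obtain ⟨rfl, rfl⟩ := b e
      exact ⟨rfl, rfl⟩
    | skip => exact h.not_skip.elim
  | skip =>
    cases h₂ with
    | comp h' => exact h'.not_skip.elim
    | skip => exact ⟨trivial, fun _ => ⟨rfl, rfl⟩⟩
  | _ => cases h₂ <;> simp_all [Lab.Similar]

/-- The outputs of a program are determined by its low inputs if its high inputs are default. -/
theorem Halts.outs_eq {lvl : CIn → Level} {dv : CIn → Val} {p : Prog CIn COut} {m : Mem}
    {i j : Queue CIn} {o r : Queue COut} (h : Halts p m i o) (h' : Halts p m j r)
    (hi : ∀ q ∈ i, lvl q.1 = .high → q.2 = dv q.1) (hj : ∀ q ∈ j, lvl q.1 = .high → q.2 = dv q.1)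
    (hl : LowEq lvl i j) : o = r := by
  induction h generalizing j r with
  | done =>
    cases h' with
    | done => rfl
    | tau h _ => exact h.not_skip.elim
    | inp h _ => exact h.not_skip.elim
    | out h _ => exact h.not_skip.elim
  | tau h _ ih =>
    cases h' with
    | done => exact h.not_skip.elim
    | tau h' r' =>
      obtain ⟨rfl, rfl⟩ := (h.det h').2 rfl
      exact ih r' hi hj hl
    | inp h' _ => exact (h.det h').1.elim
    | out h' _ => exact (h.det h').1.elim
  | @inp p m p' m' c y i o h _ ih =>
    cases h' with
    | done => exact h.not_skip.elim
    | tau h' _ => exact (h.det h').1.elim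
    | @inp _ _ _ _ d z j' _ h' r' =>
      have hcd : c = d := (h.det h').1
      subst hcd
      have hyz : y = z ∧ LowEq lvl i j' := by
        cases hc : lvl c with
        | low =>
          rw [LowEq, atLevel_cons_of_eq hc, atLevel_cons_of_eq hc] at hl
          simpa [LowEq] using hl
        | high =>
          have hc' : lvl c ≠ .low := by simp [hc]
          rw [LowEq, atLevel_cons_of_ne hc', atLevel_cons_of_ne hc'] at hl
          -- Both traces receive the default value on a high channel, and the low restrictions do
          -- not see it.
          refine ⟨?_, hl⟩
          exact (hi (c, y) (by simp) hc).trans (hj (c, z) (by simp) hc).symm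
      obtain ⟨rfl, hl'⟩ := hyz
      obtain ⟨rfl, rfl⟩ := (h.det h').2 rfl
      exact ih r' (fun q hq => hi q (by simp [hq])) (fun q hq => hj q (by simp [hq])) hl'
    | out h' _ => exact (h.det h').1.elim
  | out h _ ih =>
    cases h' with
    | done => exact h.not_skip.elim
    | tau h' _ => exact (h.det h').1.elim
    | inp h' _ => exact (h.det h').1.elim
    | out h' r' =>
      obtain ⟨rfl, rfl⟩ := (h.det h').1
      obtain ⟨rfl, rfl⟩ := (h.det h').2 rfl
      rw [ih r' hi hj hl]

/-- The next instruction of a command reveals the kind of its next step. So what a sleeping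
execution waits for can be read off its program. -/
theorem TStep.head_tau {p p' : Prog CIn COut} {m m' : Mem} (h : TStep p m .tau p' m') :
    p.head = none := by
  generalize hl : Lab.tau = l at h
  induction h <;> simp_all [Cmd.head]

theorem TStep.head_inp {p p' : Prog CIn COut} {m m' : Mem} {c : CIn} {y : Val}
    (h : TStep p m (.inp c y) p' m') : ∃ x, p.head = some (.input x c) := by
  generalize hl : Lab.inp c y = l at h
  induction h <;> simp_all [Cmd.head]

/-- An executed output leaves a `skip` in front. This distinguishes an execution asleep behind an
output from one asleep on an input. -/
theorem TStep.head_out {p p' : Prog CIn COut} {m m' : Mem} {c : COut} {y : Val}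
    (h : TStep p m (.out c y) p' m') :
    (∃ e, p.head = some (.output e c)) ∧ p'.head = none ∧ m' = m := by
  generalize hl : Lab.out c y = l at h
  induction h <;> simp_all [Cmd.head]

variable [DecidableEq CIn]

abbrev LocalConf.Step : Prog CIn COut → LocalConf CIn COut → Prog CIn COut →
    LocalConf CIn COut → Prop :=
  Cmd.Step (fun s a => a s.mem) (fun s x y => { s with mem := Function.update s.mem x y }) LocalAct

/-- Except when an item is missing, a local step is a step of the open semantics; this is what
projects local executions to `Halts` traces. -/
theorem LocalConf.Step.inv {p p' : Prog CIn COut} {s s' : LocalConf CIn COut}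
    (h : LocalConf.Step p s p' s') :
    (∃ m', TStep p s.mem .tau p' m' ∧ s' = { s with mem := m' }) ∨
    (∃ c y m' I, TStep p s.mem (.inp c y) p' m' ∧ dequeue c s.inp = some (y, I) ∧
      s' = { s with mem := m', inp := I }) ∨
    (∃ x c, p.head = some (.input x c) ∧ dequeue c s.inp = none ∧ s.int = none ∧ p' = p ∧
      s' = { s with stt := .sleeping, int := some (.inp c) }) ∨
    (∃ c y, TStep p s.mem (.out c y) p' s.mem ∧ s.int = none ∧
      s' = { s with stt := .sleeping, int := some (.out c), out := s.out ++ [(c, y)] }) := by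
  induction h with
  | assign h => exact .inl ⟨_, .assign h, rfl⟩
  | ifT h => exact .inl ⟨_, .ifT h, rfl⟩
  | ifF h => exact .inl ⟨_, .ifF h, rfl⟩
  | whileT h => exact .inl ⟨_, .whileT h, rfl⟩
  | whileF h => exact .inl ⟨_, .whileF h, rfl⟩
  | skip => exact .inl ⟨_, .skip, rfl⟩
  | comp _ ih =>
    rcases ih with ⟨m', h, e⟩ | ⟨c, y, m', I, h, hd, e⟩ | ⟨x, c, h, hd, hi, hp, e⟩ | ⟨c, y, h, hi, e⟩
    · exact .inl ⟨m', .comp h, e⟩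
    · exact .inr (.inl ⟨c, y, m', I, .comp h, hd, e⟩)
    · exact .inr (.inr (.inl ⟨x, c, h, hd, hi, by rw [hp], e⟩))
    · exact .inr (.inr (.inr ⟨c, y, .comp h, hi, e⟩))
  | atom h =>
    cases h with
    | inp₁ h => exact .inr (.inl ⟨_, _, _, _, .inp, h, rfl⟩)
    | inp₂ h hi => exact .inr (.inr (.inl ⟨_, _, rfl, h, hi, rfl, rfl⟩))
    | outp h hi => exact .inr (.inr (.inr ⟨_, _, .out h, hi, rfl⟩))

/-- This lemma and the next three are the converse direction, which drives the runs constructed for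
RI and DI. -/
theorem LocalConf.step_tau {p p' : Prog CIn COut} {s : LocalConf CIn COut} {m' : Mem}
    (h : TStep p s.mem .tau p' m') : LocalConf.Step p s p' { s with mem := m' } := by
  generalize hl : Lab.tau = l at h
  generalize hm : s.mem = m at h
  induction h with
  | assign h => subst hm; exact .assign h
  | comp _ ih => exact .comp (ih hl hm)
  | ifT h => subst hm; exact .ifT h
  | ifF h => subst hm; exact .ifF h
  | whileT h => subst hm; exact .whileT h
  | whileF h => subst hm; exact .whileF h
  | skip => subst hm; exact .skip
  | inp => cases hl
  | out => cases hl

theorem LocalConf.step_inp {p p' : Prog CIn COut} {s : LocalConf CIn COut} {m' : Mem} {c : CIn}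
    {y : Val} {I : Queue CIn} (h : TStep p s.mem (.inp c y) p' m')
    (hd : dequeue c s.inp = some (y, I)) :
    LocalConf.Step p s p' { s with mem := m', inp := I } := by
  generalize hl : Lab.inp c y = l at h
  generalize hm : s.mem = m at h
  induction h with
  | comp _ ih => exact .comp (ih hl hm)
  | inp => subst hm; cases hl; exact .atom (.inp₁ hd)
  | _ => cases hl

theorem LocalConf.step_sleep {p p' : Prog CIn COut} {s : LocalConf CIn COut} {m' : Mem} {c : CIn}
    {y : Val} (h : TStep p s.mem (.inp c y) p' m') (hd : dequeue c s.inp = none)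
    (hi : s.int = none) :
    LocalConf.Step p s p { s with stt := .sleeping, int := some (.inp c) } := by
  generalize hl : Lab.inp c y = l at h
  generalize hm : s.mem = m at h
  induction h with
  | comp _ ih => exact .comp (ih hl hm)
  | inp => subst hm; cases hl; exact .atom (.inp₂ hd hi)
  | _ => cases hl

theorem LocalConf.step_out {p p' : Prog CIn COut} {s : LocalConf CIn COut} {m' : Mem} {c : COut}
    {y : Val} (h : TStep p s.mem (.out c y) p' m') (hi : s.int = none) :
    LocalConf.Step p s p'
      { s with stt := .sleeping, int := some (.out c), out := s.out ++ [(c, y)] } := by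
  generalize hl : Lab.out c y = l at h
  generalize hm : s.mem = m at h
  induction h with
  | comp _ ih => exact .comp (ih hl hm)
  | out h => subst hm; cases hl; exact .atom (.outp h hi)
  | _ => cases hl

end Programs

/-! ### Control points of MAP and REDUCE -/

/-- The three selected configurations of the framework. -/
inductive Kind where
  | ri
  | ni
  | di
  deriving DecidableEq

def Kind.mech {CIn : Type u} {COut : Type v} [DecidableEq CIn] (K : Kind)
    (lvlIn : CIn → Level) (lvlOut : COut → Level) (δ : Defaults CIn COut) : Mechanism CIn COut :=
  match K with
  | .ri => mechRI lvlIn lvlOut δ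
  | .ni => mechNI lvlIn lvlOut δ
  | .di => mechDI lvlIn lvlOut δ

/-- The points of a MAP program before the distribution of items begins. -/
inductive DecPt where
  | root
  | clone
  | cont
  | sel
  | both

/-- The control points of the MAP programs. The boolean tells whether a finished instruction
still has to be removed. -/
inductive MStage (CIn : Type u) where
  | idle
  | dec (q : DecPt) (i : ℕ) (c : CIn)
  -- `b0` to `b3` stand before the four instructions of a broadcast, `d0` and `d1` before the two of
  -- a default delivery. The requester is dropped after `b0`; `b1` keeps the received value.
  | b0 (i : ℕ) (c : CIn)
  | b1 (w : Bool) (c : CIn) (v : Val)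
  | b2 (w : Bool) (c : CIn)
  | b3 (w : Bool) (c : CIn)
  | d0 (i : ℕ) (c : CIn)
  | d1 (w : Bool) (i : ℕ) (c : CIn)

/-- The control points of the REDUCE program. -/
inductive RPt where
  | start
  -- The suffix `W` marks a leading `skip`, left by the preceding instruction, that is still to be
  -- removed.
  | askW
  | ask
  | fetch
  | tellW
  | tell
  | emit
  | cleanW
  | clean
  | wakeW
  | wake

inductive RStage (COut : Type v) where
  | idle
  | busy (q : RPt) (i : ℕ) (c : COut)

def wrap {E : Type u} {A : Type v} (w : Bool) (p : Cmd E A) : Cmd E A :=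
  match w with
  | true => .skip ⨾ p
  | false => p

section Stages

variable {CIn : Type u} {COut : Type v} [DecidableEq CIn]

/-- The part of the MAP program of DI behind the creation of the clone. -/
def diRest (δ : Defaults CIn COut) (i : ℕ) (c : CIn) : MapProg CIn COut :=
  .ite (inTM .ask i c) (.ite (inTM .tell i c) (mapBroadcast δ c) (mapDefault δ i c)) .skip

def MStage.prog (K : Kind) (lvlIn : CIn → Level) (lvlOut : COut → Level)
    (δ : Defaults CIn COut) : MStage CIn → MapProg CIn COut
  | .idle => .skip
  | .dec .root i c => (K.mech lvlIn lvlOut δ).mapProg i c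
  | .dec .clone i c =>
      .atom (.clone (identical i) (column lvlIn {.ask} {.tell}) (column lvlOut ∅ ∅)) ⨾
        diRest δ i c
  | .dec .cont i c => .skip ⨾ diRest δ i c
  -- This point is shared by DI and NI. RI never reaches it (`MStage.Cond` excludes it), so its
  -- value there is arbitrary.
  | .dec .sel i c =>
      match K with
      | .di => diRest δ i c
      | _ => .ite (notInTM .tell i c) (mapDefault δ i c) .skip
  | .dec .both i c => .ite (inTM .tell i c) (mapBroadcast δ c) (mapDefault δ i c)
  | .b0 _ c => mapBroadcast δ c
  | .b1 w c _ => wrap w (.atom (.map readX c (canTell c)) ⨾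
      .atom (.map (const (δ.inp c)) c (notCanTell c)) ⨾ .atom (.wake (isReady c)))
  | .b2 w c => wrap w (.atom (.map (const (δ.inp c)) c (notCanTell c)) ⨾
      .atom (.wake (isReady c)))
  | .b3 w c => wrap w (.atom (.wake (isReady c)))
  | .d0 i c => mapDefault δ i c
  | .d1 w i _ => wrap w (.atom (.wake (identical i)))

omit [DecidableEq CIn] in
def RStage.prog (δ : Defaults CIn COut) : RStage COut → RedProg CIn COut
  | .idle => .skip
  | .busy q i c =>
    let wk : RedProg CIn COut := .atom (.wake (identical i))
    let cl : RedProg CIn COut := .atom (.clean c (identical i)) ⨾ wk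
    let tl : RedProg CIn COut := .ite (inTR .tell i c) (.atom (.output readX c)) .skip ⨾ cl
    let as : RedProg CIn COut := .ite (inTR .ask i c) (.atom (.retrieve varX i c)) .skip ⨾ tl
    match q with
    | .start => .assign varX (const (δ.out c)) ⨾ as
    | .askW => .skip ⨾ as
    | .ask => as
    | .fetch => .atom (.retrieve varX i c) ⨾ tl
    | .tellW => .skip ⨾ tl
    | .tell => tl
    | .emit => .atom (.output readX c) ⨾ cl
    | .cleanW => .skip ⨾ cl
    | .clean => cl
    | .wakeW => .skip ⨾ wk
    | .wake => wk

end Stages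

/-! ### The invariant -/

section Invariant

variable {CIn : Type u} {COut : Type v}

/-- The facts about the privilege tables on which soundness rests. -/
structure Tables (K : Kind) (lvlIn : CIn → Level) (lvlOut : COut → Level) (tm : Table CIn)
    (tr : Table COut) (n : ℕ) : Prop where
  two_le : 2 ≤ n
  eq_two : K ≠ .di → n = 2
  length_tm : tm.length = n
  length_tr : tr.length = n
  -- Without a bound on `j` a statement also covers indices beyond the table, where there are no
  -- privileges.
  tell_high : ∀ j c, lvlIn c = .high → (Priv.tell ∈ tm.priv j c ↔ j = 0)
  tell_low : ∀ j c, j < n → lvlIn c = .low → Priv.tell ∈ tm.priv j c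
  ask_low : ∀ j c, lvlIn c = .low → (Priv.ask ∈ tm.priv j c ↔ j = 1)
  ask_high : K ≠ .ni → ∀ j c, j < n → lvlIn c = .high → Priv.ask ∈ tm.priv j c
  ask_high_zero : ∀ c, lvlIn c = .high → Priv.ask ∈ tm.priv 0 c
  ask_out : ∀ j c, Priv.ask ∈ tr.priv j c ↔ j = 0 ∧ lvlOut c = .high ∨ j = 1 ∧ lvlOut c = .low
  tell_out : ∀ j c, Priv.tell ∈ tr.priv j c ↔ j = 0 ∧ lvlOut c = .high ∨ j = 1 ∧ lvlOut c = .low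

/-- The local execution sleeps on an input from `c`. -/
def LocalConf.AtInput (e : LocalConf CIn COut) (c : CIn) : Prop :=
  e.stt = .sleeping ∧ ∃ x, e.prg.head = some (.input x c)

abbrev Stack (CIn : Type u) (COut : Type v) := List (LocalConf CIn COut)

def Waits (ex : Stack CIn COut) (j : ℕ) (c : CIn) : Prop :=
  ∃ e, ex[j]? = some e ∧ e.AtInput c

/-- Some clone is in the same state as the sleeping local execution 0. -/
def FreshClone (ex : Stack CIn COut) : Prop :=
  ∃ k e₀ e c, 2 ≤ k ∧ ex[0]? = some e₀ ∧ ex[k]? = some e ∧ e₀.AtInput c ∧ e.AtInput c ∧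
    e.prg = e₀.prg ∧ e.mem = e₀.mem ∧ e.inp = e₀.inp

/-- The local execution that requests the items of a level. -/
def asker : Level → ℕ
  | .low => 1
  | .high => 0

/-- The requester sleeps until it is served, and in DI the clone made for a high request of
execution 0 stays equal to it until the broadcast. In `b1` the requester is recovered from the
level; this is claimed only for low channels and for DI, since in RI both executions may ask for
high items. -/
def MStage.Cond (K : Kind) (lvlIn : CIn → Level) (tm : Table CIn) (ex : Stack CIn COut)
    (mm : Mem) : MStage CIn → Prop
  | .idle => True
  | .dec q i c => Waits ex i c ∧
      match q with
      | .root => True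
      | .clone => K = .di ∧ i = 0 ∧ lvlIn c = .high
      | .cont => K = .di ∧ (i = 0 → lvlIn c = .high → FreshClone ex)
      | .sel => K = .di ∧ (i = 0 → lvlIn c = .high → FreshClone ex) ∨
          K = .ni ∧ Priv.ask ∉ tm.priv i c
      | .both => K = .di ∧ (i = 0 → lvlIn c = .high → FreshClone ex) ∧ Priv.ask ∈ tm.priv i c
  | .b0 i c => Waits ex i c ∧ Priv.ask ∈ tm.priv i c ∧
      (K = .di → Priv.tell ∈ tm.priv i c ∧ (lvlIn c = .high → FreshClone ex))
  | .b1 _ c v => mm varX = v ∧ (lvlIn c = .low ∨ K = .di → Waits ex (asker (lvlIn c)) c)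
  | .b2 _ _ => True
  | .b3 _ _ => True
  | .d0 i c => Waits ex i c ∧ lvlIn c = .high ∧ i ≠ 0 ∧ K ≠ .ri
  | .d1 _ i c => Waits ex i c ∧ lvlIn c = .high ∧ i ≠ 0 ∧ K ≠ .ri

/-- MAP has distributed an item on the channel and has not yet woken its readers. -/
def MStage.Delivered : MStage CIn → CIn → Prop
  | .b2 _ c, d => c = d
  | .b3 _ c, d => c = d
  | _, _ => False

/-- The only excuse for sleeping with the awaited item at hand: MAP has delivered it and not yet
reached the wake-up. -/
def MStage.WakesUp (m : MStage CIn) (j : ℕ) (d : CIn) : Prop :=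
  m.Delivered d ∨ ∃ w, m = .d1 w j d

/-- MAP is working on a request on channel `d` of the local execution `j`. -/
def MStage.Handles (lvlIn : CIn → Level) (tm : Table CIn) (j : ℕ) (d : CIn) (Q : Queue CIn) :
    MStage CIn → Prop
  | .idle => False
  | .dec q i c => i = j ∨ (i = 0 ∧ lvlIn c = .high ∧ c = d ∧ q ≠ .root ∧ q ≠ .clone)
  | .b0 _ c => c = d
  | .b1 _ c _ => c = d
  | .b2 _ c => c = d ∧ (Priv.tell ∈ tm.priv j c → Has c Q)
  | .b3 _ c => c = d ∧ Has c Q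
  | .d0 i _ => i = j
  | .d1 _ i _ => i = j

/-- The requester of a level holds at most one unread item of this level. -/
def Served (lvlIn : CIn → Level) (ex : Stack CIn COut) (m : MStage CIn) (l : Level) : Prop :=
  -- The one item belongs to the input instruction at hand, and its reader is awake or about to be
  -- woken. So it is read before the next request.
  ∀ e, ex[asker l]? = some e → Queue.atLevel lvlIn l e.inp = [] ∨
    ∃ x c v, lvlIn c = l ∧ e.prg.head = some (.input x c) ∧
      Queue.atLevel lvlIn l e.inp = [(c, v)] ∧ (e.stt = .executing ∨ m.Delivered c)

/-- The part of the invariant that concerns MAP and the inputs of the local executions. -/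
structure MapInv (K : Kind) (lvlIn : CIn → Level) (δ : Defaults CIn COut) (tm : Table CIn)
    (ex : Stack CIn COut) (mm : Mem) (m : MStage CIn) : Prop where
  -- Only execution 0 is ever told high values.
  default : ∀ j e, ex[j]? = some e → j ≠ 0 →
    ∀ q ∈ e.inp, lvlIn q.1 = .high → q.2 = δ.inp q.1
  served_low : Served lvlIn ex m .low
  served_high : K = .di → Served lvlIn ex m .high
  no_item : ∀ j e d, ex[j]? = some e → e.AtInput d → Has d e.inp → m.WakesUp j d
  -- The first alternative is the ignored request: a low one from an execution that may not ask. It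
  -- stays asleep without a signal until execution 1 causes a broadcast.
  signal : ∀ j e d, ex[j]? = some e → e.AtInput d → e.int = none →
    lvlIn d = .low ∧ j ≠ 1 ∨ m.Handles lvlIn tm j d e.inp
  cond : m.Cond K lvlIn tm ex mm

def RPt.cleaned : RPt → Bool
  | .wakeW => true
  | .wake => true
  | _ => false

def RPt.emitted : RPt → Bool
  | .cleanW => true
  | .clean => true
  | .wakeW => true
  | .wake => true
  | _ => false

def RPt.fetched : RPt → Bool
  | .tellW => true
  | .tell => true
  | .emit => true
  | _ => false

/-- The served execution sleeps behind its output, and its output queue holds just this output until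
it is cleaned. The variable is constrained only where the output has been retrieved. -/
def RStage.Cond (tr : Table COut) (ex : Stack CIn COut) (rm : Mem) : RStage COut → Prop
  | .idle => True
  | .busy q i c => ∃ e, ex[i]? = some e ∧ e.stt = .sleeping ∧ e.prg.head = none ∧ e.int = none ∧
      (q.cleaned = true → e.out = []) ∧
      (q.cleaned = false → ∃ y, e.out = [(c, y)] ∧
        (q.fetched = true → Priv.ask ∈ tr.priv i c → rm varX = y)) ∧
      (q = .fetch → Priv.ask ∈ tr.priv i c) ∧ (q = .emit → Priv.tell ∈ tr.priv i c)

def RStage.Serves (j : ℕ) : RStage COut → Prop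
  | .idle => False
  | .busy _ i _ => i = j

/-- The admissible states of a local execution. -/
def LocalConf.Regular (e : LocalConf CIn COut) (busy : Prop) : Prop :=
  e.stt = .executing ∧ e.int = none ∧ e.out = [] ∨
  (∃ c, e.AtInput c ∧ e.out = [] ∧ (e.int = none ∨ e.int = some (.inp c))) ∨
  e.stt = .sleeping ∧ e.prg.head = none ∧
    ((∃ c y, e.int = some (.out c) ∧ e.out = [(c, y)]) ∨ e.int = none ∧ busy)

/-- The part of the invariant that concerns REDUCE and the outputs of the local executions. -/
structure RedInv (tr : Table COut) (ex : Stack CIn COut) (rm : Mem) (r : RStage COut) : Prop where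
  regular : ∀ (j : ℕ) (e : LocalConf CIn COut), ex[j]? = some e → e.Regular (r.Serves j)
  cond : r.Cond tr ex rm

/-- The stages `m` and `r` are ghost data: they name the remaining programs of MAP and REDUCE, and
the facts that hold depend on them. -/
structure Inv [DecidableEq CIn] (K : Kind) (lvlIn : CIn → Level) (lvlOut : COut → Level)
    (δ : Defaults CIn COut) (γ : EMConf CIn COut) (m : MStage CIn) (r : RStage COut) : Prop where
  mapPrg : γ.mapPrg = m.prog K lvlIn lvlOut δ
  redPrg : γ.redPrg = r.prog δ
  tables : Tables K lvlIn lvlOut γ.tm γ.tr γ.ex.length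
  map : MapInv K lvlIn δ γ.tm γ.ex γ.mapMem m
  red : RedInv γ.tr γ.ex γ.redMem r

/-- The items that MAP has received and not yet appended to the queue of local execution `k`. -/
def MStage.inflight (δ : Defaults CIn COut) (tm : Table CIn) (k : ℕ) : MStage CIn → Queue CIn
  | .b1 _ c v => [(c, if Priv.tell ∈ tm.priv k c then v else δ.inp c)]
  | .b2 _ c => if Priv.tell ∈ tm.priv k c then [] else [(c, δ.inp c)]
  | _ => []

/-- The items that local execution `k` has not read yet. -/
def flow (δ : Defaults CIn COut) (γ : EMConf CIn COut) (m : MStage CIn) (k : ℕ)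
    (e : LocalConf CIn COut) : Queue CIn :=
  e.inp ++ m.inflight δ γ.tm k ++ γ.inp

/-- REDUCE has already sent the output of local execution 1. -/
def RStage.Sent : RStage COut → Bool
  | .busy q 1 _ => q.emitted
  | _ => false

/-- The low output of local execution 1 that REDUCE has not sent yet. -/
def pending (lvlOut : COut → Level) (ex : Stack CIn COut) (r : RStage COut) : Queue COut :=
  match r.Sent, ex[1]? with
  | false, some e => Queue.atLevel lvlOut .low e.out
  | _, _ => []

/-- What local execution 1 has sent on low channels. -/
def lowSent (lvlOut : COut → Level) (γ : EMConf CIn COut) (r : RStage COut) : Queue COut :=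
  Queue.atLevel lvlOut .low γ.out ++ pending lvlOut γ.ex r

theorem Level.eq_high_of_ne_low {l : Level} (h : l ≠ .low) : l = .high := by
  cases l <;> simp_all

theorem getElem?_set_of_some {α : Type*} {l : List α} {i : ℕ} {a : α} (h : l[i]? = some a)
    (b : α) (j : ℕ) : (l.set i b)[j]? = if i = j then some b else l[j]? := by
  have hi : i < l.length := (List.getElem?_eq_some_iff.1 h).1
  by_cases hij : i = j
  · subst hij; simp [hi]
  · simp [hij]

theorem forall_getElem?_set {α : Type*} {l : List α} {i : ℕ} {a b : α} (h : l[i]? = some a)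
    {P : ℕ → α → Prop} (hi : P i b) (hP : ∀ j x, l[j]? = some x → P j x) :
    ∀ j x, (l.set i b)[j]? = some x → P j x := by
  intro j x hx
  rw [getElem?_set_of_some h] at hx
  split_ifs at hx with hij
  · subst hij; cases hx; exact hi
  · exact hP j x hx

theorem Waits.set {ex : Stack CIn COut} {i j : ℕ} {e e' : LocalConf CIn COut} {c : CIn}
    (hi : ex[i]? = some e) (he : ∀ c, e.AtInput c → e'.AtInput c) (h : Waits ex j c) :
    Waits (ex.set i e') j c := by
  obtain ⟨a, ha, hc⟩ := h
  by_cases hij : i = j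
  · subst hij
    rw [hi] at ha; cases ha
    exact ⟨e', by simp [getElem?_set_of_some hi], he c hc⟩
  · exact ⟨a, by simp [getElem?_set_of_some hi, hij, ha], hc⟩

theorem FreshClone.set {ex : Stack CIn COut} {i : ℕ} {e e' : LocalConf CIn COut}
    (hi : ex[i]? = some e) (he : ∀ c, ¬ e.AtInput c) (h : FreshClone ex) :
    FreshClone (ex.set i e') := by
  obtain ⟨k, e₀, a, c, hk, h0, ha, hc0, hc, h1⟩ := h
  refine ⟨k, e₀, a, c, hk, ?_, ?_, hc0, hc, h1⟩
  · rw [getElem?_set_of_some hi, if_neg, h0]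
    rintro rfl; rw [hi] at h0; cases h0; exact he _ hc0
  · rw [getElem?_set_of_some hi, if_neg, ha]
    rintro rfl; rw [hi] at ha; cases ha; exact he _ hc

theorem MStage.Cond.set {K : Kind} {lvlIn : CIn → Level} {tm : Table CIn} {ex : Stack CIn COut}
    {mm : Mem} {m : MStage CIn} {i : ℕ} {e e' : LocalConf CIn COut}
    (hi : ex[i]? = some e) (he : ∀ c, ¬ e.AtInput c) (h : m.Cond K lvlIn tm ex mm) :
    m.Cond K lvlIn tm (ex.set i e') mm := by
  have hW : ∀ {j c}, Waits ex j c → Waits (ex.set i e') j c :=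
    fun {j c} => Waits.set hi fun c hc => (he c hc).elim
  have hF : FreshClone ex → FreshClone (ex.set i e') := FreshClone.set hi he
  cases m with
  | idle => trivial
  | dec q j c =>
    refine ⟨hW h.1, ?_⟩
    have h2 := h.2
    cases q <;> simp only at h2 ⊢ <;> tauto
  | b0 j c => exact ⟨hW h.1, h.2.1, fun hK => ⟨(h.2.2 hK).1, fun hc => hF ((h.2.2 hK).2 hc)⟩⟩
  | b1 w c v => exact ⟨h.1, fun hc => hW (h.2 hc)⟩
  | b2 => trivial
  | b3 => trivial
  | d0 j c => exact ⟨hW h.1, h.2⟩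
  | d1 w j c => exact ⟨hW h.1, h.2⟩

/-- MAP does not see changes of local executions that do not sleep on an input. -/
theorem MapInv.set {K : Kind} {lvlIn : CIn → Level} {δ : Defaults CIn COut} {tm : Table CIn}
    {ex : Stack CIn COut} {mm : Mem} {m : MStage CIn} {i : ℕ} {e e' : LocalConf CIn COut}
    (h : MapInv K lvlIn δ tm ex mm m) (hi : ex[i]? = some e) (he : ∀ c, ¬ e.AtInput c)
    (hmem : ∀ q ∈ e'.inp, q ∈ e.inp)
    (hserved : ∀ l, (Queue.atLevel lvlIn l e.inp = [] ∨
      ∃ x c v, lvlIn c = l ∧ e.prg.head = some (.input x c) ∧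
        Queue.atLevel lvlIn l e.inp = [(c, v)] ∧ (e.stt = .executing ∨ m.Delivered c)) →
      (Queue.atLevel lvlIn l e'.inp = [] ∨
      ∃ x c v, lvlIn c = l ∧ e'.prg.head = some (.input x c) ∧
        Queue.atLevel lvlIn l e'.inp = [(c, v)] ∧ (e'.stt = .executing ∨ m.Delivered c)))
    (hno : ∀ d, e'.AtInput d → ¬ Has d e'.inp ∧ e'.int ≠ none) :
    MapInv K lvlIn δ tm (ex.set i e') mm m := by
  have hs : ∀ l, Served lvlIn ex m l → Served lvlIn (ex.set i e') m l := by
    intro l hl a ha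
    rw [getElem?_set_of_some hi] at ha
    split_ifs at ha with hij
    · cases ha; subst hij; exact hserved l (hl e hi)
    · exact hl a ha
  exact
    { default := forall_getElem?_set hi (P := fun j e => j ≠ 0 →
        ∀ q ∈ e.inp, lvlIn q.1 = .high → q.2 = δ.inp q.1)
        (fun h0 q hq => h.default i e hi h0 q (hmem q hq)) h.default
      served_low := hs _ h.served_low
      served_high := fun hK => hs _ (h.served_high hK)
      no_item := fun j a d => forall_getElem?_set hi
        (P := fun j e => e.AtInput d → Has d e.inp → m.WakesUp j d)
        (fun h1 h2 => ((hno d h1).1 h2).elim) (fun j a => h.no_item j a d) j a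
      signal := fun j a d => forall_getElem?_set hi
        (P := fun j e => e.AtInput d → e.int = none → lvlIn d = .low ∧ j ≠ 1 ∨
          m.Handles lvlIn tm j d e.inp)
        (fun h1 h2 => ((hno d h1).2 h2).elim) (fun j a => h.signal j a d) j a
      cond := h.cond.set hi he }

end Invariant

/-! ### Local steps preserve the invariant -/

section Exec

variable {CIn : Type u} {COut : Type v}

theorem LocalConf.AtInput.not_executing {e : LocalConf CIn COut} {c : CIn} (h : e.AtInput c) :
    e.stt ≠ .executing := by
  simp [h.1]

theorem LocalConf.AtInput.head_ne {e : LocalConf CIn COut} {c : CIn} (h : e.AtInput c) :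
    e.prg.head ≠ none := by
  obtain ⟨_, x, h⟩ := h
  simp [h]

theorem LocalConf.AtInput.unique {e : LocalConf CIn COut} {c d : CIn} (h : e.AtInput c)
    (h' : e.AtInput d) : c = d := by
  obtain ⟨_, x, h⟩ := h
  obtain ⟨_, y, h'⟩ := h'
  rw [h] at h'; cases h'; rfl

theorem LocalConf.Regular.of_executing {e : LocalConf CIn COut} {b : Prop} (h : e.Regular b)
    (he : e.stt = .executing) : e.int = none ∧ e.out = [] := by
  rcases h with h | ⟨c, h, _⟩ | h
  · exact h.2
  · exact (h.not_executing he).elim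
  · rw [h.1] at he; cases he

theorem LocalConf.Regular.of_atInput {e : LocalConf CIn COut} {b : Prop} {c : CIn}
    (h : e.Regular b) (he : e.AtInput c) :
    e.out = [] ∧ (e.int = none ∨ e.int = some (.inp c)) := by
  rcases h with h | ⟨d, h, h'⟩ | h
  · exact (he.not_executing h.1).elim
  · cases h.unique he; exact h'
  · exact (he.head_ne h.2.1).elim

theorem LocalConf.Regular.of_head_none {e : LocalConf CIn COut} {b : Prop}
    (h : e.Regular b) (hs : e.stt = .sleeping) (he : e.prg.head = none) :
    (∃ c y, e.int = some (.out c) ∧ e.out = [(c, y)]) ∨ e.int = none ∧ b := by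
  rcases h with h | ⟨d, h, h'⟩ | h
  · rw [hs] at h; cases h.1
  · exact (h.head_ne he).elim
  · exact h.2.2

theorem LocalConf.Regular.mono {e : LocalConf CIn COut} {b b' : Prop} (h : e.Regular b)
    (hb : b → b') : e.Regular b' := by
  rcases h with h | h | ⟨h, h', h''⟩
  · exact .inl h
  · exact .inr (.inl h)
  · exact .inr (.inr ⟨h, h', h''.imp_right fun h => ⟨h.1, hb h.2⟩⟩)

/-- What a step of a local execution does. -/
theorem LocalStep.inv [DecidableEq CIn] {e e' : LocalConf CIn COut} (h : LocalStep e e') :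
    (∃ p m, TStep e.prg e.mem .tau p m ∧ e' = { e with prg := p, mem := m }) ∨
    (∃ c y p m I, TStep e.prg e.mem (.inp c y) p m ∧ dequeue c e.inp = some (y, I) ∧
      e' = { e with prg := p, mem := m, inp := I }) ∨
    (∃ x c, e.prg.head = some (.input x c) ∧ dequeue c e.inp = none ∧
      e' = { e with stt := .sleeping, int := some (.inp c) }) ∨
    (∃ c y p, TStep e.prg e.mem (.out c y) p e.mem ∧
      e' = { e with prg := p, stt := .sleeping, int := some (.out c), out := e.out ++ [(c, y)] })
    := by
  obtain ⟨_, p, s, h, rfl⟩ := h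
  rcases LocalConf.Step.inv h with ⟨m', ht, rfl⟩ | ⟨c, y, m', I, ht, hd, rfl⟩ |
    ⟨x, c, ht, hd, hi, rfl, rfl⟩ | ⟨c, y, ht, hi, rfl⟩
  · exact .inl ⟨_, _, ht, rfl⟩
  · exact .inr (.inl ⟨c, y, _, _, I, ht, hd, rfl⟩)
  · exact .inr (.inr (.inl ⟨x, c, ht, hd, rfl⟩))
  · exact .inr (.inr (.inr ⟨c, y, p, ht, rfl⟩))

/-- REDUCE serves an execution that sleeps behind an output, so one that is executing, or at an
input or output instruction, is a different one. -/
theorem RStage.Cond.set {tr : Table COut} {ex : Stack CIn COut} {rm : Mem} {r : RStage COut}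
    {i : ℕ} {e e' : LocalConf CIn COut} (hi : ex[i]? = some e)
    (he : e.stt = .executing ∨ e.prg.head ≠ none) (h : r.Cond tr ex rm) :
    r.Cond tr (ex.set i e') rm := by
  cases r with
  | idle => trivial
  | busy q j c =>
    obtain ⟨a, ha, hs, hh, h⟩ := h
    refine ⟨a, ?_, hs, hh, h⟩
    rw [getElem?_set_of_some hi, if_neg, ha]
    rintro rfl
    rw [hi] at ha; cases ha
    rcases he with he | he
    · rw [hs] at he; cases he
    · exact he hh

variable [DecidableEq CIn]

/-- Reading the single item of a level leaves none of that level, and an execution falls asleep on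
an input only without an item on the channel and with a fresh signal. -/
theorem MapInv.exec {K : Kind} {lvlIn : CIn → Level} {δ : Defaults CIn COut} {tm : Table CIn}
    {ex : Stack CIn COut} {mm : Mem} {m : MStage CIn} {i : ℕ} {e e' : LocalConf CIn COut}
    (h : MapInv K lvlIn δ tm ex mm m) (hi : ex[i]? = some e) (hs : LocalStep e e') :
    MapInv K lvlIn δ tm (ex.set i e') mm m := by
  have hx := hs.1
  refine h.set hi (fun c hc => hc.not_executing hx) ?_ ?_ ?_
  · rcases hs.inv with ⟨p, m, ht, rfl⟩ | ⟨c, y, p, m, I, ht, hd, rfl⟩ | ⟨x, c, ht, hd, rfl⟩ |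
      ⟨c, y, p, ht, rfl⟩
    · exact fun q hq => hq
    · exact dequeue_subset hd
    · exact fun q hq => hq
    · exact fun q hq => hq
  · rintro l (hl | ⟨x, c, v, hc, hh, hl, -⟩)
    · left
      refine atLevel_eq_nil_of_subset ?_ hl
      rcases hs.inv with ⟨p, m, ht, rfl⟩ | ⟨c, y, p, m, I, ht, hd, rfl⟩ | ⟨x, c, ht, hd, rfl⟩ |
        ⟨c, y, p, ht, rfl⟩
      · exact fun q hq => hq
      · exact dequeue_subset hd
      · exact fun q hq => hq
      · exact fun q hq => hq
    · left
      rcases hs.inv with ⟨p, m, ht, rfl⟩ | ⟨d, y, p, m, I, ht, hd, rfl⟩ | ⟨x, d, ht, hd, rfl⟩ |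
        ⟨d, y, p, ht, rfl⟩
      · rw [ht.head_tau] at hh; cases hh
      · obtain ⟨x', hx'⟩ := ht.head_inp
        rw [hx'] at hh; cases hh
        exact (dequeue_atLevel_of_singleton hd hc hl).2.2
      · rw [ht] at hh; cases hh
        -- An execution that still holds the item it wants does not fall asleep.
        refine (dequeue_eq_none.1 hd ⟨v, ?_⟩).elim
        have : (c, v) ∈ Queue.atLevel lvlIn l e.inp := by simp [hl]
        exact (List.mem_filter.1 this).1
      · obtain ⟨⟨x', hx'⟩, _⟩ := ht.head_out
        rw [hx'] at hh; cases hh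
  · intro d hd'
    rcases hs.inv with ⟨p, m, ht, rfl⟩ | ⟨c, y, p, m, I, ht, hd, rfl⟩ | ⟨x, c, ht, hd, rfl⟩ |
      ⟨c, y, p, ht, rfl⟩
    · exact (hd'.not_executing hx).elim
    · exact (hd'.not_executing hx).elim
    · obtain ⟨_, x', hx'⟩ := hd'
      simp only at hx'
      rw [ht] at hx'; cases hx'
      exact ⟨dequeue_eq_none.1 hd, by simp⟩
    · exact (hd'.head_ne ht.head_out.2.1).elim

theorem RedInv.exec {tr : Table COut} {ex : Stack CIn COut} {rm : Mem} {r : RStage COut} {i : ℕ}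
    {e e' : LocalConf CIn COut} (h : RedInv tr ex rm r) (hi : ex[i]? = some e)
    (hs : LocalStep e e') : RedInv tr (ex.set i e') rm r := by
  have hx := hs.1
  refine ⟨forall_getElem?_set hi (P := fun j e => e.Regular (r.Serves j)) ?_ h.regular,
    h.cond.set hi (.inl hx)⟩
  obtain ⟨h1, h2⟩ := (h.regular i e hi).of_executing hx
  rcases hs.inv with ⟨p, m, ht, rfl⟩ | ⟨c, y, p, m, I, ht, hd, rfl⟩ | ⟨x, c, ht, hd, rfl⟩ |
      ⟨c, y, p, ht, rfl⟩
  · exact .inl ⟨hx, h1, h2⟩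
  · exact .inl ⟨hx, h1, h2⟩
  · exact .inr (.inl ⟨c, ⟨rfl, x, ht⟩, h2, .inr rfl⟩)
  · exact .inr (.inr ⟨rfl, ht.head_out.2.1, .inl ⟨c, y, rfl, by simp [h2]⟩⟩)

theorem Inv.exec {K : Kind} {lvlIn : CIn → Level} {lvlOut : COut → Level}
    {δ : Defaults CIn COut} {γ : EMConf CIn COut} {m : MStage CIn} {r : RStage COut} {i : ℕ}
    {e e' : LocalConf CIn COut} (h : Inv K lvlIn lvlOut δ γ m r) (hi : γ.ex[i]? = some e)
    (hs : LocalStep e e') : Inv K lvlIn lvlOut δ { γ with ex := γ.ex.set i e' } m r :=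
  { mapPrg := h.mapPrg
    redPrg := h.redPrg
    tables := by simpa using h.tables
    map := h.map.exec hi hs
    red := h.red.exec hi hs }

end Exec

/-! ### REDUCE preserves the invariant and the low output -/

section Reduce

variable {CIn : Type u} {COut : Type v} [DecidableEq COut]

abbrev RedStep : RedProg CIn COut → EMConf CIn COut → RedProg CIn COut → EMConf CIn COut → Prop :=
  Cmd.Step (fun s a => a s.tm s.tr s.redMem)
    (fun s x y => { s with redMem := Function.update s.redMem x y }) RedAct

/-- The successor of a control point and the change of the configuration in a step of REDUCE. -/
inductive RTrans (δ : Defaults CIn COut) (i : ℕ) (c : COut) (γ : EMConf CIn COut) :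
    RPt → RStage COut → EMConf CIn COut → Prop
  | start : RTrans δ i c γ .start (.busy .askW i c)
      { γ with redMem := Function.update γ.redMem varX (δ.out c) }
  | askW : RTrans δ i c γ .askW (.busy .ask i c) γ
  | ask₁ (h : Priv.ask ∈ γ.tr.priv i c) : RTrans δ i c γ .ask (.busy .fetch i c) γ
  | ask₂ (h : Priv.ask ∉ γ.tr.priv i c) : RTrans δ i c γ .ask (.busy .tellW i c) γ
  | fetch {e y Q} (he : γ.ex[i]? = some e) (h : dequeue c e.out = some (y, Q)) :
      RTrans δ i c γ .fetch (.busy .tellW i c)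
        { γ with redMem := Function.update γ.redMem varX y }
  | tellW : RTrans δ i c γ .tellW (.busy .tell i c) γ
  | tell₁ (h : Priv.tell ∈ γ.tr.priv i c) : RTrans δ i c γ .tell (.busy .emit i c) γ
  | tell₂ (h : Priv.tell ∉ γ.tr.priv i c) : RTrans δ i c γ .tell (.busy .cleanW i c) γ
  | emit : RTrans δ i c γ .emit (.busy .cleanW i c)
      { γ with out := γ.out ++ [(c, γ.redMem varX)] }
  | cleanW : RTrans δ i c γ .cleanW (.busy .clean i c) γ
  | clean : RTrans δ i c γ .clean (.busy .wakeW i c)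
      (γ.modify (identical i) (fun l => { l with out := remove c l.out }))
  | wakeW : RTrans δ i c γ .wakeW (.busy .wake i c) γ
  | wake (h : γ.Asleep (identical i)) : RTrans δ i c γ .wake .idle
      (γ.modify (identical i) (fun l => { l with int := none, stt := .executing }))

/-- With its converse `RTrans.step` this replaces the small-step semantics of the REDUCE program by
a transition graph on control points. -/
theorem RedStep.inv {δ : Defaults CIn COut} {r : RStage COut} {γ γ' : EMConf CIn COut}
    {p : RedProg CIn COut} (h : RedStep (r.prog δ) γ p γ') :
    ∃ q i c r', r = .busy q i c ∧ p = r'.prog δ ∧ RTrans δ i c γ q r' γ' := by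
  cases r with
  | idle => cases h
  | busy q i c =>
    cases q
    case start =>
      cases h with
      | comp h => cases h with
        | assign h => cases h; exact ⟨_, _, _, _, rfl, rfl, .start⟩
    case askW =>
      cases h with
      | comp h => cases h
      | skip => exact ⟨_, _, _, _, rfl, rfl, .askW⟩
    case ask =>
      cases h with
      | comp h => cases h with
        | ifT h => exact ⟨_, _, _, _, rfl, rfl, .ask₁ (by simpa [inTR] using h)⟩
        | ifF h => exact ⟨_, _, _, _, rfl, rfl, .ask₂ (by simpa [inTR] using h)⟩
    case fetch =>
      cases h with
      | comp h => cases h with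
        | atom h => cases h with
          | retrieve he h => exact ⟨_, _, _, _, rfl, rfl, .fetch he h⟩
    case tellW =>
      cases h with
      | comp h => cases h
      | skip => exact ⟨_, _, _, _, rfl, rfl, .tellW⟩
    case tell =>
      cases h with
      | comp h => cases h with
        | ifT h => exact ⟨_, _, _, _, rfl, rfl, .tell₁ (by simpa [inTR] using h)⟩
        | ifF h => exact ⟨_, _, _, _, rfl, rfl, .tell₂ (by simpa [inTR] using h)⟩
    case emit =>
      cases h with
      | comp h => cases h with
        | atom h => cases h with
          | output h => cases h; exact ⟨_, _, _, _, rfl, rfl, .emit⟩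
    case cleanW =>
      cases h with
      | comp h => cases h
      | skip => exact ⟨_, _, _, _, rfl, rfl, .cleanW⟩
    case clean =>
      cases h with
      | comp h => cases h with
        | atom h => cases h with
          | clean => exact ⟨_, _, _, _, rfl, rfl, .clean⟩
    case wakeW =>
      cases h with
      | comp h => cases h
      | skip => exact ⟨_, _, _, _, rfl, rfl, .wakeW⟩
    case wake =>
      cases h with
      | atom h => cases h with
        | wake h => exact ⟨_, _, _, _, rfl, rfl, .wake h⟩

theorem RTrans.step {δ : Defaults CIn COut} {q : RPt} {i : ℕ} {c : COut} {r' : RStage COut}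
    {γ γ' : EMConf CIn COut} (h : RTrans δ i c γ q r' γ') :
    RedStep ((RStage.busy q i c).prog δ) γ (r'.prog δ) γ' := by
  cases h with
  | start => exact .comp (.assign rfl)
  | askW => exact .skip
  | ask₁ h => exact .comp (.ifT (by simpa [inTR] using h))
  | ask₂ h => exact .comp (.ifF (by simpa [inTR] using h))
  | fetch he h => exact .comp (.atom (.retrieve he h))
  | tellW => exact .skip
  | tell₁ h => exact .comp (.ifT (by simpa [inTR] using h))
  | tell₂ h => exact .comp (.ifF (by simpa [inTR] using h))
  | emit => exact .comp (.atom (.output rfl))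
  | cleanW => exact .skip
  | clean => exact .comp (.atom .clean)
  | wakeW => exact .skip
  | wake h => exact .atom (.wake h)

omit [DecidableEq COut] in
theorem modify_identical {γ : EMConf CIn COut} {i : ℕ} {e : LocalConf CIn COut}
    (hi : γ.ex[i]? = some e) (f : LocalConf CIn COut → LocalConf CIn COut) :
    γ.modify (identical i) f = { γ with ex := γ.ex.set i (f e) } := by
  have : γ.ex.mapIdx (fun j a => if γ.sat (identical i) j then f a else a)
      = γ.ex.set i (f e) := by
    apply List.ext_getElem?
    intro j
    rw [getElem?_set_of_some hi, List.getElem?_mapIdx]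
    by_cases hij : i = j
    · subst hij; simp [hi, EMConf.sat, identical]
    · have hji : ¬ j = i := fun h => hij h.symm
      simp [hij, EMConf.sat, identical, hji]
  simp only [EMConf.modify, this]

/-- REDUCE changes at most the local execution that it serves, which stays outside MAP's concern,
and makes progress. -/
structure RedEffect (lvlOut : COut → Level) (γ γ' : EMConf CIn COut) (r r' : RStage COut) :
    Prop where
  tm : γ'.tm = γ.tm
  tr : γ'.tr = γ.tr
  mapPrg : γ'.mapPrg = γ.mapPrg
  mapMem : γ'.mapMem = γ.mapMem
  inp : γ'.inp = γ.inp
  red : RedInv γ'.tr γ'.ex γ'.redMem r'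
  sent : lowSent lvlOut γ' r' = lowSent lvlOut γ r
  ex : γ'.ex = γ.ex ∨ ∃ i e e', γ.ex[i]? = some e ∧ γ'.ex = γ.ex.set i e' ∧ e.stt = .sleeping ∧
    e.prg.head = none ∧
    e'.prg = e.prg ∧ e'.mem = e.mem ∧ e'.inp = e.inp

/-- What matters is `lowSent`. Ask and tell coincide in `T_R`, so whatever is sent is the true
output and not the default. Execution 1 may tell exactly on low channels and no other execution may
tell there, so low outputs stem from execution 1 and none of them is dropped. -/
theorem RTrans.effect {lvlIn : CIn → Level} {lvlOut : COut → Level} {K : Kind}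
    {δ : Defaults CIn COut} {q : RPt} {i : ℕ} {c : COut}
    {r' : RStage COut} {γ γ' : EMConf CIn COut} (h : RTrans δ i c γ q r' γ')
    (ht : Tables K lvlIn lvlOut γ.tm γ.tr γ.ex.length)
    (hr : RedInv γ.tr γ.ex γ.redMem (.busy q i c)) :
    RedEffect lvlOut γ γ' (.busy q i c) r' := by
  obtain ⟨e, he, hs, hh, hint, hcl, hncl, hf, hem⟩ := hr.cond
  -- Before cleaning and waking, only the memory of REDUCE, its control point and the global output
  -- change.
  have hsame : ∀ (rm' : Mem) (q' : RPt) (out' : Queue COut), q'.cleaned = q.cleaned →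
      (q.cleaned = false → ∃ y, e.out = [(c, y)] ∧
        (q'.fetched = true → Priv.ask ∈ γ.tr.priv i c → rm' varX = y)) →
      (q' = .fetch → Priv.ask ∈ γ.tr.priv i c) → (q' = .emit → Priv.tell ∈ γ.tr.priv i c) →
      (Queue.atLevel lvlOut .low out' ++ pending lvlOut γ.ex (.busy q' i c) =
        lowSent lvlOut γ (.busy q i c)) →
      RedEffect lvlOut γ { γ with redMem := rm', out := out' } (.busy q i c) (.busy q' i c) := by
    intro rm' q' out' h1 h2 h3 h4 h5
    refine ⟨rfl, rfl, rfl, rfl, rfl, ⟨hr.regular, e, he, hs, hh, hint, ?_, ?_, h3, h4⟩, h5, .inl rfl⟩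
    · rw [h1]; exact hcl
    · rw [h1]; exact h2
  -- The control point influences the pending output only through whether the output has been
  -- emitted, and only when execution 1 is served.
  have hpend : ∀ q' : RPt, q'.emitted = q.emitted →
      Queue.atLevel lvlOut .low γ.out ++ pending lvlOut γ.ex (.busy q' i c) =
        lowSent lvlOut γ (.busy q i c) := by
    intro q' hq'
    unfold lowSent pending RStage.Sent
    rcases i with _ | _ | i <;> simp [hq']
  have hpend' : ∀ q' : RPt, i ≠ 1 → Queue.atLevel lvlOut .low γ.out ++
      pending lvlOut γ.ex (.busy q' i c) = lowSent lvlOut γ (.busy q i c) := by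
    intro q' hq'
    unfold lowSent pending RStage.Sent
    rcases i with _ | _ | i <;> simp at hq' ⊢
  cases h with
  | start =>
    refine hsame _ _ _ rfl (fun h => ?_) (by simp) (by simp) (hpend _ rfl)
    obtain ⟨y, hy, _⟩ := hncl h
    exact ⟨y, hy, by simp [RPt.fetched]⟩
  | askW =>
    refine hsame _ _ _ rfl (fun h => ?_) (by simp) (by simp) (hpend _ rfl)
    obtain ⟨y, hy, _⟩ := hncl h
    exact ⟨y, hy, by simp [RPt.fetched]⟩
  | ask₁ h =>
    refine hsame _ _ _ rfl (fun h => ?_) (by simp [h]) (by simp) (hpend _ rfl)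
    obtain ⟨y, hy, _⟩ := hncl h
    exact ⟨y, hy, by simp [RPt.fetched]⟩
  | ask₂ h =>
    refine hsame _ _ _ rfl (fun h' => ?_) (by simp) (by simp) (hpend _ rfl)
    obtain ⟨y, hy, _⟩ := hncl h'
    exact ⟨y, hy, fun _ h'' => (h h'').elim⟩
  | @fetch e' y Q he' h =>
    rw [he] at he'; cases he'
    refine hsame _ _ _ rfl (fun h' => ?_) (by simp) (by simp) (hpend _ rfl)
    obtain ⟨z, hz, _⟩ := hncl h'
    rw [hz] at h
    simp [dequeue] at h
    exact ⟨z, hz, by simp [h.1]⟩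
  | tellW =>
    refine hsame _ _ _ rfl (fun h => ?_) (by simp) (by simp) (hpend _ rfl)
    obtain ⟨y, hy, hy'⟩ := hncl h
    exact ⟨y, hy, fun _ => hy' rfl⟩
  | tell₁ h =>
    refine hsame _ _ _ rfl (fun h => ?_) (by simp) (by simp [h]) (hpend _ rfl)
    obtain ⟨y, hy, hy'⟩ := hncl h
    exact ⟨y, hy, fun _ => hy' rfl⟩
  | tell₂ h =>
    obtain ⟨y, hy, hy'⟩ := hncl rfl
    refine hsame _ _ _ rfl (fun h => ⟨y, hy, by simp [RPt.fetched]⟩) (by simp) (by simp) ?_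
    by_cases hi : i = 1
    · subst hi
      -- An output of execution 1 that is not sent is high, so nothing is lost when it stops being
      -- pending.
      have hc : lvlOut c ≠ .low := fun hc => h ((ht.tell_out 1 c).2 (.inr ⟨rfl, hc⟩))
      simp [lowSent, pending, RStage.Sent, RPt.emitted, he, hy, atLevel_cons_of_ne hc]
    · exact hpend' _ hi
  | emit =>
    obtain ⟨y, hy, hy'⟩ := hncl rfl
    refine hsame _ _ _ rfl (fun h => ⟨y, hy, by simp [RPt.fetched]⟩) (by simp) (by simp) ?_
    have htell := hem rfl
    -- Permission to tell implies permission to ask, so the variable holds the retrieved value.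
    have hask := (ht.ask_out i c).2 ((ht.tell_out i c).1 htell)
    have hy2 := hy' rfl hask
    by_cases hi : i = 1
    · subst hi
      simp [lowSent, pending, RStage.Sent, RPt.emitted, he, hy, atLevel_append, hy2]
    · have hc : lvlOut c ≠ .low := by
        rcases (ht.tell_out i c).1 htell with ⟨_, h⟩ | ⟨h, _⟩
        · simp [h]
        · exact (hi h).elim
      rw [atLevel_append, atLevel_cons_of_ne hc]
      simpa using hpend' _ hi
  | cleanW =>
    refine hsame _ _ _ rfl (fun h => ?_) (by simp) (by simp) (hpend _ rfl)
    obtain ⟨y, hy, _⟩ := hncl h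
    exact ⟨y, hy, by simp [RPt.fetched]⟩
  | wakeW => exact hsame _ _ _ rfl (fun h => by cases h) (by simp) (by simp) (hpend _ rfl)
  | clean =>
    obtain ⟨y, hy, -⟩ := hncl rfl
    rw [modify_identical he]
    refine ⟨rfl, rfl, rfl, rfl, rfl, ⟨?_, ?_⟩, ?_, .inr ⟨i, e, _, he, rfl, hs, hh, rfl, rfl, rfl⟩⟩
    · exact forall_getElem?_set he (P := fun j e => e.Regular (i = j))
        (.inr (.inr ⟨hs, hh, .inr ⟨hint, rfl⟩⟩)) hr.regular
    · refine ⟨{ e with out := remove c e.out }, by simp [getElem?_set_of_some he], hs, hh, hint, ?_,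
        by simp [RPt.cleaned], by simp, by simp⟩
      simp [hy, remove]
    · by_cases hi : i = 1
      · subst hi; simp [lowSent, pending, RStage.Sent, RPt.emitted]
      · have : (RStage.busy .wakeW i c).Sent = false := by
          unfold RStage.Sent; rcases i with _ | _ | i <;> simp at hi ⊢
        have h' : (RStage.busy .clean i c).Sent = false := by
          unfold RStage.Sent; rcases i with _ | _ | i <;> simp at hi ⊢
        simp [lowSent, pending, this, h', getElem?_set_of_some he, hi]
  | wake h =>
    rw [modify_identical he]
    refine ⟨rfl, rfl, rfl, rfl, rfl, ⟨?_, trivial⟩, ?_, .inr ⟨i, e, _, he, rfl, hs, hh, rfl, rfl, rfl⟩⟩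
    · intro j a ha
      rw [getElem?_set_of_some he] at ha
      split_ifs at ha with hij
      · cases ha
        exact .inl ⟨rfl, rfl, hcl rfl⟩
      · exact (hr.regular j a ha).mono fun h => hij h
    · by_cases hi : i = 1
      · subst hi
        simp [lowSent, pending, RStage.Sent, RPt.emitted, getElem?_set_of_some he, hcl rfl]
      · have h' : (RStage.busy .wake i c).Sent = false := by
          unfold RStage.Sent; rcases i with _ | _ | i <;> simp at hi ⊢
        have h2 : (RStage.idle : RStage COut).Sent = false := rfl
        simp [lowSent, pending, h2, h', getElem?_set_of_some he, hi]

omit [DecidableEq COut] in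
/-- MAP's invariant survives the steps of REDUCE. -/
theorem MapInv.reduce {K : Kind} {lvlIn : CIn → Level} {δ : Defaults CIn COut} {tm : Table CIn}
    {ex : Stack CIn COut} {mm : Mem} {m : MStage CIn} {i : ℕ} {e e' : LocalConf CIn COut}
    (h : MapInv K lvlIn δ tm ex mm m) (hi : ex[i]? = some e) (hh : e.prg.head = none)
    (hp : e'.prg = e.prg) (hinp : e'.inp = e.inp) : MapInv K lvlIn δ tm (ex.set i e') mm m := by
  refine h.set hi (fun c hc => hc.head_ne hh) (by simp [hinp]) ?_ ?_
  · rintro l (hl | ⟨x, c, v, hc, hh', -⟩)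
    · left; rw [hinp]; exact hl
    · rw [hh] at hh'; cases hh'
  · intro d hd
    exact (hd.head_ne (by rw [hp, hh])).elim

end Reduce

/-! ### The transition graph of MAP -/

section Map

variable {CIn : Type u} {COut : Type v} [DecidableEq CIn]

abbrev MapStep : MapProg CIn COut → EMConf CIn COut → MapProg CIn COut → EMConf CIn COut → Prop :=
  Cmd.Step (fun s a => a s.tm s.tr s.mapMem)
    (fun s x y => { s with mapMem := Function.update s.mapMem x y }) MapAct

omit [DecidableEq CIn] in
/-- The steps of MAP that only change its program. -/
inductive Silent (K : Kind) (lvlIn : CIn → Level) (tm : Table CIn) :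
    MStage CIn → MStage CIn → Prop
  | ri₁ {i c} (hK : K = .ri) (h : Priv.ask ∈ tm.priv i c) :
      Silent K lvlIn tm (.dec .root i c) (.b0 i c)
  | ri₂ {i c} (hK : K = .ri) (h : Priv.ask ∉ tm.priv i c) :
      Silent K lvlIn tm (.dec .root i c) .idle
  | ni₁ {i c} (hK : K = .ni) (h : Priv.ask ∈ tm.priv i c) :
      Silent K lvlIn tm (.dec .root i c) (.b0 i c)
  | ni₂ {i c} (hK : K = .ni) (h : Priv.ask ∉ tm.priv i c) :
      Silent K lvlIn tm (.dec .root i c) (.dec .sel i c)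
  | ni₃ {i c} (hK : K = .ni) (h : Priv.tell ∉ tm.priv i c) :
      Silent K lvlIn tm (.dec .sel i c) (.d0 i c)
  | ni₄ {i c} (hK : K = .ni) (h : Priv.tell ∈ tm.priv i c) :
      Silent K lvlIn tm (.dec .sel i c) .idle
  | di₁ {i c} (hK : K = .di) (h : lvlIn c = .high ∧ i = 0) :
      Silent K lvlIn tm (.dec .root i c) (.dec .clone i c)
  | di₂ {i c} (hK : K = .di) (h : ¬ (lvlIn c = .high ∧ i = 0)) :
      Silent K lvlIn tm (.dec .root i c) (.dec .cont i c)
  | di₃ {i c} (hK : K = .di) : Silent K lvlIn tm (.dec .cont i c) (.dec .sel i c)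
  | di₄ {i c} (hK : K = .di) (h : Priv.ask ∈ tm.priv i c) :
      Silent K lvlIn tm (.dec .sel i c) (.dec .both i c)
  | di₅ {i c} (hK : K = .di) (h : Priv.ask ∉ tm.priv i c) :
      Silent K lvlIn tm (.dec .sel i c) .idle
  | di₆ {i c} (hK : K = .di) (h : Priv.tell ∈ tm.priv i c) :
      Silent K lvlIn tm (.dec .both i c) (.b0 i c)
  | di₇ {i c} (hK : K = .di) (h : Priv.tell ∉ tm.priv i c) :
      Silent K lvlIn tm (.dec .both i c) (.d0 i c)
  | b1 {c v} : Silent K lvlIn tm (.b1 true c v) (.b1 false c v)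
  | b2 {c} : Silent K lvlIn tm (.b2 true c) (.b2 false c)
  | b3 {c} : Silent K lvlIn tm (.b3 true c) (.b3 false c)
  | d1 {i c} : Silent K lvlIn tm (.d1 true i c) (.d1 false i c)

omit [DecidableEq CIn] in
/-- The configuration behind a clone instruction of DI. -/
def EMConf.cloned (lvlIn : CIn → Level) (lvlOut : COut → Level) (i : ℕ) (γ : EMConf CIn COut) :
    EMConf CIn COut :=
  { γ with
    ex := γ.ex ++ γ.forks (identical i)
    tm := γ.tm ++ List.replicate (γ.forks (identical i)).length (column lvlIn {.ask} {.tell})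
    tr := γ.tr ++ List.replicate (γ.forks (identical i)).length (column lvlOut ∅ ∅) }

omit [DecidableEq CIn] in
def EMConf.append (γ : EMConf CIn COut) (P : LPred CIn COut) (c : CIn) (v : Val) :
    EMConf CIn COut :=
  γ.modify P (fun l => { l with inp := l.inp ++ [(c, v)] })

omit [DecidableEq CIn] in
def EMConf.wakeAll (γ : EMConf CIn COut) (P : LPred CIn COut) : EMConf CIn COut :=
  γ.modify P (fun l => { l with int := none, stt := .executing })

inductive MTrans (K : Kind) (lvlIn : CIn → Level) (lvlOut : COut → Level)
    (δ : Defaults CIn COut) (γ : EMConf CIn COut) :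
    MStage CIn → MStage CIn → EMConf CIn COut → Prop
  | silent {m m'} (h : Silent K lvlIn γ.tm m m') : MTrans K lvlIn lvlOut δ γ m m' γ
  | clone {i c} : MTrans K lvlIn lvlOut δ γ (.dec .clone i c) (.dec .cont i c)
      (γ.cloned lvlIn lvlOut i)
  | input {i c y I} (h : γ.inp = (c, y) :: I) : MTrans K lvlIn lvlOut δ γ (.b0 i c) (.b1 true c y)
      { γ with inp := I, mapMem := Function.update γ.mapMem varX y }
  | tell {c v} : MTrans K lvlIn lvlOut δ γ (.b1 false c v) (.b2 true c)
      (γ.append (canTell c) c (γ.mapMem varX))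
  | hide {c} : MTrans K lvlIn lvlOut δ γ (.b2 false c) (.b3 true c)
      (γ.append (notCanTell c) c (δ.inp c))
  | wake {c} : MTrans K lvlIn lvlOut δ γ (.b3 false c) .idle (γ.wakeAll (isReady c))
  | default {i c} : MTrans K lvlIn lvlOut δ γ (.d0 i c) (.d1 true i c)
      (γ.append (identical i) c (δ.inp c))
  | wakeOne {i c} : MTrans K lvlIn lvlOut δ γ (.d1 false i c) .idle (γ.wakeAll (identical i))

/-- Some control points are shared or make sense in one configuration only; there the condition of
the stage determines `K`. -/
theorem MapStep.inv {K : Kind} {lvlIn : CIn → Level} {lvlOut : COut → Level}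
    {δ : Defaults CIn COut} {γ γ' : EMConf CIn COut} {m : MStage CIn} {p : MapProg CIn COut}
    (h : MapStep (m.prog K lvlIn lvlOut δ) γ p γ') (hc : m.Cond K lvlIn γ.tm γ.ex γ.mapMem) :
    ∃ m', p = m'.prog K lvlIn lvlOut δ ∧ MTrans K lvlIn lvlOut δ γ m m' γ' := by
  cases m with
  | idle => cases h
  | dec q i c =>
    have hc2 := hc.2
    cases q
    case root =>
      cases K
      case ri =>
        cases h with
        | ifT h => exact ⟨_, rfl, .silent (.ri₁ rfl (by simpa [inTM] using h))⟩
        | ifF h => exact ⟨.idle, rfl, .silent (.ri₂ rfl (by simpa [inTM] using h))⟩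
      case ni =>
        cases h with
        | ifT h => exact ⟨_, rfl, .silent (.ni₁ rfl (by simpa [inTM] using h))⟩
        | ifF h => exact ⟨.dec .sel i c, rfl, .silent (.ni₂ rfl (by simpa [inTM] using h))⟩
      case di =>
        cases h with
        | comp h => cases h with
          | ifT h => exact ⟨.dec .clone i c, rfl, .silent (.di₁ rfl (by simpa [const] using h))⟩
          | ifF h => exact ⟨.dec .cont i c, rfl, .silent (.di₂ rfl (by simpa [const] using h))⟩
    case clone =>
      cases h with
      | comp h => cases h with
        | atom h => cases h with
          | clone => exact ⟨.dec .cont i c, rfl, .clone⟩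
    case cont =>
      obtain ⟨rfl, _⟩ := hc2
      cases h with
      | comp h => cases h
      | skip => exact ⟨.dec .sel i c, rfl, .silent (.di₃ rfl)⟩
    case sel =>
      rcases hc2 with ⟨rfl, _⟩ | ⟨rfl, _⟩
      · cases h with
        | ifT h => exact ⟨.dec .both i c, rfl, .silent (.di₄ rfl (by simpa [inTM] using h))⟩
        | ifF h => exact ⟨.idle, rfl, .silent (.di₅ rfl (by simpa [inTM] using h))⟩
      · cases h with
        | ifT h => exact ⟨.d0 i c, rfl, .silent (.ni₃ rfl (by simpa [notInTM] using h))⟩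
        | ifF h => exact ⟨.idle, rfl, .silent (.ni₄ rfl (by simpa [notInTM] using h))⟩
    case both =>
      obtain ⟨rfl, _⟩ := hc2
      cases h with
      | ifT h => exact ⟨.b0 i c, rfl, .silent (.di₆ rfl (by simpa [inTM] using h))⟩
      | ifF h => exact ⟨.d0 i c, rfl, .silent (.di₇ rfl (by simpa [inTM] using h))⟩
  | b0 i c =>
    cases h with
    | comp h => cases h with
      | atom h => cases h with
        | input h => exact ⟨.b1 true c _, rfl, .input h⟩
  | b1 w c v =>
    cases w
    · cases h with
      | comp h => cases h with
        | atom h => cases h with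
          | map h => cases h; exact ⟨.b2 true c, rfl, .tell⟩
    · cases h with
      | comp h => cases h
      | skip => exact ⟨.b1 false c v, rfl, .silent .b1⟩
  | b2 w c =>
    cases w
    · cases h with
      | comp h => cases h with
        | atom h => cases h with
          | map h => cases h; exact ⟨.b3 true c, rfl, .hide⟩
    · cases h with
      | comp h => cases h
      | skip => exact ⟨.b2 false c, rfl, .silent .b2⟩
  | b3 w c =>
    cases w
    · cases h with
      | atom h => cases h with
        | wake h => exact ⟨.idle, rfl, .wake⟩
    · cases h with
      | comp h => cases h
      | skip => exact ⟨.b3 false c, rfl, .silent .b3⟩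
  | d0 i c =>
    cases h with
    | comp h => cases h with
      | atom h => cases h with
        | map h => cases h; exact ⟨.d1 true i c, rfl, .default⟩
  | d1 w i c =>
    cases w
    · cases h with
      | atom h => cases h with
        | wake h => exact ⟨.idle, rfl, .wakeOne⟩
    · cases h with
      | comp h => cases h
      | skip => exact ⟨.d1 false i c, rfl, .silent .d1⟩

omit [DecidableEq CIn]

theorem modify_getElem? (γ : EMConf CIn COut) (P : LPred CIn COut)
    (f : LocalConf CIn COut → LocalConf CIn COut) (j : ℕ) :
    (γ.modify P f).ex[j]? = (γ.ex[j]?).map fun e => if γ.sat P j then f e else e := by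
  simp [EMConf.modify, List.getElem?_mapIdx]

theorem length_modify (γ : EMConf CIn COut) (P : LPred CIn COut)
    (f : LocalConf CIn COut → LocalConf CIn COut) : (γ.modify P f).ex.length = γ.ex.length := by
  simp [EMConf.modify]

theorem lt_of_getElem? {α : Type*} {l : List α} {j : ℕ} {a : α} (h : l[j]? = some a) :
    j < l.length :=
  (List.getElem?_eq_some_iff.1 h).1

theorem sat_isReady [DecidableEq CIn] {γ : EMConf CIn COut} {c : CIn} {j : ℕ}
    {e : LocalConf CIn COut} (hj : γ.ex[j]? = some e) :
    γ.sat (isReady c) j = true ↔ e.AtInput c ∧ Has c e.inp := by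
  have hd : (dequeue c e.inp).isSome = true ↔ Has c e.inp := by
    rw [Option.isSome_iff_ne_none, Ne, dequeue_eq_none, not_not]
  have hn : nextIsInput c e.prg = true ↔ ∃ x, e.prg.head = some (.input x c) := by
    unfold nextIsInput
    split
    · rename_i x d h
      simp only [decide_eq_true_eq, h, Option.some.injEq, IOInstr.input.injEq]
      exact ⟨fun h => ⟨x, rfl, h⟩, fun ⟨_, _, h⟩ => h⟩
    · rename_i h
      simp only [Bool.false_eq_true, false_iff, not_exists]
      exact fun x hx => h x c hx
  simp only [EMConf.sat, isReady, hj, Bool.and_eq_true, decide_eq_true_eq, hd, hn]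
  rfl

/-- What an instruction of MAP does to the control state of a local execution. -/
def MapChange (e a : LocalConf CIn COut) : Prop :=
  a.prg = e.prg ∧ a.mem = e.mem ∧ a.out = e.out ∧
    (a.stt = e.stt ∧ a.int = e.int ∨ (∃ c, e.AtInput c) ∧ a.stt = .executing ∧ a.int = none)

theorem MapChange.refl (e : LocalConf CIn COut) : MapChange e e :=
  ⟨rfl, rfl, rfl, .inl ⟨rfl, rfl⟩⟩

/-- The unread items `Q'` of local execution `j` arise from `Q` by a step of MAP. -/
def FlowSame (K : Kind) (lvlIn : CIn → Level) (j : ℕ) (Q Q' : Queue CIn) : Prop :=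
  -- The low part never changes, and execution 0 is told every item as it is. In RI every item taken
  -- from the environment reaches everyone and nothing else does, so only values can change.
  Queue.atLevel lvlIn .low Q' = Queue.atLevel lvlIn .low Q ∧ (j = 0 → Q' = Q) ∧
    (K = .ri → Q'.map Prod.fst = Q.map Prod.fst)

theorem FlowSame.refl (K : Kind) (lvlIn : CIn → Level) (j : ℕ) (Q : Queue CIn) :
    FlowSame K lvlIn j Q Q :=
  ⟨rfl, fun _ => rfl, fun _ => rfl⟩

theorem FlowSame.of_eq {K : Kind} {lvlIn : CIn → Level} {j : ℕ} {Q Q' : Queue CIn} (h : Q' = Q) :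
    FlowSame K lvlIn j Q Q' :=
  h ▸ FlowSame.refl K lvlIn j Q

theorem FlowSame.trans {K : Kind} {lvlIn : CIn → Level} {j : ℕ} {Q Q' Q'' : Queue CIn}
    (h : FlowSame K lvlIn j Q Q') (h' : FlowSame K lvlIn j Q' Q'') : FlowSame K lvlIn j Q Q'' :=
  ⟨h'.1.trans h.1, fun hj => (h'.2.1 hj).trans (h.2.1 hj), fun hK => (h'.2.2 hK).trans (h.2.2 hK)⟩

/-- The delicate steps are those that end MAP's program without serving the request (`ri₂`, `ni₄`,
`di₅`). The sleeper then has no signal, and the tables show that its request was low and not from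
execution 1, which `signal` admits. -/
theorem MapInv.silent {K : Kind} {lvlIn : CIn → Level} {lvlOut : COut → Level}
    {δ : Defaults CIn COut} {tm : Table CIn}
    {tr : Table COut} {ex : Stack CIn COut} {mm : Mem} {m m' : MStage CIn}
    (h : MapInv K lvlIn δ tm ex mm m) (ht : Tables K lvlIn lvlOut tm tr ex.length)
    (hs : Silent K lvlIn tm m m') : MapInv K lvlIn δ tm ex mm m' := by
  have hwait : ∀ {i c j e d}, Waits ex i c → ex[j]? = some e → e.AtInput d → i = j → c = d := by
    rintro i c j e d ⟨a, ha, hc⟩ he hd rfl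
    rw [ha] at he; cases he
    exact hc.unique hd
  have hlt : ∀ {i c}, Waits ex i c → i < ex.length := fun ⟨a, ha, _⟩ => lt_of_getElem? ha
  have hdel : ∀ c, m.Delivered c → m'.Delivered c := by
    intro c hc
    cases hs <;> exact hc
  have hwk : ∀ j d, m.WakesUp j d → m'.WakesUp j d := by
    rintro j d (h | ⟨w, rfl⟩)
    · exact .inl (hdel d h)
    · cases hs
      exact .inr ⟨false, rfl⟩
  have hserved : ∀ l, Served lvlIn ex m l → Served lvlIn ex m' l := by
    intro l hl e he
    rcases hl e he with h | ⟨x, c, v, h1, h2, h3, h4⟩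
    · exact .inl h
    · exact .inr ⟨x, c, v, h1, h2, h3, h4.imp_right (hdel c)⟩
  have hcond := h.cond
  refine ⟨h.default, hserved _ h.served_low, fun hK => hserved _ (h.served_high hK),
    fun j e d he ha hd => hwk j d (h.no_item j e d he ha hd), ?_, ?_⟩
  · intro j e d he ha hi
    rcases h.signal j e d he ha hi with h' | h'
    · exact .inl h'
    have low_of : ∀ c, lvlIn c ≠ .high → lvlIn c = .low := fun c hc => by
      cases hc' : lvlIn c <;> simp_all
    cases hs with
    | ri₁ hK hp =>
      rcases h' with h' | h'
      · exact .inr (hwait hcond.1 he ha h')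
      · exact (h'.2.2.2.1 rfl).elim
    | ni₁ hK hp =>
      rcases h' with h' | h'
      · exact .inr (hwait hcond.1 he ha h')
      · exact (h'.2.2.2.1 rfl).elim
    | @ri₂ i c hK hp =>
      -- In RI every execution may ask on high channels, so a refused request is low.
      have hl : lvlIn c = .low :=
        low_of c fun hc => hp (ht.ask_high (by simp [hK]) _ _ (hlt hcond.1) hc)
      rcases h' with h' | h'
      · cases hwait hcond.1 he ha h'
        subst h'
        exact .inl ⟨hl, fun h1 => hp ((ht.ask_low _ _ hl).2 h1)⟩
      · exact (h'.2.2.2.1 rfl).elim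
    | ni₂ hK hp =>
      rcases h' with h' | h'
      · exact .inr (.inl h')
      · exact (h'.2.2.2.1 rfl).elim
    | @ni₃ i c hK hp =>
      rcases h' with h' | h'
      · exact .inr h'
      · exact (hp ((ht.tell_high _ _ h'.2.1).2 h'.1)).elim
    | @ni₄ i c hK hp =>
      have hna : Priv.ask ∉ tm.priv i c := by
        rcases hcond.2 with h | h
        · rw [hK] at h; cases h.1
        · exact h.2
      -- On a high channel, permission to tell would single out execution 0, which may ask there.
      have hl : lvlIn c = .low := low_of c fun hc => by
        have := (ht.tell_high _ _ hc).1 hp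
        subst this
        exact hna (ht.ask_high_zero c hc)
      rcases h' with h' | h'
      · cases hwait hcond.1 he ha h'
        subst h'
        exact .inl ⟨hl, fun h1 => hna ((ht.ask_low _ _ hl).2 h1)⟩
      · rw [hl] at h'; cases h'.2.1
    | di₁ hK hp =>
      rcases h' with h' | h'
      · exact .inr (.inl h')
      · exact (h'.2.2.2.1 rfl).elim
    | di₂ hK hp =>
      rcases h' with h' | h'
      · exact .inr (.inl h')
      · exact (h'.2.2.2.1 rfl).elim
    | di₃ hK => exact .inr (h'.imp_right fun h => ⟨h.1, h.2.1, h.2.2.1, by simp, by simp⟩)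
    | di₄ hK hp => exact .inr (h'.imp_right fun h => ⟨h.1, h.2.1, h.2.2.1, by simp, by simp⟩)
    | @di₅ i c hK hp =>
      have hl : lvlIn c = .low :=
        low_of c fun hc => hp (ht.ask_high (by simp [hK]) _ _ (hlt hcond.1) hc)
      rcases h' with h' | h'
      · cases hwait hcond.1 he ha h'
        subst h'
        exact .inl ⟨hl, fun h1 => hp ((ht.ask_low _ _ hl).2 h1)⟩
      · rw [hl] at h'; cases h'.2.1
    | di₆ hK hp =>
      rcases h' with h' | h'
      · exact .inr (hwait hcond.1 he ha h')
      · exact .inr h'.2.2.1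
    | @di₇ i c hK hp =>
      rcases h' with h' | h'
      · exact .inr h'
      · exact (hp ((ht.tell_high _ _ h'.2.1).2 h'.1)).elim
    | b1 => exact .inr h'
    | b2 => exact .inr h'
    | b3 => exact .inr h'
    | d1 => exact .inr h'
  -- Low items are told to everybody and high ones to execution 0, so a requester that is not told
  -- is another execution on a high channel.
  · have hhigh : ∀ {i c}, Waits ex i c → Priv.tell ∉ tm.priv i c → lvlIn c = .high ∧ i ≠ 0 := by
      intro i c hw hp
      have hc : lvlIn c = .high := by
        cases hc : lvlIn c
        · exact (hp (ht.tell_low _ _ (hlt hw) hc)).elim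
        · rfl
      exact ⟨hc, fun hi => hp ((ht.tell_high _ _ hc).2 hi)⟩
    cases hs with
    | ri₁ hK hp => exact ⟨hcond.1, hp, by simp [hK]⟩
    | ri₂ => trivial
    | ni₁ hK hp => exact ⟨hcond.1, hp, by simp [hK]⟩
    | ni₂ hK hp => exact ⟨hcond.1, .inr ⟨hK, hp⟩⟩
    | ni₃ hK hp =>
      exact ⟨hcond.1, (hhigh hcond.1 hp).1, (hhigh hcond.1 hp).2, by simp [hK]⟩
    | ni₄ => trivial
    | di₁ hK hp => exact ⟨hcond.1, hK, hp.2, hp.1⟩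
    | di₂ hK hp => exact ⟨hcond.1, hK, fun h1 h2 => (hp ⟨h2, h1⟩).elim⟩
    | di₃ hK => exact ⟨hcond.1, .inl hcond.2⟩
    | di₄ hK hp =>
      refine ⟨hcond.1, hK, ?_, hp⟩
      rcases hcond.2 with h | h
      · exact h.2
      · rw [hK] at h; cases h.1
    | di₅ => trivial
    | di₆ hK hp =>
      exact ⟨hcond.1, hcond.2.2.2, fun _ => ⟨hp, fun hc =>
        hcond.2.2.1 ((ht.tell_high _ _ hc).1 hp) hc⟩⟩
    | di₇ hK hp =>
      exact ⟨hcond.1, (hhigh hcond.1 hp).1, (hhigh hcond.1 hp).2, by simp [hK]⟩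
    | b1 => exact hcond
    | b2 => trivial
    | b3 => trivial
    | d1 => exact hcond

/-- The effect on MAP's invariant of appending the items `add j` to the input queues. -/
theorem MapInv.append {K : Kind} {lvlIn : CIn → Level} {δ : Defaults CIn COut} {tm : Table CIn}
    {ex ex' : Stack CIn COut} {mm : Mem} {m m' : MStage CIn} {add : ℕ → Queue CIn}
    (h : MapInv K lvlIn δ tm ex mm m)
    (hex : ∀ j : ℕ, ex'[j]? = (ex[j]?).map fun e : LocalConf CIn COut => { e with inp := e.inp ++ add j })
    (hdef : ∀ j, j ≠ 0 → ∀ q ∈ add j, lvlIn q.1 = .high → q.2 = δ.inp q.1)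
    (hserved : ∀ l, (l = .low ∨ K = .di) →
      (Queue.atLevel lvlIn l (add (asker l)) = [] ∧ ∀ c, m.Delivered c → m'.Delivered c) ∨
      ∃ c v, lvlIn c = l ∧ Queue.atLevel lvlIn l (add (asker l)) = [(c, v)] ∧
        Waits ex (asker l) c ∧ (∀ c, ¬ m.Delivered c) ∧ m'.Delivered c)
    (hno : ∀ j d, Has d (add j) → m'.WakesUp j d)
    (hwk : ∀ j d, m.WakesUp j d → m'.WakesUp j d)
    (hsig : ∀ j d Q, j < ex.length → m.Handles lvlIn tm j d Q →
      m'.Handles lvlIn tm j d (Q ++ add j))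
    (hcond : m'.Cond K lvlIn tm ex' mm) : MapInv K lvlIn δ tm ex' mm m' := by
  have key : ∀ (j : ℕ) (a : LocalConf CIn COut), ex'[j]? = some a →
      ∃ e, ex[j]? = some e ∧ a = { e with inp := e.inp ++ add j } := by
    intro (j : ℕ) a ha
    rw [hex] at ha
    obtain ⟨e, he, rfl⟩ := Option.map_eq_some_iff.1 ha
    exact ⟨e, he, rfl⟩
  have hs : ∀ l, (l = .low ∨ K = .di) → Served lvlIn ex m l → Served lvlIn ex' m' l := by
    intro l hl hS a ha
    obtain ⟨e, he, rfl⟩ := key _ a ha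
    rcases hserved l hl with ⟨h1, h2⟩ | ⟨c, v, h1, h2, h3, h4, h5⟩
    · rcases hS e he with h | ⟨x, c, v, h3, h4, h5, h6⟩
      · left; simp [atLevel_append, h, h1]
      · exact .inr ⟨x, c, v, h3, h4, by simp [atLevel_append, h5, h1], h6.imp_right (h2 c)⟩
    · obtain ⟨b, hb, hbc⟩ := h3
      rw [he] at hb; cases hb
      rcases hS e he with h | ⟨x, d, w, h6, h7, h8, h9⟩
      · obtain ⟨hst, x, hx⟩ := hbc
        exact .inr ⟨x, c, v, h1, hx, by simp [atLevel_append, h, h2], .inr h5⟩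
      -- The asker sleeps and nothing has been delivered so far, so it cannot already hold an item
      -- of the level.
      · rcases h9 with h9 | h9
        · exact (hbc.not_executing h9).elim
        · exact (h4 d h9).elim
  refine ⟨?_, hs _ (.inl rfl) h.served_low, fun hK => hs _ (.inr hK) (h.served_high hK), ?_, ?_,
    hcond⟩
  · intro j a ha hj q hq hq'
    obtain ⟨e, he, rfl⟩ := key _ a ha
    rcases List.mem_append.1 hq with hq | hq
    · exact h.default j e he hj q hq hq'
    · exact hdef j hj q hq hq'
  · intro j a d ha hd hh
    obtain ⟨e, he, rfl⟩ := key _ a ha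
    rcases Has.append.1 hh with hh | hh
    · exact hwk j d (h.no_item j e d he hd hh)
    · exact hno j d hh
  · intro j a d ha hd hi
    obtain ⟨e, he, rfl⟩ := key _ a ha
    exact (h.signal j e d he hd hi).imp_right (hsig j d e.inp (lt_of_getElem? he))

/-- The effect on MAP's invariant of waking some local executions that sleep on inputs. -/
theorem MapInv.wakeUp {K : Kind} {lvlIn : CIn → Level} {δ : Defaults CIn COut} {tm : Table CIn}
    {ex ex' : Stack CIn COut} {mm : Mem} {m : MStage CIn} {W : ℕ → LocalConf CIn COut → Prop}
    (h : MapInv K lvlIn δ tm ex mm m)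
    (hex : ∀ (j : ℕ) (a : LocalConf CIn COut), ex'[j]? = some a → ∃ e, ex[j]? = some e ∧
      (W j e ∧ a = { e with int := none, stt := .executing } ∨ ¬ W j e ∧ a = e))
    (hW : ∀ (j : ℕ) (e : LocalConf CIn COut) d, ex[j]? = some e → e.AtInput d → Has d e.inp → m.WakesUp j d → W j e)
    (hW' : ∀ (j : ℕ) (e : LocalConf CIn COut) d, ex[j]? = some e → e.AtInput d → m.Handles lvlIn tm j d e.inp → W j e) :
    MapInv K lvlIn δ tm ex' mm .idle := by
  have hs : ∀ l, Served lvlIn ex m l → Served lvlIn ex' .idle l := by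
    intro l hS a ha
    obtain ⟨e, he, hWe⟩ := hex _ a ha
    have hinp : a.inp = e.inp := by rcases hWe with ⟨_, rfl⟩ | ⟨_, rfl⟩ <;> rfl
    have hprg : a.prg = e.prg := by rcases hWe with ⟨_, rfl⟩ | ⟨_, rfl⟩ <;> rfl
    rw [hinp, hprg]
    rcases hS e he with h | ⟨x, c, v, h3, h4, h5, h6⟩
    · exact .inl h
    · refine .inr ⟨x, c, v, h3, h4, h5, .inl ?_⟩
      rcases hWe with ⟨_, rfl⟩ | ⟨hn, rfl⟩
      · rfl
      · rcases h6 with h6 | h6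
        · exact h6
        · by_contra hne
          have hsl : a.stt = .sleeping := by cases hst : a.stt <;> simp_all
          have hmem : (c, v) ∈ Queue.atLevel lvlIn l a.inp := by simp [h5]
          exact hn (hW _ a c he ⟨hsl, x, h4⟩ ⟨v, (List.mem_filter.1 hmem).1⟩ (.inl h6))
  refine ⟨?_, hs _ h.served_low, fun hK => hs _ (h.served_high hK), ?_, ?_, trivial⟩
  · intro j a ha hj q hq hq'
    obtain ⟨e, he, hWe⟩ := hex _ a ha
    have hinp : a.inp = e.inp := by rcases hWe with ⟨_, rfl⟩ | ⟨_, rfl⟩ <;> rfl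
    rw [hinp] at hq
    exact h.default j e he hj q hq hq'
  · intro j a d ha hd hh
    obtain ⟨e, he, ⟨_, rfl⟩ | ⟨hn, rfl⟩⟩ := hex _ a ha
    · exact (hd.not_executing rfl).elim
    · exact (hn (hW j a d he hd hh (h.no_item j a d he hd hh))).elim
  · intro j a d ha hd hi
    obtain ⟨e, he, ⟨_, rfl⟩ | ⟨hn, rfl⟩⟩ := hex _ a ha
    · exact (hd.not_executing rfl).elim
    · exact (h.signal j a d he hd hi).imp_right fun hh => hn (hW' j a d he hd hh)

end Map

/-! ### MAP preserves the invariant and the unread items -/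

section Effect

variable {CIn : Type u} {COut : Type v}

theorem Table.priv_concat {C : Type u} (T : Table C) (col : C → Finset Priv) (j : ℕ) (c : C) :
    Table.priv (T ++ [col]) j c =
      if j < T.length then T.priv j c else if j = T.length then col c else ∅ := by
  unfold Table.priv
  by_cases h : j < T.length
  · simp [h, List.getElem?_append_left h]
  · rw [List.getElem?_append_right (by omega)]
    by_cases h' : j = T.length
    · simp [h']
    · have : j - T.length ≠ 0 := by omega
      simp [h, h', this]

theorem Table.priv_of_le {C : Type u} {T : Table C} {j : ℕ} {c : C} (h : T.length ≤ j) :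
    T.priv j c = ∅ := by
  unfold Table.priv
  rw [List.getElem?_eq_none h]

/-- The new column has an index of at least 2, so it only has to grant tell on low and ask on high
channels and to withhold everything else. -/
theorem Tables.concat {lvlIn : CIn → Level} {lvlOut : COut → Level} {tm : Table CIn}
    {tr : Table COut} {n : ℕ} (h : Tables .di lvlIn lvlOut tm tr n) :
    Tables .di lvlIn lvlOut (tm ++ [column lvlIn {.ask} {.tell}]) (tr ++ [column lvlOut ∅ ∅])
      (n + 1) := by
  have h2 := h.two_le
  have hM : ∀ j c, Table.priv (tm ++ [column lvlIn {.ask} {.tell}]) j c =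
      if j = n then column lvlIn {.ask} {.tell} c else tm.priv j c := by
    intro j c
    rw [Table.priv_concat, h.length_tm]
    split_ifs with h1 h2 h2
    · omega
    · rfl
    · rfl
    · rw [Table.priv_of_le (by rw [h.length_tm]; omega)]
  -- A column without privileges behaves like no column at all.
  have hR : ∀ j c, Table.priv (tr ++ [column lvlOut ∅ ∅]) j c = tr.priv j c := by
    intro j c
    rw [Table.priv_concat, h.length_tr]
    split_ifs with h1 h2
    · rfl
    · rw [Table.priv_of_le (by rw [h.length_tr]; omega)]
      unfold column; cases lvlOut c <;> rfl
    · rw [Table.priv_of_le (by rw [h.length_tr]; omega)]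
  refine ⟨by omega, fun h => (h rfl).elim, by simp [h.length_tm], by simp [h.length_tr], ?_, ?_, ?_, ?_, ?_, ?_, ?_⟩
  · intro j c hc
    rw [hM]
    split_ifs with hj
    · have : j ≠ 0 := by omega
      simp [column, hc, this]
    · exact h.tell_high j c hc
  · intro j c hj hc
    rw [hM]
    split_ifs with hj'
    · simp [column, hc]
    · exact h.tell_low j c (by omega) hc
  · intro j c hc
    rw [hM]
    split_ifs with hj
    · have : j ≠ 1 := by omega
      simp [column, hc, this]
    · exact h.ask_low j c hc
  · intro hK j c hj hc
    rw [hM]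
    split_ifs with hj'
    · simp [column, hc]
    · exact h.ask_high hK j c (by omega) hc
  · intro c hc
    rw [hM, if_neg (by omega)]
    exact h.ask_high_zero c hc
  · intro j c; rw [hR]; exact h.ask_out j c
  · intro j c; rw [hR]; exact h.tell_out j c

/-- The predicate holds at index `i` alone; the stack is split there, and the parts before and
behind contribute nothing. -/
theorem forks_identical {γ : EMConf CIn COut} {i : ℕ} {e : LocalConf CIn COut}
    (hi : γ.ex[i]? = some e) : γ.forks (identical i) = [{ e with stt := .sleeping }] := by
  -- `n` is the position of the sublist `l` within the stack.
  have aux : ∀ (l : List (LocalConf CIn COut)) (n : ℕ), (∀ j, l[j]? ≠ none → j + n ≠ i) →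
      (l.mapIdx (fun j a => if γ.sat (identical i) (j + n) then
        some { a with stt := Status.sleeping } else none)).reduceOption = [] := by
    intro l n hl
    rw [List.reduceOption, List.filterMap_eq_nil_iff]
    intro o ho
    obtain ⟨j, hj, rfl⟩ := List.mem_iff_getElem.1 ho
    have : ¬ (j + n = i) := hl j (by simp at hj; simp [hj])
    simp [EMConf.sat, identical, this]
  have hlt := lt_of_getElem? hi
  have hsplit : γ.ex = γ.ex.take i ++ e :: γ.ex.drop (i + 1) := by
    have := List.take_append_drop i γ.ex
    rw [List.drop_eq_getElem_cons hlt] at this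
    rw [← (List.getElem?_eq_some_iff.1 hi).2]
    exact this.symm
  unfold EMConf.forks
  conv_lhs => rw [hsplit]
  rw [List.mapIdx_append, List.mapIdx_cons, List.reduceOption_append]
  have h1 := aux (γ.ex.take i) 0 (by
    intro j hj
    have : j < i := by
      by_contra h
      exact hj (List.getElem?_eq_none (by simp; omega))
    omega)
  have h2 := aux (γ.ex.drop (i + 1)) (i + 1) (by intro j _; omega)
  have hlen : (γ.ex.take i).length = i := by simp; omega
  simp only [Nat.add_zero] at h1
  rw [h1]
  simp only [hlen, List.nil_append]
  have h3 : γ.sat (identical i) (0 + i) = true := by simp [EMConf.sat, identical]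
  rw [if_pos h3]
  have h4 : ∀ j, j + 1 + i = j + (i + 1) := fun j => by omega
  simp only [h4]
  rw [List.reduceOption_cons_of_some, h2]

theorem cloned_eq {lvlIn : CIn → Level} {lvlOut : COut → Level} {γ : EMConf CIn COut} {i : ℕ}
    {e : LocalConf CIn COut} (hi : γ.ex[i]? = some e) (he : e.stt = .sleeping) :
    γ.cloned lvlIn lvlOut i = { γ with
      ex := γ.ex ++ [e]
      tm := γ.tm ++ [column lvlIn {.ask} {.tell}]
      tr := γ.tr ++ [column lvlOut ∅ ∅] } := by
  have : ({ e with stt := .sleeping } : LocalConf CIn COut) = e := by rw [← he]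
  simp [EMConf.cloned, forks_identical hi, this]

theorem getElem?_concat {α : Type*} {l : List α} {a b : α} {j : ℕ} (h : (l ++ [a])[j]? = some b) :
    l[j]? = some b ∨ j = l.length ∧ b = a := by
  by_cases hj : j < l.length
  · rw [List.getElem?_append_left hj] at h; exact .inl h
  · rw [List.getElem?_append_right (by omega)] at h
    have h0 : j - l.length = 0 := by
      have := lt_of_getElem? h
      simpa using this
    rw [h0] at h
    simp at h
    exact .inr ⟨by omega, h.symm⟩

theorem Waits.concat {ex : Stack CIn COut} {j : ℕ} {c : CIn} {e : LocalConf CIn COut}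
    (h : Waits ex j c) : Waits (ex ++ [e]) j c := by
  obtain ⟨a, ha, hc⟩ := h
  exact ⟨a, by rw [List.getElem?_append_left (lt_of_getElem? ha), ha], hc⟩

/-- A clone must hold no genuine high value, although execution 0 reads such values. It holds none:
execution 0 is asleep on an input and nothing has been delivered to it, so by `Served` its queue
contains no high item when it is copied. -/
theorem MapInv.clone {lvlIn : CIn → Level} {lvlOut : COut → Level} {δ : Defaults CIn COut}
    {tm : Table CIn} {tr : Table COut} {ex : Stack CIn COut} {mm : Mem} {c : CIn}
    {e : LocalConf CIn COut} (h : MapInv .di lvlIn δ tm ex mm (.dec .clone 0 c))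
    (ht : Tables .di lvlIn lvlOut tm tr ex.length) (he : ex[0]? = some e) (hc : e.AtInput c)
    (hl : lvlIn c = .high) (col : CIn → Finset Priv) :
    MapInv .di lvlIn δ (tm ++ [col]) (ex ++ [e]) mm (.dec .cont 0 c) := by
  have h2 := ht.two_le
  have hnil : Queue.atLevel lvlIn .high e.inp = [] := by
    rcases h.served_high rfl e he with h | ⟨x, d, v, h1, h2, h3, h4⟩
    · exact h
    · rcases h4 with h4 | h4
      · exact (hc.not_executing h4).elim
      · exact h4.elim
  have hs : ∀ l, Served lvlIn ex (.dec .clone 0 c) l →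
      Served lvlIn (ex ++ [e]) (.dec .cont 0 c) l := by
    intro l hS a ha
    have hlt : asker l < ex.length := by
      have : asker l ≤ 1 := by cases l <;> simp [asker]
      omega
    rw [List.getElem?_append_left hlt] at ha
    rcases hS a ha with h | ⟨x, d, v, h1, h2, h3, h4⟩
    · exact .inl h
    · exact .inr ⟨x, d, v, h1, h2, h3, h4.imp_right fun h => h.elim⟩
  refine ⟨?_, hs _ h.served_low, fun hK => hs _ (h.served_high hK), ?_, ?_, ?_⟩
  · intro j a ha hj q hq hq'
    rcases getElem?_concat ha with ha | ⟨_, rfl⟩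
    · exact h.default j a ha hj q hq hq'
    · have : q ∈ Queue.atLevel lvlIn .high a.inp := List.mem_filter.2 ⟨hq, by simp [hq']⟩
      rw [hnil] at this; simp at this
  · intro j a d ha hd hh
    rcases getElem?_concat ha with ha | ⟨_, rfl⟩
    · rcases h.no_item j a d ha hd hh with h | ⟨w, h⟩
      · exact h.elim
      · cases h
    · rcases h.no_item 0 a d he hd hh with h | ⟨w, h⟩
      · exact h.elim
      · cases h
  · intro j a d ha hd hi
    rcases getElem?_concat ha with ha | ⟨_, rfl⟩
    · rcases h.signal j a d ha hd hi with h | h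
      · exact .inl h
      · rcases h with h | h
        · exact .inr (.inl h)
        · exact (h.2.2.2.2 rfl).elim
    -- A clone without a signal of its own is still being handled: the broadcast on its channel
    -- under way will wake it together with execution 0.
    · exact .inr (.inr ⟨rfl, hl, hc.unique hd, by simp, by simp⟩)
  · refine ⟨⟨e, by rw [List.getElem?_append_left (by omega), he], hc⟩, rfl, fun _ _ => ?_⟩
    exact ⟨ex.length, e, e, c, h2, by rw [List.getElem?_append_left (by omega), he], by simp, hc, hc,
      rfl, rfl, rfl⟩

/-- The effect of a step of MAP. -/
structure MapEffect (K : Kind) (lvlIn : CIn → Level) (lvlOut : COut → Level)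
    (δ : Defaults CIn COut) (γ γ' : EMConf CIn COut) (m m' : MStage CIn) : Prop where
  redPrg : γ'.redPrg = γ.redPrg
  redMem : γ'.redMem = γ.redMem
  out : γ'.out = γ.out
  tables : Tables K lvlIn lvlOut γ'.tm γ'.tr γ'.ex.length
  map : MapInv K lvlIn δ γ'.tm γ'.ex γ'.mapMem m'
  old : ∀ (j : ℕ) (e : LocalConf CIn COut), γ.ex[j]? = some e → ∃ a, γ'.ex[j]? = some a ∧
    MapChange e a ∧ FlowSame K lvlIn j (flow δ γ m j e) (flow δ γ' m' j a)
  new : ∀ (j : ℕ) (a : LocalConf CIn COut), γ'.ex[j]? = some a →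
    j < γ.ex.length ∨ ∃ c, γ.ex[0]? = some a ∧ a.AtInput c ∧
      flow δ γ' m' j a = flow δ γ m 0 a

theorem MapEffect.of_modify {K : Kind} {lvlIn : CIn → Level} {lvlOut : COut → Level}
    {δ : Defaults CIn COut} {γ : EMConf CIn COut} {m m' : MStage CIn} {P : LPred CIn COut}
    {f : LocalConf CIn COut → LocalConf CIn COut}
    (ht : Tables K lvlIn lvlOut γ.tm γ.tr γ.ex.length)
    (hm : MapInv K lvlIn δ γ.tm (γ.modify P f).ex γ.mapMem m')
    (hf : ∀ (j : ℕ) (e : LocalConf CIn COut), γ.ex[j]? = some e →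
      MapChange e (if γ.sat P j then f e else e) ∧
      FlowSame K lvlIn j (flow δ γ m j e) (flow δ γ m' j (if γ.sat P j then f e else e))) :
    MapEffect K lvlIn lvlOut δ γ (γ.modify P f) m m' where
  redPrg := rfl
  redMem := rfl
  out := rfl
  tables := by rw [length_modify]; exact ht
  map := hm
  old j e he := ⟨_, by rw [modify_getElem?, he]; rfl, hf j e he⟩
  new j a ha := .inl (by rw [← length_modify γ P f]; exact lt_of_getElem? ha)

theorem Waits.append {ex ex' : Stack CIn COut} {add : ℕ → Queue CIn} {i : ℕ} {c : CIn}
    (hex : ∀ j : ℕ, ex'[j]? = (ex[j]?).map fun e : LocalConf CIn COut =>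
      { e with inp := e.inp ++ add j })
    (h : Waits ex i c) : Waits ex' i c := by
  obtain ⟨a, ha, hc⟩ := h
  exact ⟨{ a with inp := a.inp ++ add i }, by rw [hex, ha]; rfl, hc.1, hc.2⟩

theorem append_getElem? (γ : EMConf CIn COut) (P : LPred CIn COut) (c : CIn) (v : Val) (j : ℕ) :
    (γ.append P c v).ex[j]? = (γ.ex[j]?).map fun e : LocalConf CIn COut =>
      { e with inp := e.inp ++ if γ.sat P j then [(c, v)] else [] } := by
  rw [EMConf.append, modify_getElem?]
  congr 1
  funext e
  split_ifs <;> simp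

theorem MapChange.append (e : LocalConf CIn COut) (b : Bool) (Q : Queue CIn) :
    MapChange e (if b then { e with inp := e.inp ++ Q } else e) := by
  cases b <;> exact ⟨rfl, rfl, rfl, .inl ⟨rfl, rfl⟩⟩

variable [DecidableEq CIn]

/-- A broadcast moves an item from the environment through `inflight` to the local queues, possibly
replacing its value; only a default delivery creates an item. Both stay within the changes that
`FlowSame` tolerates. -/
theorem MTrans.effect {K : Kind} {lvlIn : CIn → Level} {lvlOut : COut → Level}
    {δ : Defaults CIn COut} {γ γ' : EMConf CIn COut} {m m' : MStage CIn}
    (h : MTrans K lvlIn lvlOut δ γ m m' γ') (ht : Tables K lvlIn lvlOut γ.tm γ.tr γ.ex.length)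
    (hm : MapInv K lvlIn δ γ.tm γ.ex γ.mapMem m) :
    MapEffect K lvlIn lvlOut δ γ γ' m m' := by
  have hcond := hm.cond
  have h2 := ht.two_le
  cases h with
  | silent h =>
    refine ⟨rfl, rfl, rfl, ht, hm.silent ht h, fun j e he => ⟨e, he, .refl e, .of_eq ?_⟩,
      fun j a ha => .inl (lt_of_getElem? ha)⟩
    cases h <;> rfl
  | @clone i c =>
    obtain ⟨⟨e, he, hc⟩, rfl, rfl, hl⟩ := hcond
    rw [cloned_eq he hc.1]
    refine ⟨rfl, rfl, rfl, by simpa using ht.concat, hm.clone ht he hc hl _, ?_, ?_⟩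
    · intro j a ha
      exact ⟨a, by simp only; rw [List.getElem?_append_left (lt_of_getElem? ha), ha], .refl a,
        .of_eq rfl⟩
    · intro j a ha
      rcases getElem?_concat ha with ha | ⟨_, rfl⟩
      · exact .inl (lt_of_getElem? ha)
      · exact .inr ⟨c, he, hc, rfl⟩
  | @input i c y I h =>
    have hw : ∀ a, Waits γ.ex i a → i < γ.ex.length := fun a ⟨e, he, _⟩ => lt_of_getElem? he
    have hs : ∀ l, Served lvlIn γ.ex (.b0 i c) l → Served lvlIn γ.ex (.b1 true c y) l := by
      intro l hS a ha
      rcases hS a ha with h | ⟨x, d, v, h1, h2, h3, h4⟩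
      · exact .inl h
      · exact .inr ⟨x, d, v, h1, h2, h3, h4.imp_right fun h => h.elim⟩
    refine ⟨rfl, rfl, rfl, ht, ⟨hm.default, hs _ hm.served_low, fun hK => hs _ (hm.served_high hK),
      ?_, ?_, ?_⟩, ?_, fun j a ha => .inl (lt_of_getElem? ha)⟩
    · intro j e d he hd hh
      rcases hm.no_item j e d he hd hh with h | ⟨w, h⟩
      · exact h.elim
      · cases h
    · exact hm.signal
    · refine ⟨by simp, ?_⟩
      intro hor
      -- Low items are asked for by execution 1 only, and DI broadcasts a high item only for a
      -- requester that may be told it, which is execution 0.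
      have hi : asker (lvlIn c) = i := by
        cases hc : lvlIn c with
        | low => exact ((ht.ask_low i c hc).1 hcond.2.1).symm
        | high =>
          rcases hor with h | hK
          · rw [hc] at h; cases h
          · exact ((ht.tell_high i c hc).1 (hcond.2.2 hK).1).symm
      rw [hi]; exact hcond.1
    · intro j e he
      refine ⟨e, he, .refl e, ?_⟩
      have e1 : flow δ γ (.b0 i c) j e = e.inp ++ (c, y) :: I := by
        simp [flow, MStage.inflight, h]
      by_cases hp : Priv.tell ∈ γ.tm.priv j c
      · refine .of_eq ?_
        rw [e1]; simp [flow, MStage.inflight, hp]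
      -- An item is hidden only on a high channel, so replacing its value affects neither the low
      -- part nor the channel.
      · have hc : lvlIn c = .high := by
          cases hc : lvlIn c
          · exact (hp (ht.tell_low _ _ (lt_of_getElem? he) hc)).elim
          · rfl
        have hc' : lvlIn c ≠ .low := by simp [hc]
        rw [e1]
        refine ⟨?_, fun hj => (hp ((ht.tell_high _ _ hc).2 hj)).elim, fun _ => ?_⟩
        · simp [flow, MStage.inflight, hp, atLevel_append, atLevel_cons_of_ne hc']
        · simp [flow, MStage.inflight]
  | @tell c v =>
    refine MapEffect.of_modify ht ?_ ?_
    · refine hm.append (add := fun j => if γ.sat (canTell c) j then [(c, γ.mapMem varX)] else [])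
        (append_getElem? γ _ _ _) ?_ ?_ ?_ ?_ ?_ trivial
      · intro j hj q hq hc
        have hn : Priv.tell ∉ γ.tm.priv j q.1 := fun hp => hj ((ht.tell_high j _ hc).1 hp)
        by_cases hp : Priv.tell ∈ γ.tm.priv j c
        · simp only [EMConf.sat, canTell, hp, decide_true, if_true, List.mem_singleton] at hq
          rw [hq] at hn; exact (hn hp).elim
        · simp [EMConf.sat, canTell, hp] at hq
      · intro l hl
        by_cases hlc : lvlIn c = l
        · right
          have hp : Priv.tell ∈ γ.tm.priv (asker l) c := by
            cases l
            · exact ht.tell_low _ _ (by simp only [asker]; omega) hlc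
            · exact (ht.tell_high _ _ hlc).2 rfl
          refine ⟨c, γ.mapMem varX, hlc, ?_, ?_, fun _ h => h, rfl⟩
          · simp [EMConf.sat, canTell, hp, atLevel_cons_of_eq hlc]
          · rw [← hlc]; exact hcond.2 (by rw [hlc]; exact hl)
        · left
          refine ⟨?_, fun c h => h.elim⟩
          split_ifs <;> simp [atLevel_cons_of_ne hlc]
      · intro j d hh
        have : c = d := by
          split_ifs at hh
          · exact (Has.singleton.1 hh).symm
          · exact (Has.nil hh).elim
        exact .inl this
      · rintro j d (h | ⟨w, h⟩)
        · exact h.elim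
        · cases h
      · intro j d Q hj hh
        refine ⟨hh, fun hp => ?_⟩
        simp [EMConf.sat, canTell, hp]
    · intro j e he
      refine ⟨.append e _ _, .of_eq ?_⟩
      have hv : γ.mapMem varX = v := hcond.1
      by_cases hp : Priv.tell ∈ γ.tm.priv j c <;>
        simp [flow, MStage.inflight, EMConf.sat, canTell, hp, hv]
  | @hide c =>
    refine MapEffect.of_modify ht ?_ ?_
    · refine hm.append (add := fun j => if γ.sat (notCanTell c) j then [(c, δ.inp c)] else [])
        (append_getElem? γ _ _ _) ?_ ?_ ?_ ?_ ?_ trivial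
      · intro j hj q hq hc
        split_ifs at hq
        · rw [List.mem_singleton.1 hq]
        · simp at hq
      · intro l hl
        left
        refine ⟨?_, fun c h => h⟩
        by_cases hlc : lvlIn c = l
        -- The asker of a level is told the items of that level, so hidden items go to others and
        -- `Served` is not affected.
        · have hp : Priv.tell ∈ γ.tm.priv (asker l) c := by
            cases l
            · exact ht.tell_low _ _ (by simp only [asker]; omega) hlc
            · exact (ht.tell_high _ _ hlc).2 rfl
          simp [EMConf.sat, notCanTell, hp]
        · split_ifs <;> simp [atLevel_cons_of_ne hlc]
      · intro j d hh
        have : c = d := by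
          split_ifs at hh
          · exact (Has.singleton.1 hh).symm
          · exact (Has.nil hh).elim
        exact .inl this
      · rintro j d (h | ⟨w, h⟩)
        · exact .inl h
        · cases h
      · rintro j d Q hj ⟨rfl, hh⟩
        refine ⟨rfl, ?_⟩
        by_cases hp : Priv.tell ∈ γ.tm.priv j c
        · exact Has.append.2 (.inl (hh hp))
        · simp [EMConf.sat, notCanTell, hp]
    · intro j e he
      refine ⟨.append e _ _, .of_eq ?_⟩
      by_cases hp : Priv.tell ∈ γ.tm.priv j c <;>
        simp [flow, MStage.inflight, EMConf.sat, notCanTell, hp]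
  | @wake c =>
    refine MapEffect.of_modify ht ?_ ?_
    · refine hm.wakeUp (W := fun j e => e.AtInput c ∧ Has c e.inp) ?_ ?_ ?_
      · intro j a ha
        rw [modify_getElem?] at ha
        obtain ⟨e, he, rfl⟩ := Option.map_eq_some_iff.1 ha
        refine ⟨e, he, ?_⟩
        by_cases hs : γ.sat (isReady c) j = true
        · exact .inl ⟨(sat_isReady he).1 hs, by simp [hs]⟩
        · exact .inr ⟨fun h => hs ((sat_isReady he).2 h), by simp [hs]⟩
      · intro j e d he hd hh hw
        rcases hw with hw | ⟨w, hw⟩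
        · cases hw; exact ⟨hd, hh⟩
        · cases hw
      · rintro j e d he hd ⟨rfl, hh⟩
        exact ⟨hd, hh⟩
    · intro j e he
      by_cases hs : γ.sat (isReady c) j = true
      · rw [if_pos hs]
        exact ⟨⟨rfl, rfl, rfl, .inr ⟨⟨c, ((sat_isReady he).1 hs).1⟩, rfl, rfl⟩⟩, .of_eq rfl⟩
      · rw [if_neg hs]
        exact ⟨.refl e, .of_eq rfl⟩
  | @default i c =>
    obtain ⟨hw, hc, hi, hK⟩ := hcond
    have hlow : lvlIn c ≠ .low := by simp [hc]
    refine MapEffect.of_modify ht ?_ ?_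
    · refine hm.append (add := fun j => if γ.sat (identical i) j then [(c, δ.inp c)] else [])
        (append_getElem? γ _ _ _) ?_ ?_ ?_ ?_ ?_ ⟨Waits.append (append_getElem? γ _ _ _) hw, hc, hi, hK⟩
      · intro j hj q hq _
        split_ifs at hq
        · rw [List.mem_singleton.1 hq]
        · simp at hq
      · intro l hl
        left
        refine ⟨?_, fun c h => h.elim⟩
        cases l
        · split_ifs <;> simp [atLevel_cons_of_ne hlow]
        · have : ¬ (0 = i) := fun h => hi h.symm
          simp [EMConf.sat, identical, asker, this]
      · intro j d hh
        by_cases hj : j = i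
        · simp only [EMConf.sat, identical, hj, decide_true, if_true, Has.singleton] at hh
          subst hj; subst hh
          exact .inr ⟨true, rfl⟩
        · simp [EMConf.sat, identical, hj] at hh
      · rintro j d (h | ⟨w, h⟩)
        · exact h.elim
        · cases h
      · intro j d Q hj hh
        exact hh
    · intro j e he
      refine ⟨.append e _ _, ?_⟩
      by_cases hj : j = i
      -- The created item is high, goes to an execution other than 0, and does not occur in RI:
      -- exactly the freedom left by `FlowSame`.
      · refine ⟨?_, fun h0 => (hi (hj.symm.trans h0)).elim, fun h => (hK h).elim⟩
        simp [flow, MStage.inflight, EMConf.sat, identical, hj, atLevel_append,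
          atLevel_cons_of_ne hlow]
      · refine .of_eq ?_
        simp [flow, MStage.inflight, EMConf.sat, identical, hj]
  | @wakeOne i c =>
    obtain ⟨⟨e₁, he₁, hc₁⟩, hc, hi, hK⟩ := hcond
    refine MapEffect.of_modify ht ?_ ?_
    · refine hm.wakeUp (W := fun j e => j = i) ?_ ?_ ?_
      · intro j a ha
        rw [modify_getElem?] at ha
        obtain ⟨e, he, rfl⟩ := Option.map_eq_some_iff.1 ha
        refine ⟨e, he, ?_⟩
        by_cases hs : j = i
        · exact .inl ⟨hs, by simp [EMConf.sat, identical, hs]⟩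
        · exact .inr ⟨hs, by simp [EMConf.sat, identical, hs]⟩
      · intro j e d he hd hh hw
        rcases hw with hw | ⟨w, hw⟩
        · exact hw.elim
        · cases hw; rfl
      · intro j e d he hd hh
        exact hh.symm
    · intro j e he
      by_cases hs : j = i
      · subst hs
        rw [he] at he₁; cases he₁
        have : γ.sat (identical j) j = true := by simp [EMConf.sat, identical]
        rw [if_pos this]
        exact ⟨⟨rfl, rfl, rfl, .inr ⟨⟨c, hc₁⟩, rfl, rfl⟩⟩, .of_eq rfl⟩
      · have : ¬ γ.sat (identical i) j = true := by simp [EMConf.sat, identical, hs]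
        rw [if_neg this]
        exact ⟨.refl e, .of_eq rfl⟩

end Effect

/-! ### The invariant under all steps of MAP and REDUCE -/

section Control

variable {CIn : Type u} {COut : Type v} [DecidableEq CIn] [DecidableEq COut]

/-- The steps of MAP and REDUCE. -/
inductive Ctl (m₀ : Mem) (M : Mechanism CIn COut) : EMConf CIn COut → EMConf CIn COut → Prop
  | map {γ p' γ'} (h : MapStep γ.mapPrg γ p' γ') : Ctl m₀ M γ { γ' with mapPrg := p' }
  | red {γ p' γ'} (h : RedStep γ.redPrg γ p' γ') : Ctl m₀ M γ { γ' with redPrg := p' }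
  | mapActivate {γ i e c} (hp : γ.mapPrg = .skip) (hi : γ.ex[i]? = some e) (hc : e.AtInput c)
      (hint : e.int = some (.inp c)) :
      Ctl m₀ M γ { γ with ex := γ.ex.set i { e with int := none }
                          mapPrg := M.mapProg i c
                          mapMem := m₀ }
  | redActivate {γ i e c} (hp : γ.redPrg = .skip) (hi : γ.ex[i]? = some e)
      (hs : e.stt = .sleeping) (hint : e.int = some (.out c)) :
      Ctl m₀ M γ { γ with ex := γ.ex.set i { e with int := none }
                          redPrg := M.redProg i c
                          redMem := m₀ }

/-- The steps of the local execution `i`. -/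
inductive Exec (i : ℕ) : EMConf CIn COut → EMConf CIn COut → Prop
  | mk {γ e e'} (hi : γ.ex[i]? = some e) (h : LocalStep e e') :
      Exec i γ { γ with ex := γ.ex.set i e' }

theorem EMStep.iff {m₀ : Mem} {M : Mechanism CIn COut} {γ γ' : EMConf CIn COut} :
    EMStep m₀ M γ γ' ↔ (∃ i, Exec i γ γ') ∨ Ctl m₀ M γ γ' := by
  constructor
  · intro h
    cases h with
    | exec hi h => exact .inl ⟨_, .mk hi h⟩
    | map h => exact .inr (.map h)
    | red h => exact .inr (.red h)
    | mapActivate hp hi hs hint hprg => exact .inr (.mapActivate hp hi ⟨hs, _, hprg⟩ hint)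
    | redActivate hp hi hs hint => exact .inr (.redActivate hp hi hs hint)
  · rintro (⟨i, h⟩ | h)
    · cases h with
      | mk hi h => exact .exec hi h
    · cases h with
      | map h => exact .map h
      | red h => exact .red h
      | mapActivate hp hi hc hint =>
        obtain ⟨hs, x, hx⟩ := hc
        exact .mapActivate hp hi hs hint hx
      | redActivate hp hi hs hint => exact .redActivate hp hi hs hint

omit [DecidableEq COut] in
theorem MStage.eq_idle {K : Kind} {lvlIn : CIn → Level} {lvlOut : COut → Level}
    {δ : Defaults CIn COut} {m : MStage CIn} (h : m.prog K lvlIn lvlOut δ = .skip) :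
    m = .idle := by
  cases m with
  | idle => rfl
  | dec q i c => cases q <;> cases K <;> cases h
  | b0 => cases h
  | b1 w => cases w <;> cases h
  | b2 w => cases w <;> cases h
  | b3 w => cases w <;> cases h
  | d0 => cases h
  | d1 w => cases w <;> cases h

omit [DecidableEq CIn] [DecidableEq COut] in
theorem RStage.eq_idle {δ : Defaults CIn COut} {r : RStage COut} (h : r.prog δ = .skip) :
    r = .idle := by
  cases r with
  | idle => rfl
  | busy q => cases q <;> cases h

omit [DecidableEq CIn] [DecidableEq COut] in
theorem MapInv.activate {K : Kind} {lvlIn : CIn → Level} {δ : Defaults CIn COut} {tm : Table CIn}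
    {ex : Stack CIn COut} {mm : Mem} {i : ℕ} {e : LocalConf CIn COut} {c : CIn}
    (h : MapInv K lvlIn δ tm ex mm .idle) (hi : ex[i]? = some e) (hc : e.AtInput c) (mm' : Mem) :
    MapInv K lvlIn δ tm (ex.set i { e with int := none }) mm' (.dec .root i c) := by
  have hs : ∀ l, Served lvlIn ex .idle l →
      Served lvlIn (ex.set i { e with int := none }) (.dec .root i c) l := by
    intro l hl a ha
    rw [getElem?_set_of_some hi] at ha
    split_ifs at ha with hij
    · cases ha; subst hij; exact hl e hi
    · exact hl a ha
  refine ⟨?_, hs _ h.served_low, fun hK => hs _ (h.served_high hK), ?_, ?_, ?_⟩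
  · exact forall_getElem?_set hi (P := fun j e => j ≠ 0 →
      ∀ q ∈ e.inp, lvlIn q.1 = .high → q.2 = δ.inp q.1) (h.default i e hi) h.default
  · intro j a d
    refine forall_getElem?_set hi (P := fun j e => e.AtInput d → Has d e.inp →
      (MStage.dec DecPt.root i c).WakesUp j d) ?_ ?_ j a
    · intro hd hh
      rcases h.no_item i e d hi hd hh with h | ⟨w, h⟩
      · exact h.elim
      · cases h
    · intro j a ha hd hh
      rcases h.no_item j a d ha hd hh with h | ⟨w, h⟩
      · exact h.elim
      · cases h
  · intro j a d
    refine forall_getElem?_set hi (P := fun j e => e.AtInput d → e.int = none →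
      lvlIn d = .low ∧ j ≠ 1 ∨ (MStage.dec DecPt.root i c).Handles lvlIn tm j d e.inp) ?_ ?_ j a
    · intro _ _
      exact .inr (.inl rfl)
    · intro j a ha hd hint
      rcases h.signal j a d ha hd hint with h | h
      · exact .inl h
      · exact h.elim
  · exact ⟨⟨{ e with int := none }, by simp [getElem?_set_of_some hi], hc.1, hc.2⟩, trivial⟩

/-- The effect of a step of MAP or REDUCE. -/
structure CtlEffect (K : Kind) (lvlIn : CIn → Level) (lvlOut : COut → Level)
    (δ : Defaults CIn COut) (γ : EMConf CIn COut) (m : MStage CIn) (r : RStage COut)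
    (γ' : EMConf CIn COut) (m' : MStage CIn) (r' : RStage COut) : Prop where
  old : ∀ (j : ℕ) (e : LocalConf CIn COut), γ.ex[j]? = some e → ∃ a, γ'.ex[j]? = some a ∧
    a.prg = e.prg ∧ a.mem = e.mem ∧ (e.stt = .executing → a.stt = .executing) ∧
    FlowSame K lvlIn j (flow δ γ m j e) (flow δ γ' m' j a)
  new : ∀ (j : ℕ) (a : LocalConf CIn COut), γ'.ex[j]? = some a →
    j < γ.ex.length ∨ ∃ c, γ.ex[0]? = some a ∧ a.AtInput c ∧ flow δ γ' m' j a = flow δ γ m 0 a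
  sent : lowSent lvlOut γ' r' = lowSent lvlOut γ r

omit [DecidableEq CIn] [DecidableEq COut] in
theorem CtlEffect.of_set {K : Kind} {lvlIn : CIn → Level} {lvlOut : COut → Level}
    {δ : Defaults CIn COut} {γ : EMConf CIn COut} {m m' : MStage CIn} {r r' : RStage COut}
    {γ' : EMConf CIn COut} {i : ℕ} {e e' : LocalConf CIn COut} (hi : γ.ex[i]? = some e)
    (hex : γ'.ex = γ.ex.set i e') (htm : γ'.tm = γ.tm) (hinp : γ'.inp = γ.inp)
    (hm : ∀ k, m'.inflight δ γ.tm k = m.inflight δ γ.tm k)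
    (h1 : e'.prg = e.prg) (h2 : e'.mem = e.mem) (h3 : e.stt = .executing → e'.stt = .executing)
    (h4 : e'.inp = e.inp) (h5 : lowSent lvlOut γ' r' = lowSent lvlOut γ r) :
    CtlEffect K lvlIn lvlOut δ γ m r γ' m' r' := by
  refine ⟨?_, fun j a ha => .inl ?_, h5⟩
  · intro j a ha
    rw [hex, getElem?_set_of_some hi]
    split_ifs with hij
    · subst hij
      rw [hi] at ha; cases ha
      exact ⟨e', rfl, h1, h2, h3, .of_eq (by simp [flow, h4, htm, hinp, hm])⟩
    · exact ⟨a, ha, rfl, rfl, id, .of_eq (by simp [flow, htm, hinp, hm])⟩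
  · rw [hex] at ha
    simpa using lt_of_getElem? ha

-- MAP alters the control state only of executions asleep on an input, and these have no output
-- waiting; REDUCE is concerned with those asleep behind an output. A clone is again asleep on an
-- input.
omit [DecidableEq CIn] [DecidableEq COut] in
theorem RedInv.map {K : Kind} {lvlIn : CIn → Level} {lvlOut : COut → Level}
    {δ : Defaults CIn COut} {γ γ' : EMConf CIn COut} {m m' : MStage CIn} {r : RStage COut}
    (hr : RedInv γ.tr γ.ex γ.redMem r) (ht : Tables K lvlIn lvlOut γ.tm γ.tr γ.ex.length)
    (h : MapEffect K lvlIn lvlOut δ γ γ' m m') :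
    RedInv γ'.tr γ'.ex γ'.redMem r := by
  constructor
  · intro j a ha
    rcases h.new j a ha with hj | ⟨c, h0, hc, _⟩
    · have hj' : γ.ex[j]? = some γ.ex[j] := by simp [hj]
      obtain ⟨b, hb, ⟨h1, h2, h3, h4⟩, _⟩ := h.old j _ hj'
      rw [ha] at hb; cases hb
      have hreg := hr.regular j _ hj'
      rcases h4 with ⟨h4, h5⟩ | ⟨⟨c, hc⟩, h5, h6⟩
      · unfold LocalConf.Regular LocalConf.AtInput at *
        rw [h1, h3, h4, h5]; exact hreg
      · exact .inl ⟨h5, h6, h3.trans (hreg.of_atInput hc).1⟩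
    · exact .inr (.inl ⟨c, hc, (hr.regular 0 a h0).of_atInput hc⟩)
  · cases r with
    | idle => trivial
    | busy q i c =>
      obtain ⟨e, he, hs, hh, hint, h6⟩ := hr.cond
      obtain ⟨a, ha, ⟨h1, h2, h3, h4⟩, _⟩ := h.old i e he
      rcases h4 with ⟨h4, h5⟩ | ⟨⟨c, hc⟩, _⟩
      · refine ⟨a, ha, h4.trans hs, by rw [h1]; exact hh, h5.trans hint, ?_⟩
        rw [h3, h.redMem, h.tables.ask_out, h.tables.tell_out]
        rw [ht.ask_out, ht.tell_out] at h6
        exact h6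
      · exact (hc.head_ne hh).elim

omit [DecidableEq COut] in
theorem Inv.mapStep {K : Kind} {lvlIn : CIn → Level} {lvlOut : COut → Level}
    {δ : Defaults CIn COut} {γ γ' : EMConf CIn COut} {m : MStage CIn} {r : RStage COut}
    {p : MapProg CIn COut} (h : Inv K lvlIn lvlOut δ γ m r) (hs : MapStep γ.mapPrg γ p γ') :
    ∃ m', Inv K lvlIn lvlOut δ { γ' with mapPrg := p } m' r ∧
      CtlEffect K lvlIn lvlOut δ γ m r { γ' with mapPrg := p } m' r := by
  rw [h.mapPrg] at hs
  obtain ⟨m', rfl, ht⟩ := hs.inv h.map.cond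
  have he := ht.effect h.tables h.map
  have hred := h.red.map h.tables he
  refine ⟨m', ⟨rfl, he.redPrg.trans h.redPrg, he.tables, he.map, hred⟩, ?_, ?_, ?_⟩
  · intro j e hj
    obtain ⟨a, ha, ⟨h1, h2, h3, h4⟩, hf⟩ := he.old j e hj
    refine ⟨a, ha, h1, h2, fun hx => ?_, hf⟩
    rcases h4 with h4 | h4
    · exact h4.1.trans hx
    · exact h4.2.1
  · exact he.new
  · have h1 : 1 < γ.ex.length := by have := h.tables.two_le; omega
    have h1' : γ.ex[1]? = some γ.ex[1] := by simp [h1]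
    obtain ⟨a, ha, ⟨_, _, h3, _⟩, _⟩ := he.old 1 _ h1'
    unfold lowSent pending
    simp only [ha, h1', he.out]
    cases r.Sent <;> simp [h3]

theorem Inv.redStep {K : Kind} {lvlIn : CIn → Level} {lvlOut : COut → Level}
    {δ : Defaults CIn COut} {γ γ' : EMConf CIn COut} {m : MStage CIn} {q : RPt} {i : ℕ} {c : COut}
    {r' : RStage COut} (h : Inv K lvlIn lvlOut δ γ m (.busy q i c))
    (ht : RTrans δ i c γ q r' γ') :
    Inv K lvlIn lvlOut δ { γ' with redPrg := r'.prog δ } m r' ∧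
      CtlEffect K lvlIn lvlOut δ γ m (.busy q i c) { γ' with redPrg := r'.prog δ } m r' := by
  have he := ht.effect h.tables h.red
  rcases he.ex with hex | ⟨k, e, e', hk, hex, hst, h1, h2, h3, h4⟩
  · refine ⟨⟨he.mapPrg.trans h.mapPrg, rfl, ?_, ?_, he.red⟩, ?_, ?_, he.sent⟩
    · simp only [he.tm, he.tr, hex]; exact h.tables
    · simp only [he.tm, he.mapMem, hex]; exact h.map
    · intro j a ha
      exact ⟨a, by simp only [hex, ha], rfl, rfl, id, .of_eq (by simp [flow, he.tm, he.inp])⟩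
    · intro j a ha
      simp only [hex] at ha
      exact .inl (lt_of_getElem? ha)
  · refine ⟨⟨he.mapPrg.trans h.mapPrg, rfl, ?_, ?_, he.red⟩,
      CtlEffect.of_set hk hex he.tm he.inp (fun _ => rfl) h2 h3 ?_ h4 he.sent⟩
    · simp only [he.tm, he.tr, hex]; simpa using h.tables
    · simp only [he.tm, he.mapMem, hex]; exact h.map.reduce hk h1 h2 h4
    · intro hx
      rw [hst] at hx; cases hx

omit [DecidableEq COut] in
theorem Inv.mapActivate {K : Kind} {lvlIn : CIn → Level} {lvlOut : COut → Level} {δ : Defaults CIn COut}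
    {γ : EMConf CIn COut} {r : RStage COut} {i : ℕ} {e : LocalConf CIn COut} {c : CIn}
    (h : Inv K lvlIn lvlOut δ γ .idle r) (hi : γ.ex[i]? = some e) (hc : e.AtInput c) (mm : Mem) :
    let γ' : EMConf CIn COut := { γ with ex := γ.ex.set i { e with int := none }
                                         mapPrg := (K.mech lvlIn lvlOut δ).mapProg i c
                                         mapMem := mm }
    Inv K lvlIn lvlOut δ γ' (.dec .root i c) r ∧
      CtlEffect K lvlIn lvlOut δ γ .idle r γ' (.dec .root i c) r := by
  intro γ'
  refine ⟨⟨rfl, h.redPrg, by simpa [γ'] using h.tables, h.map.activate hi hc _, ?_, ?_⟩,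
    CtlEffect.of_set hi rfl rfl rfl (fun _ => rfl) rfl rfl id rfl ?_⟩
  · exact forall_getElem?_set hi (P := fun j e => e.Regular (r.Serves j))
      (.inr (.inl ⟨c, ⟨hc.1, hc.2⟩, ((h.red.regular i e hi).of_atInput hc).1, .inl rfl⟩))
      h.red.regular
  · exact h.red.cond.set hi (.inr hc.head_ne)
  · simp only [lowSent, pending, γ', getElem?_set_of_some hi]
    by_cases h1 : i = 1
    · subst h1; simp only [if_true, hi]; cases r.Sent <;> rfl
    · simp [h1]

omit [DecidableEq COut] in
theorem Inv.redActivate {K : Kind} {lvlIn : CIn → Level} {lvlOut : COut → Level} {δ : Defaults CIn COut}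
    {γ : EMConf CIn COut} {m : MStage CIn} {i : ℕ} {e : LocalConf CIn COut} {c : COut}
    (h : Inv K lvlIn lvlOut δ γ m .idle) (hi : γ.ex[i]? = some e) (hs : e.stt = .sleeping)
    (hint : e.int = some (.out c)) (rm : Mem) :
    let γ' : EMConf CIn COut := { γ with ex := γ.ex.set i { e with int := none }
                                         redPrg := (K.mech lvlIn lvlOut δ).redProg i c
                                         redMem := rm }
    Inv K lvlIn lvlOut δ γ' m (.busy .start i c) ∧
      CtlEffect K lvlIn lvlOut δ γ m .idle γ' m (.busy .start i c) := by
  intro γ'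
  have hreg := h.red.regular i e hi
  -- An output signal excludes an execution that is awake or asleep on an input.
  have hh : e.prg.head = none := by
    rcases hreg with h | ⟨d, _, _, h⟩ | h
    · rw [hs] at h; cases h.1
    · rw [hint] at h; rcases h with h | h <;> cases h
    · exact h.2.1
  obtain ⟨y, hy⟩ : ∃ y, e.out = [(c, y)] := by
    rcases hreg.of_head_none hs hh with ⟨d, y, h1, h2⟩ | h
    · rw [hint] at h1; cases h1; exact ⟨y, h2⟩
    · exact h.2.elim
  have hprog : (K.mech lvlIn lvlOut δ).redProg i c = (RStage.busy .start i c).prog δ := by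
    cases K <;> rfl
  refine ⟨⟨h.mapPrg, hprog, by simpa [γ'] using h.tables, h.map.reduce hi hh rfl rfl, ?_, ?_⟩,
    CtlEffect.of_set hi rfl rfl rfl (fun _ => rfl) rfl rfl id rfl ?_⟩
  · exact forall_getElem?_set hi (P := fun j e => e.Regular (i = j))
      (.inr (.inr ⟨hs, hh, .inr ⟨rfl, rfl⟩⟩)) fun j a ha =>
        (h.red.regular j a ha).mono fun h => h.elim
  · exact ⟨{ e with int := none }, by simp [γ', getElem?_set_of_some hi], hs, hh, rfl,
      by simp [RPt.cleaned], fun _ => ⟨y, hy, by simp [RPt.fetched]⟩, by simp, by simp⟩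
  · have hS : (RStage.busy .start i c).Sent = false := by
      unfold RStage.Sent; rcases i with _ | _ | i <;> rfl
    have hS' : (RStage.idle : RStage COut).Sent = false := rfl
    simp only [lowSent, pending, γ', getElem?_set_of_some hi, hS, hS']
    by_cases h1 : i = 1
    · subst h1; simp [hi]
    · simp [h1]

theorem Inv.ctl {K : Kind} {lvlIn : CIn → Level} {lvlOut : COut → Level} {m₀ : Mem}
    {δ : Defaults CIn COut} {γ γ' : EMConf CIn COut} {m : MStage CIn} {r : RStage COut}
    (h : Inv K lvlIn lvlOut δ γ m r) (hs : Ctl m₀ (K.mech lvlIn lvlOut δ) γ γ') :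
    ∃ m' r', Inv K lvlIn lvlOut δ γ' m' r' ∧ CtlEffect K lvlIn lvlOut δ γ m r γ' m' r' := by
  cases hs with
  | map hs =>
    obtain ⟨m', h1, h2⟩ := h.mapStep hs
    exact ⟨m', r, h1, h2⟩
  | red hs =>
    rw [h.redPrg] at hs
    obtain ⟨q, i, c, r', rfl, rfl, ht⟩ := hs.inv
    exact ⟨m, r', h.redStep ht⟩
  | mapActivate hp hi hc hint =>
    rw [h.mapPrg] at hp
    cases MStage.eq_idle hp
    exact ⟨_, r, h.mapActivate hi hc _⟩
  | redActivate hp hi hs hint =>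
    rw [h.redPrg] at hp
    cases RStage.eq_idle hp
    exact ⟨m, _, h.redActivate hi hs hint _⟩

end Control

/-! ### From runs of the mechanism to traces of the program; TINI -/

section Extraction

variable {CIn : Type u} {COut : Type v}

/-- All high items of the queue carry the default value of their channel. -/
def HighDefault (lvlIn : CIn → Level) (δ : Defaults CIn COut) (Q : Queue CIn) : Prop :=
  ∀ q ∈ Q, lvlIn q.1 = .high → q.2 = δ.inp q.1

theorem HighDefault.cons {lvlIn : CIn → Level} {δ : Defaults CIn COut} {Q : Queue CIn} {c : CIn}
    {y : Val} (h : HighDefault lvlIn δ Q) (hc : lvlIn c = .high → y = δ.inp c) :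
    HighDefault lvlIn δ ((c, y) :: Q) := by
  intro q hq hq'
  rcases List.mem_cons.1 hq with rfl | hq
  · exact hc hq'
  · exact h q hq hq'

variable [DecidableEq CIn]

/-- Local execution 1 can run to its end, reading exactly the low items to come and completing
the low output `O`. -/
def Completes (K : Kind) (lvlIn : CIn → Level) (lvlOut : COut → Level) (δ : Defaults CIn COut)
    (O : Queue COut) (γ : EMConf CIn COut) (m : MStage CIn) (r : RStage COut) : Prop :=
  ∃ e ins outs, γ.ex[1]? = some e ∧ Halts e.prg e.mem ins outs ∧ HighDefault lvlIn δ ins ∧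
    Queue.atLevel lvlIn .low ins = Queue.atLevel lvlIn .low (flow δ γ m 1 e) ∧
    lowSent lvlOut γ r ++ Queue.atLevel lvlOut .low outs = O ∧
    (K = .ri → ∀ c, (Queue.onChan c ins).length ≤ (Queue.onChan c (flow δ γ m 1 e)).length)

/-- Local execution `j` can run to its end on default high items and the low items to come. -/
def CanFinish (lvlIn : CIn → Level) (δ : Defaults CIn COut) (j : ℕ) (γ : EMConf CIn COut)
    (m : MStage CIn) : Prop :=
  ∃ e ins outs, γ.ex[j]? = some e ∧ Halts e.prg e.mem ins outs ∧ HighDefault lvlIn δ ins ∧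
    ∀ c, lvlIn c = .low → Queue.onChan c ins <+: Queue.onChan c (flow δ γ m j e)

omit [DecidableEq CIn] in
theorem pending_of_out_nil {lvlOut : COut → Level} {ex : Stack CIn COut} {r : RStage COut}
    {e : LocalConf CIn COut} (he : ex[1]? = some e) (h : e.out = []) :
    pending lvlOut ex r = [] := by
  unfold pending
  rw [he]
  cases r.Sent <;> simp [h]

omit [DecidableEq CIn] in
theorem sent_eq_false {tr : Table COut} {ex : Stack CIn COut} {rm : Mem} {r : RStage COut}
    {e : LocalConf CIn COut} (h : RedInv tr ex rm r) (he : ex[1]? = some e)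
    (hx : e.stt = .executing) : r.Sent = false := by
  cases r with
  | idle => rfl
  | busy q i c =>
    by_cases hi : i = 1
    · subst hi
      obtain ⟨a, ha, hs, _⟩ := h.cond
      rw [he] at ha; cases ha
      rw [hx] at hs; cases hs
    · unfold RStage.Sent; rcases i with _ | _ | i <;> simp at hi ⊢

omit [DecidableEq CIn] in
theorem low_flow {lvlIn : CIn → Level} {δ : Defaults CIn COut} {γ γ' : EMConf CIn COut}
    {m : MStage CIn} {k : ℕ} {e e' : LocalConf CIn COut} {l : Level} (ht : γ'.tm = γ.tm)
    (hi : γ'.inp = γ.inp) (h : Queue.atLevel lvlIn l e'.inp = Queue.atLevel lvlIn l e.inp) :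
    Queue.atLevel lvlIn l (flow δ γ' m k e') = Queue.atLevel lvlIn l (flow δ γ m k e) := by
  simp only [flow, atLevel_append, h, ht, hi]

/-- The argument goes backwards along the run: a step of execution 1 is put in front of the trace
that it has afterwards, and steps of other executions do not matter. -/
theorem Completes.of_exec {K : Kind} {lvlIn : CIn → Level} {lvlOut : COut → Level}
    {δ : Defaults CIn COut} {O : Queue COut} {γ γ' : EMConf CIn COut} {m : MStage CIn}
    {r : RStage COut} {i : ℕ} (h : Inv K lvlIn lvlOut δ γ m r) (hs : Exec i γ γ')
    (h' : Completes K lvlIn lvlOut δ O γ' m r) : Completes K lvlIn lvlOut δ O γ m r := by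
  obtain ⟨b, ins, outs, hb, hh, hd, hlow, hO, hn⟩ := h'
  cases hs with
  | @mk e e' hi hs =>
  rw [getElem?_set_of_some hi] at hb
  by_cases h1 : i = 1
  swap
  · rw [if_neg h1] at hb
    refine ⟨b, ins, outs, hb, hh, hd, hlow, ?_, hn⟩
    rw [← hO]
    simp only [lowSent, pending, getElem?_set_of_some hi, if_neg h1]
  subst h1
  rw [if_pos rfl] at hb
  cases hb
  have hx := hs.1
  obtain ⟨hint, hout⟩ := (h.red.regular 1 e hi).of_executing hx
  have hpend := pending_of_out_nil (lvlOut := lvlOut) (r := r) hi hout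
  have hset : ∀ a : LocalConf CIn COut, (γ.ex.set 1 a)[1]? = some a := fun a => by
    rw [getElem?_set_of_some hi, if_pos rfl]
  have hS := sent_eq_false h.red hi hx
  have hp : ∀ s t p m I o, pending lvlOut (γ.ex.set 1 ⟨s, t, p, m, I, o⟩) r =
      Queue.atLevel lvlOut .low o := fun s t p m I o => by simp [pending, hset, hS]
  simp only [lowSent] at hO
  rcases hs.inv with ⟨p, mm, ht, rfl⟩ | ⟨c, y, p, mm, I, ht, hdq, rfl⟩ | ⟨x, c, ht, hdq, rfl⟩ |
    ⟨c, y, p, ht, rfl⟩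
  · rw [hp, hout, atLevel_nil] at hO
    exact ⟨e, ins, outs, hi, .tau ht hh, hd, hlow, by simp only [lowSent, hpend, hO], hn⟩
  · rw [hp, hout, atLevel_nil] at hO
    refine ⟨e, (c, y) :: ins, outs, hi, .inp ht hh, hd.cons fun hc => ?_, ?_,
      by simp only [lowSent, hpend, hO], fun hK d => ?_⟩
    · exact h.map.default 1 e hi (by simp) (c, y) (dequeue_mem hdq) hc
    · cases hc : lvlIn c with
      | low =>
        rw [atLevel_cons_of_eq hc, hlow]
        -- By `Served` the low item being read is the only one in the local queue, hence the first
        -- of all low items to come.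
        rcases h.map.served_low e hi with h0 | ⟨x, d, v, h1, h2, h3, h4⟩
        · refine (?_ : False).elim
          have := dequeue_mem hdq
          have := atLevel_ne_nil_of_mem (lvl := lvlIn) this
          rw [hc] at this
          exact this h0
        · obtain ⟨rfl, rfl, h5⟩ := dequeue_atLevel_of_singleton hdq hc h3
          simp [flow, atLevel_append, h3, h5]
      | high =>
        have hc' : lvlIn c ≠ .low := by simp [hc]
        rw [atLevel_cons_of_ne hc', hlow]
        exact low_flow rfl rfl (dequeue_atLevel_of_ne hdq hc').symm
    · have hn' := hn hK d
      simp only [flow, onChan_append, List.length_append] at hn' ⊢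
      by_cases hcd : c = d
      · subst hcd
        rw [onChan_cons_self, dequeue_onChan_self hdq]
        simp only [List.length_cons]
        omega
      · rw [onChan_cons_of_ne hcd, dequeue_onChan_of_ne hdq hcd]
        exact hn'
  · rw [hp, hout, atLevel_nil] at hO
    exact ⟨e, ins, outs, hi, hh, hd, hlow, by simp only [lowSent, hpend, hO], hn⟩
  · refine ⟨e, ins, (c, y) :: outs, hi, .out ht hh, hd, hlow, ?_, hn⟩
    -- After the step the output is pending; before it, it is the head of the outputs of the trace.
    rw [← hO, hp, hout, ← List.singleton_append (l := outs), atLevel_append]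
    simp [lowSent, hpend]

/-- Executions other than 1 may store many low items and read them in any order of channels, so only
the order on each channel is tracked. It is a prefix because some items may remain unread. -/
theorem CanFinish.of_exec {K : Kind} {lvlIn : CIn → Level} {lvlOut : COut → Level}
    {δ : Defaults CIn COut} {γ γ' : EMConf CIn COut} {m : MStage CIn}
    {r : RStage COut} {i j : ℕ} (h : Inv K lvlIn lvlOut δ γ m r) (hs : Exec i γ γ') (hj : j ≠ 0)
    (h' : CanFinish lvlIn δ j γ' m) : CanFinish lvlIn δ j γ m := by
  obtain ⟨b, ins, outs, hb, hh, hd, hlow⟩ := h'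
  cases hs with
  | @mk e e' hi hs =>
  rw [getElem?_set_of_some hi] at hb
  by_cases h1 : i = j
  swap
  · rw [if_neg h1] at hb
    exact ⟨b, ins, outs, hb, hh, hd, hlow⟩
  subst h1
  rw [if_pos rfl] at hb
  cases hb
  rcases hs.inv with ⟨p, mm, ht, rfl⟩ | ⟨c, y, p, mm, I, ht, hdq, rfl⟩ | ⟨x, c, ht, hdq, rfl⟩ |
    ⟨c, y, p, ht, rfl⟩
  · exact ⟨e, ins, outs, hi, .tau ht hh, hd, hlow⟩
  · refine ⟨e, (c, y) :: ins, outs, hi, .inp ht hh, hd.cons fun hc => ?_, fun d hdl => ?_⟩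
    · exact h.map.default _ e hi hj (c, y) (dequeue_mem hdq) hc
    · have hl := hlow d hdl
      simp only [flow, onChan_append] at hl ⊢
      by_cases hcd : c = d
      · subst hcd
        rw [onChan_cons_self, dequeue_onChan_self hdq, List.cons_append, List.cons_append]
        exact (List.prefix_cons_inj _).2 hl
      · rw [onChan_cons_of_ne hcd, dequeue_onChan_of_ne hdq hcd]
        exact hl
  · exact ⟨e, ins, outs, hi, hh, hd, hlow⟩
  · exact ⟨e, ins, _, hi, .out ht hh, hd, hlow⟩

variable [DecidableEq COut]

omit [DecidableEq COut] in
theorem Completes.of_ctl {K : Kind} {lvlIn : CIn → Level} {lvlOut : COut → Level}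
    {δ : Defaults CIn COut} {O : Queue COut} {γ γ' : EMConf CIn COut} {m m' : MStage CIn}
    {r r' : RStage COut} (h : Inv K lvlIn lvlOut δ γ m r)
    (he : CtlEffect K lvlIn lvlOut δ γ m r γ' m' r')
    (h' : Completes K lvlIn lvlOut δ O γ' m' r') : Completes K lvlIn lvlOut δ O γ m r := by
  obtain ⟨b, ins, outs, hb, hh, hd, hlow, hO, hn⟩ := h'
  have h1 : 1 < γ.ex.length := by have := h.tables.two_le; omega
  have h1' : γ.ex[1]? = some γ.ex[1] := by simp [h1]
  obtain ⟨a, ha, e1, e2, -, e4, -, e5⟩ := he.old 1 _ h1'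
  rw [hb] at ha; cases ha
  refine ⟨_, ins, outs, h1', by rw [← e1, ← e2]; exact hh, hd, hlow.trans e4,
    by rw [← he.sent]; exact hO, fun hK c => ?_⟩
  rw [← length_onChan_eq_of_map_fst (e5 hK) c]
  exact hn hK c

omit [DecidableEq COut] in
theorem CanFinish.of_ctl {K : Kind} {lvlIn : CIn → Level} {lvlOut : COut → Level}
    {δ : Defaults CIn COut} {γ γ' : EMConf CIn COut} {m m' : MStage CIn}
    {r r' : RStage COut} {j : ℕ} (hj : j < γ.ex.length)
    (he : CtlEffect K lvlIn lvlOut δ γ m r γ' m' r')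
    (h' : CanFinish lvlIn δ j γ' m') : CanFinish lvlIn δ j γ m := by
  obtain ⟨b, ins, outs, hb, hh, hd, hlow⟩ := h'
  have h1' : γ.ex[j]? = some γ.ex[j] := by simp [hj]
  obtain ⟨a, ha, e1, e2, -, e4, -, -⟩ := he.old j _ h1'
  rw [hb] at ha; cases ha
  refine ⟨_, ins, outs, h1', by rw [← e1, ← e2]; exact hh, hd, fun c hc => ?_⟩
  rw [← onChan_atLevel hc (flow δ γ m j _), ← e4, onChan_atLevel hc]
  exact hlow c hc

/-- In a terminating run every local execution can run to its end, from every configuration. -/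
theorem Inv.completes {K : Kind} {lvlIn : CIn → Level} {lvlOut : COut → Level} {m₀ : Mem}
    {δ : Defaults CIn COut} {γ γ' : EMConf CIn COut}
    (hr : Relation.ReflTransGen (EMStep m₀ (K.mech lvlIn lvlOut δ)) γ γ') (hF : γ'.Final)
    {m : MStage CIn} {r : RStage COut} (h : Inv K lvlIn lvlOut δ γ m r) :
    Completes K lvlIn lvlOut δ (Queue.atLevel lvlOut .low γ'.out) γ m r ∧
      ∀ j, j ≠ 0 → j < γ.ex.length → CanFinish lvlIn δ j γ m := by
  induction hr using Relation.ReflTransGen.head_induction_on generalizing m r with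
  | refl =>
    obtain ⟨h1, h2, h3, h4⟩ := hF
    have hm := h.mapPrg.symm.trans h2
    cases MStage.eq_idle hm
    constructor
    · have hlt : 1 < γ'.ex.length := by have := h.tables.two_le; omega
      have he : γ'.ex[1]? = some γ'.ex[1] := by simp [hlt]
      obtain ⟨hp, hx⟩ := h4 γ'.ex[1] (by simp)
      have hout := ((h.red.regular 1 _ he).of_executing hx).2
      refine ⟨_, [], [], he, ?_, fun q hq => by simp at hq, ?_, ?_, fun _ c => by simp [Queue.onChan]⟩
      · rw [hp]; exact .done
      -- A terminated program is not at an input instruction, so `Served` leaves it no unread low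
      -- item: execution 1 has read all of them.
      · rcases h.map.served_low _ he with h0 | ⟨x, d, v, _, h5, _⟩
        · simp [flow, h0, h1, MStage.inflight]
        · rw [hp] at h5; cases h5
      · simp [lowSent, pending_of_out_nil he hout]
    · intro j _ hj
      refine ⟨γ'.ex[j], [], [], by simp [hj], ?_, fun q hq => by simp at hq, fun c _ => by simp [Queue.onChan]⟩
      rw [(h4 γ'.ex[j] (by simp)).1]; exact .done
  | @head γ₁ γ₂ hs _ ih =>
    rcases EMStep.iff.1 hs with ⟨i, hs⟩ | hs
    · have hInv : Inv K lvlIn lvlOut δ γ₂ m r := by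
        cases hs with | mk hi hs' => exact h.exec hi hs'
      obtain ⟨g1, g2⟩ := ih hInv
      refine ⟨g1.of_exec h hs, fun j hj hlt => (g2 j hj ?_).of_exec h hs hj⟩
      cases hs; simpa using hlt
    · obtain ⟨m', r', hInv, he⟩ := h.ctl hs
      obtain ⟨g1, g2⟩ := ih hInv
      refine ⟨g1.of_ctl h he, fun j hj hlt => (g2 j hj ?_).of_ctl hlt he⟩
      obtain ⟨a, ha, _⟩ := he.old j γ₁.ex[j] (by simp [hlt])
      exact lt_of_getElem? ha

omit [DecidableEq COut] in
theorem Inv.init (K : Kind) (lvlIn : CIn → Level) (lvlOut : COut → Level) (m₀ : Mem)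
    (δ : Defaults CIn COut) (π : Prog CIn COut) (I : Queue CIn) :
    Inv K lvlIn lvlOut δ (EMConf.init m₀ (K.mech lvlIn lvlOut δ) π I) .idle .idle := by
  have hlen : (K.mech lvlIn lvlOut δ).tm.length = 2 := by cases K <;> rfl
  have hex : ∀ (j : ℕ) (e : LocalConf CIn COut),
      (EMConf.init m₀ (K.mech lvlIn lvlOut δ) π I).ex[j]? = some e →
      e = { stt := .executing, int := none, prg := π, mem := m₀, inp := [], out := [] } := by
    intro j e he
    exact List.eq_of_mem_replicate (List.mem_of_getElem? he)
  have hx : ∀ (j : ℕ) (e : LocalConf CIn COut) (d : CIn),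
      (EMConf.init m₀ (K.mech lvlIn lvlOut δ) π I).ex[j]? = some e → ¬ e.AtInput d := by
    intro j e d he hd
    rw [hex j e he] at hd
    exact hd.not_executing rfl
  have hs : ∀ l, Served lvlIn (EMConf.init m₀ (K.mech lvlIn lvlOut δ) π I).ex .idle l := by
    intro l e he
    rw [hex _ e he]
    exact .inl rfl
  refine ⟨rfl, rfl, ?_, ⟨?_, hs _, fun _ => hs _, ?_, ?_, trivial⟩, ⟨?_, trivial⟩⟩
  · simp only [EMConf.init, List.length_replicate, hlen]
    have htr : (K.mech lvlIn lvlOut δ).tr = tableR lvlOut := by cases K <;> rfl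
    refine ⟨le_rfl, fun _ => rfl, hlen, by rw [htr]; rfl, ?_, ?_, ?_, ?_, ?_, ?_, ?_⟩
    · intro j c hc
      rcases j with _ | _ | j <;> cases K <;>
        simp [Kind.mech, mechRI, mechNI, mechDI, Table.priv, column, hc]
    · intro j c hj hc
      rcases j with _ | _ | j
      · cases K <;> simp [Kind.mech, mechRI, mechNI, mechDI, Table.priv, column, hc]
      · cases K <;> simp [Kind.mech, mechRI, mechNI, mechDI, Table.priv, column, hc]
      · omega
    · intro j c hc
      rcases j with _ | _ | j <;> cases K <;>
        simp [Kind.mech, mechRI, mechNI, mechDI, Table.priv, column, hc]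
    · intro hK j c hj hc
      rcases j with _ | _ | j
      · cases K <;> simp [Kind.mech, mechRI, mechNI, mechDI, Table.priv, column, hc]
      · cases K
        · simp [Kind.mech, mechRI, Table.priv, column, hc]
        · exact (hK rfl).elim
        · simp [Kind.mech, mechDI, Table.priv, column, hc]
      · omega
    · intro c hc
      cases K <;> simp [Kind.mech, mechRI, mechNI, mechDI, Table.priv, column, hc]
    · intro j c
      rw [htr]
      rcases j with _ | _ | j <;> cases hc : lvlOut c <;> simp [tableR, Table.priv, column, hc]
    · intro j c
      rw [htr]
      rcases j with _ | _ | j <;> cases hc : lvlOut c <;> simp [tableR, Table.priv, column, hc]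
  · intro j e he _ q hq
    rw [hex j e he] at hq; simp at hq
  · intro j e d he hd
    exact (hx j e d he hd).elim
  · intro j e d he hd
    exact (hx j e d he hd).elim
  · intro j e he
    rw [hex j e he]
    exact .inl ⟨rfl, rfl, rfl⟩

/-- The low output of the mechanism is that of a run of the program. -/
theorem emBehaviour_halts {K : Kind} {lvlIn : CIn → Level} {lvlOut : COut → Level} {m₀ : Mem}
    {δ : Defaults CIn COut} {π : Prog CIn COut} {I : Queue CIn} {O : Queue COut}
    (h : emBehaviour m₀ (K.mech lvlIn lvlOut) π δ I O) :
    ∃ ins outs, Halts π m₀ ins outs ∧ HighDefault lvlIn δ ins ∧ LowEq lvlIn ins I ∧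
      LowEq lvlOut outs O ∧
      (K = .ri → ∀ c, (Queue.onChan c ins).length ≤ (Queue.onChan c I).length) := by
  obtain ⟨γ, hr, hF, rfl⟩ := h
  have hinit := Inv.init K lvlIn lvlOut m₀ δ π I
  obtain ⟨e, ins, outs, he, hh, hd, hlow, hO, hn⟩ := (Inv.completes hr hF hinit).1
  have hlen : (K.mech lvlIn lvlOut δ).tm.length = 2 := by cases K <;> rfl
  have he' : e = { stt := .executing, int := none, prg := π, mem := m₀, inp := [], out := [] } :=
    List.eq_of_mem_replicate (List.mem_of_getElem? he)
  subst he'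
  refine ⟨ins, outs, hh, hd, hlow, ?_, hn⟩
  rw [lowSent, pending_of_out_nil he rfl] at hO
  simpa [EMConf.init, LowEq] using hO

/-- Both runs project to traces of the same program with default high inputs and equal low inputs;
determinism identifies their outputs. -/
theorem sound_tini (lvlIn : CIn → Level) (lvlOut : COut → Level) (m₀ : Mem) :
    Sound m₀ (mechNI lvlIn lvlOut) (TINI (COut := COut) lvlIn lvlOut) := by
  intro π δ I I' O O' hI h h'
  obtain ⟨i, o, h1, h2, h3, h4, -⟩ := emBehaviour_halts (K := .ni) h
  obtain ⟨i', o', h1', h2', h3', h4', -⟩ := emBehaviour_halts (K := .ni) h'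
  have : o' = o := h1'.outs_eq h1 h2' h2 (h3'.trans (hI.trans h3.symm))
  subst this
  exact h4'.symm.trans h4

end Extraction

/-! ### Driving MAP and REDUCE to serve a request -/

section Reachability

variable {CIn : Type u} {COut : Type v} [DecidableEq CIn] [DecidableEq COut]

/-- What any number of steps of MAP and REDUCE leave unchanged. -/
structure CtlFrame (K : Kind) (lvlIn : CIn → Level) (lvlOut : COut → Level)
    (δ : Defaults CIn COut) (γ : EMConf CIn COut) (m : MStage CIn) (r : RStage COut)
    (γ' : EMConf CIn COut) (m' : MStage CIn) (r' : RStage COut) : Prop where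
  old : ∀ (j : ℕ) (e : LocalConf CIn COut), γ.ex[j]? = some e → ∃ a, γ'.ex[j]? = some a ∧
    a.prg = e.prg ∧ a.mem = e.mem ∧ (e.stt = .executing → a.stt = .executing) ∧
    FlowSame K lvlIn j (flow δ γ m j e) (flow δ γ' m' j a)
  finish : (∀ j, j < γ.ex.length → CanFinish lvlIn δ j γ m) →
    ∀ j, j < γ'.ex.length → CanFinish lvlIn δ j γ' m'
  sent : lowSent lvlOut γ' r' = lowSent lvlOut γ r

-- A new execution is a copy of execution 0 with the same unread items, so it inherits the ability
-- to finish. For this reason `finish` also speaks about execution 0.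
omit [DecidableEq COut] in
theorem CtlEffect.frame {K : Kind} {lvlIn : CIn → Level} {lvlOut : COut → Level}
    {δ : Defaults CIn COut} {γ γ' : EMConf CIn COut} {m m' : MStage CIn} {r r' : RStage COut}
    (h : CtlEffect K lvlIn lvlOut δ γ m r γ' m' r') :
    CtlFrame K lvlIn lvlOut δ γ m r γ' m' r' := by
  refine ⟨h.old, fun hf j hj => ?_, h.sent⟩
  have hj' : γ'.ex[j]? = some γ'.ex[j] := by simp [hj]
  rcases h.new j _ hj' with hlt | ⟨c, h0, _, hfl⟩
  · obtain ⟨e, ins, outs, he, hh, hd, hp⟩ := hf j hlt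
    obtain ⟨a, ha, e1, e2, -, e3, -⟩ := h.old j e he
    refine ⟨a, ins, outs, ha, by rw [e1, e2]; exact hh, hd, fun c hc => ?_⟩
    rw [← onChan_atLevel hc (flow δ γ' m' j a), e3, onChan_atLevel hc]
    exact hp c hc
  · obtain ⟨e, ins, outs, he, hh, hd, hp⟩ := hf 0 (lt_of_getElem? h0)
    rw [h0] at he; cases he
    exact ⟨_, ins, outs, hj', hh, hd, fun c hc => by rw [hfl]; exact hp c hc⟩

/-- MAP and REDUCE can lead from one configuration to another one, both described by stages. -/
structure Reach (K : Kind) (lvlIn : CIn → Level) (lvlOut : COut → Level) (m₀ : Mem)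
    (δ : Defaults CIn COut) (γ : EMConf CIn COut) (m : MStage CIn) (r : RStage COut)
    (γ' : EMConf CIn COut) (m' : MStage CIn) (r' : RStage COut) : Prop where
  run : Relation.ReflTransGen (Ctl m₀ (K.mech lvlIn lvlOut δ)) γ γ'
  inv : Inv K lvlIn lvlOut δ γ' m' r'
  frame : CtlFrame K lvlIn lvlOut δ γ m r γ' m' r'

section Steps

variable {K : Kind} {lvlIn : CIn → Level} {lvlOut : COut → Level} {m₀ : Mem}
  {δ : Defaults CIn COut} {γ γ' γ'' : EMConf CIn COut} {m m' m'' : MStage CIn}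
  {r r' r'' : RStage COut}

theorem Reach.refl (h : Inv K lvlIn lvlOut δ γ m r) :
    Reach K lvlIn lvlOut m₀ δ γ m r γ m r :=
  ⟨.refl, h, fun _ e he => ⟨e, he, rfl, rfl, id, .refl _ _ _ _⟩, id, rfl⟩

theorem Reach.trans (h : Reach K lvlIn lvlOut m₀ δ γ m r γ' m' r')
    (h' : Reach K lvlIn lvlOut m₀ δ γ' m' r' γ'' m'' r'') :
    Reach K lvlIn lvlOut m₀ δ γ m r γ'' m'' r'' := by
  refine ⟨h.run.trans h'.run, h'.inv, fun j e he => ?_, h'.frame.finish ∘ h.frame.finish,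
    h'.frame.sent.trans h.frame.sent⟩
  obtain ⟨a, ha, e1, e2, e3, e4⟩ := h.frame.old j e he
  obtain ⟨b, hb, f1, f2, f3, f4⟩ := h'.frame.old j a ha
  exact ⟨b, hb, f1.trans e1, f2.trans e2, f3 ∘ e3, e4.trans f4⟩

omit [DecidableEq COut] in
theorem Silent.step (h : Silent K lvlIn γ.tm m m') :
    MapStep (m.prog K lvlIn lvlOut δ) γ (m'.prog K lvlIn lvlOut δ) γ := by
  cases h with
  | ri₁ hK h => subst hK; exact .ifT (by simpa [inTM] using h)
  | ri₂ hK h => subst hK; exact .ifF (by simpa [inTM] using h)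
  | ni₁ hK h => subst hK; exact .ifT (by simpa [inTM] using h)
  | ni₂ hK h => subst hK; exact .ifF (by simpa [inTM] using h)
  | ni₃ hK h => subst hK; exact .ifT (by simpa [notInTM] using h)
  | ni₄ hK h => subst hK; exact .ifF (by simpa [notInTM] using h)
  | di₁ hK h => subst hK; exact .comp (.ifT (by simpa [const] using h))
  | di₂ hK h => subst hK; exact .comp (.ifF (by simpa [const] using h))
  | di₃ hK => subst hK; exact .skip
  | di₄ hK h => subst hK; exact .ifT (by simpa [inTM] using h)
  | di₅ hK h => subst hK; exact .ifF (by simpa [inTM] using h)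
  | di₆ hK h => subst hK; exact .ifT (by simpa [inTM] using h)
  | di₇ hK h => subst hK; exact .ifF (by simpa [inTM] using h)
  | b1 => exact .skip
  | b2 => exact .skip
  | b3 => exact .skip
  | d1 => exact .skip

omit [DecidableEq COut] in
theorem MTrans.step (h : MTrans K lvlIn lvlOut δ γ m m' γ')
    (hc : m.Cond K lvlIn γ.tm γ.ex γ.mapMem) :
    MapStep (m.prog K lvlIn lvlOut δ) γ (m'.prog K lvlIn lvlOut δ) γ' := by
  cases h with
  | silent h => exact h.step
  | clone => exact .comp (.atom .clone)
  | input h => exact .comp (.atom (.input h))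
  | tell => exact .comp (.atom (.map rfl))
  | hide => exact .comp (.atom (.map rfl))
  | wake =>
    refine .atom (.wake fun i e he hs => ?_)
    exact ((sat_isReady he).1 hs).1.1
  | default => exact .comp (.atom (.map rfl))
  | @wakeOne i c =>
    refine .atom (.wake fun j e he hs => ?_)
    have hj : j = i := by simpa [EMConf.sat, identical] using hs
    subst hj
    obtain ⟨⟨a, ha, hac⟩, _⟩ := hc
    rw [he] at ha; cases ha
    exact hac.1

omit [DecidableEq COut] in
theorem Inv.mapTrans (h : Inv K lvlIn lvlOut δ γ m r) (ht : MTrans K lvlIn lvlOut δ γ m m' γ') :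
    Inv K lvlIn lvlOut δ { γ' with mapPrg := m'.prog K lvlIn lvlOut δ } m' r ∧
      CtlEffect K lvlIn lvlOut δ γ m r { γ' with mapPrg := m'.prog K lvlIn lvlOut δ } m' r := by
  have he := ht.effect h.tables h.map
  have hred := h.red.map h.tables he
  refine ⟨⟨rfl, he.redPrg.trans h.redPrg, he.tables, he.map, hred⟩, ?_, ?_, ?_⟩
  · intro j e hj
    obtain ⟨a, ha, ⟨h1, h2, h3, h4⟩, hf⟩ := he.old j e hj
    refine ⟨a, ha, h1, h2, fun hx => ?_, hf⟩
    rcases h4 with h4 | h4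
    · exact h4.1.trans hx
    · exact h4.2.1
  · exact he.new
  · have h1 : 1 < γ.ex.length := by have := h.tables.two_le; omega
    have h1' : γ.ex[1]? = some γ.ex[1] := by simp [h1]
    obtain ⟨a, ha, ⟨_, _, h3, _⟩, _⟩ := he.old 1 _ h1'
    unfold lowSent pending
    simp only [ha, h1', he.out]
    cases r.Sent <;> simp [h3]

theorem Inv.reach_map (h : Inv K lvlIn lvlOut δ γ m r)
    (ht : MTrans K lvlIn lvlOut δ γ m m' γ') :
    Reach K lvlIn lvlOut m₀ δ γ m r { γ' with mapPrg := m'.prog K lvlIn lvlOut δ } m' r := by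
  obtain ⟨h1, h2⟩ := h.mapTrans ht
  exact ⟨.single (.map (by rw [h.mapPrg]; exact ht.step h.map.cond)), h1, h2.frame⟩

theorem Inv.reach_silent (h : Inv K lvlIn lvlOut δ γ m r) (ht : Silent K lvlIn γ.tm m m') :
    Reach K lvlIn lvlOut m₀ δ γ m r { γ with mapPrg := m'.prog K lvlIn lvlOut δ } m' r :=
  h.reach_map (.silent ht)

theorem Inv.reach_input {i : ℕ} {c : CIn} {y : Val} {I : Queue CIn}
    (h : Inv K lvlIn lvlOut δ γ (.b0 i c) r) (hI : γ.inp = (c, y) :: I) :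
    ∃ γ', Reach K lvlIn lvlOut m₀ δ γ (.b0 i c) r γ' (.b1 false c y) r ∧ γ'.inp = I ∧
      γ'.tm = γ.tm ∧ γ'.ex = γ.ex := by
  have r1 := h.reach_map (m₀ := m₀) (.input hI)
  exact ⟨_, r1.trans (r1.inv.reach_silent .b1), rfl, rfl, rfl⟩

theorem Inv.reach_tell {c : CIn} {y : Val} (h : Inv K lvlIn lvlOut δ γ (.b1 false c y) r) :
    ∃ γ', Reach K lvlIn lvlOut m₀ δ γ (.b1 false c y) r γ' (.b2 false c) r ∧ γ'.inp = γ.inp ∧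
      γ'.tm = γ.tm ∧ ∀ j : ℕ, γ'.ex[j]? = (γ.ex[j]?).map fun e : LocalConf CIn COut =>
        { e with inp := e.inp ++ if Priv.tell ∈ γ.tm.priv j c then [(c, y)] else [] } := by
  have r1 := h.reach_map (m₀ := m₀) .tell
  refine ⟨_, r1.trans (r1.inv.reach_silent .b2), rfl, rfl, fun j => ?_⟩
  have := append_getElem? γ (canTell c) c (γ.mapMem varX) j
  rw [h.map.cond.1] at this
  simpa [EMConf.sat, canTell, h.map.cond.1] using this

theorem Inv.reach_hide {c : CIn} (h : Inv K lvlIn lvlOut δ γ (.b2 false c) r) :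
    ∃ γ', Reach K lvlIn lvlOut m₀ δ γ (.b2 false c) r γ' (.b3 false c) r ∧ γ'.inp = γ.inp ∧
      ∀ j : ℕ, γ'.ex[j]? = (γ.ex[j]?).map fun e : LocalConf CIn COut =>
        { e with inp := e.inp ++ if Priv.tell ∉ γ.tm.priv j c then [(c, δ.inp c)] else [] } := by
  have r1 := h.reach_map (m₀ := m₀) .hide
  refine ⟨_, r1.trans (r1.inv.reach_silent .b3), rfl, fun j => ?_⟩
  simpa [EMConf.sat, notCanTell] using append_getElem? γ (notCanTell c) c (δ.inp c) j

theorem Inv.reach_wake {c : CIn} (h : Inv K lvlIn lvlOut δ γ (.b3 false c) r) :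
    ∃ γ', Reach K lvlIn lvlOut m₀ δ γ (.b3 false c) r γ' .idle r ∧ γ'.inp = γ.inp ∧
      γ'.ex.length = γ.ex.length ∧
      ∀ (j : ℕ) (e : LocalConf CIn COut), γ.ex[j]? = some e → e.AtInput c → Has c e.inp →
        ∃ a, γ'.ex[j]? = some a ∧ a.stt = .executing ∧ Has c a.inp := by
  have r1 := h.reach_map (m₀ := m₀) .wake
  refine ⟨_, r1, rfl, length_modify .., fun j e he hc hh => ?_⟩
  have := modify_getElem? γ (isReady c) (fun l => { l with int := none, stt := .executing }) j
  rw [he, Option.map_some, if_pos ((sat_isReady he).2 ⟨hc, hh⟩)] at this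
  exact ⟨_, this, rfl, hh⟩

/-- MAP receives an item and gives it to the local executions. -/
theorem Inv.reach_broadcast {i : ℕ} {c : CIn} {y : Val} {I : Queue CIn}
    (h : Inv K lvlIn lvlOut δ γ (.b0 i c) r) (hI : γ.inp = (c, y) :: I) :
    ∃ γ', Reach K lvlIn lvlOut m₀ δ γ (.b0 i c) r γ' .idle r ∧ γ'.inp = I ∧
      γ'.ex.length = γ.ex.length ∧
      ∀ (j : ℕ) (e : LocalConf CIn COut), γ.ex[j]? = some e → e.AtInput c →
        ∃ a, γ'.ex[j]? = some a ∧ a.stt = .executing ∧ Has c a.inp := by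
  have hlen : ∀ {γ₁ γ₂ : EMConf CIn COut} {f : ℕ → LocalConf CIn COut → LocalConf CIn COut},
      (∀ j : ℕ, γ₂.ex[j]? = (γ₁.ex[j]?).map (f j)) → γ₂.ex.length = γ₁.ex.length := by
    intro γ₁ γ₂ f hf
    refine le_antisymm ?_ ?_
    · have := hf γ₁.ex.length
      simpa using this
    · have := hf γ₂.ex.length
      simpa using this.symm
  obtain ⟨γ₁, r1, i1, t1, x1⟩ := h.reach_input (m₀ := m₀) hI
  obtain ⟨γ₂, r2, i2, t2, x2⟩ := r1.inv.reach_tell (m₀ := m₀)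
  obtain ⟨γ₃, r3, i3, x3⟩ := r2.inv.reach_hide (m₀ := m₀)
  obtain ⟨γ₄, r4, i4, l4, x4⟩ := r3.inv.reach_wake (m₀ := m₀)
  refine ⟨γ₄, ((r1.trans r2).trans r3).trans r4, by rw [i4, i3, i2, i1], ?_, fun j e he hc => ?_⟩
  · rw [l4, hlen (f := fun j e => { e with inp := _ }) x3,
      hlen (f := fun j e => { e with inp := _ }) x2, x1]
  · have e2 := x2 j
    rw [x1, he, Option.map_some] at e2
    have e3 := x3 j
    rw [e2, Option.map_some] at e3
    refine x4 j _ e3 hc ?_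
    simp only [t2]
    by_cases ht : Priv.tell ∈ γ₁.tm.priv j c <;> simp [ht]

/-- MAP sends a default item to the local execution `i`. -/
theorem Inv.reach_default {i : ℕ} {c : CIn} (h : Inv K lvlIn lvlOut δ γ (.d0 i c) r) :
    ∃ γ', Reach K lvlIn lvlOut m₀ δ γ (.d0 i c) r γ' .idle r ∧ γ'.inp = γ.inp ∧
      γ'.ex.length = γ.ex.length ∧
      ∃ a, γ'.ex[i]? = some a ∧ a.stt = .executing ∧ Has c a.inp := by
  obtain ⟨⟨e, he, hc⟩, -⟩ := h.map.cond
  obtain ⟨γ₁, r1, i1, x1⟩ : ∃ γ₁, Reach K lvlIn lvlOut m₀ δ γ (.d0 i c) r γ₁ (.d1 false i c) r ∧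
      γ₁.inp = γ.inp ∧ γ₁.ex = γ.ex.set i { e with inp := e.inp ++ [(c, δ.inp c)] } := by
    have r1 := h.reach_map (m₀ := m₀) .default
    exact ⟨_, r1.trans (r1.inv.reach_silent .d1), rfl,
      congrArg EMConf.ex (modify_identical he _)⟩
  have he1 : γ₁.ex[i]? = some { e with inp := e.inp ++ [(c, δ.inp c)] } := by
    rw [x1, getElem?_set_of_some he, if_pos rfl]
  obtain ⟨γ₂, r2, i2, x2⟩ : ∃ γ₂, Reach K lvlIn lvlOut m₀ δ γ₁ (.d1 false i c) r γ₂ .idle r ∧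
      γ₂.inp = γ₁.inp ∧ γ₂.ex = γ₁.ex.set i { e with
        inp := e.inp ++ [(c, δ.inp c)], int := none, stt := .executing } := by
    have r1 := r1.inv.reach_map (m₀ := m₀) .wakeOne
    exact ⟨_, r1, rfl, congrArg EMConf.ex (modify_identical he1 _)⟩
  refine ⟨γ₂, r1.trans r2, i2.trans i1, by simp [x2, x1], _,
    by rw [x2, getElem?_set_of_some he1, if_pos rfl], rfl, by simp⟩

/-- MAP accepts a request. -/
theorem Inv.reach_activate {i : ℕ} {c : CIn} {e : LocalConf CIn COut}
    (h : Inv K lvlIn lvlOut δ γ .idle r) (hi : γ.ex[i]? = some e) (hc : e.AtInput c)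
    (hl : lvlIn c = .low → i = 1) :
    ∃ γ', Reach K lvlIn lvlOut m₀ δ γ .idle r γ' (.dec .root i c) r ∧ γ'.inp = γ.inp ∧
      γ'.tm = γ.tm ∧ γ'.ex.length = γ.ex.length ∧ Waits γ'.ex i c := by
  -- With MAP idle, a missing signal would mean an ignored low request of an execution other than 1,
  -- which is excluded by `hl`.
  have hint : e.int = some (.inp c) := by
    rcases ((h.red.regular i e hi).of_atInput hc).2 with h0 | h0
    · rcases h.map.signal i e c hi hc h0 with h1 | h1
      · exact (h1.2 (hl h1.1)).elim
      · exact h1.elim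
    · exact h0
  obtain ⟨h1, h2⟩ := h.mapActivate hi hc m₀
  exact ⟨_, ⟨.single (.mapActivate h.mapPrg hi hc hint), h1, h2.frame⟩, rfl, rfl, by simp,
    { e with int := none }, by simp [getElem?_set_of_some hi], hc⟩

/-- MAP decides to ask for an item after a request of an execution that may do so. -/
theorem Inv.reach_ask {i : ℕ} {c : CIn} (h : Inv K lvlIn lvlOut δ γ (.dec .root i c) r)
    (hK : K = .ri ∨ K = .di ∧ i = asker (lvlIn c)) (hi : lvlIn c = .low → i = 1) :
    ∃ γ', Reach K lvlIn lvlOut m₀ δ γ (.dec .root i c) r γ' (.b0 i c) r ∧ γ'.inp = γ.inp ∧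
      (i ≠ 0 → γ'.ex.length = γ.ex.length) ∧ Waits γ'.ex i c := by
  have hw : Waits γ.ex i c := h.map.cond.1
  have hlt : i < γ.ex.length := by obtain ⟨e, he, _⟩ := hw; exact lt_of_getElem? he
  rcases hK with rfl | ⟨rfl, rfl⟩
  · have hask : Priv.ask ∈ γ.tm.priv i c := by
      cases hl : lvlIn c with
      | low => exact (h.tables.ask_low i c hl).2 (hi hl)
      | high => exact h.tables.ask_high (by simp) i c hlt hl
    exact ⟨_, h.reach_silent (.ri₁ rfl hask), rfl, fun _ => rfl, hw⟩
  · cases hl : lvlIn c with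
    | low =>
      rw [hl] at h hw
      have hask : Priv.ask ∈ γ.tm.priv 1 c := (h.tables.ask_low 1 c hl).2 rfl
      have htell : Priv.tell ∈ γ.tm.priv 1 c :=
        h.tables.tell_low 1 c (by have := h.tables.two_le; omega) hl
      have r1 := h.reach_silent (m₀ := m₀) (.di₂ rfl (by simp [hl]))
      have r2 := r1.trans (r1.inv.reach_silent (.di₃ rfl))
      have r3 := r2.trans (r2.inv.reach_silent (.di₄ rfl hask))
      exact ⟨_, r3.trans (r3.inv.reach_silent (.di₆ rfl htell)), rfl, fun _ => rfl, hw⟩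
    | high =>
      rw [hl] at h hw
      obtain ⟨e, he, hc⟩ := id hw
      have he' : γ.ex[0]? = some e := he
      obtain ⟨γ₁, r1, i1, x1⟩ : ∃ γ₁, Reach .di lvlIn lvlOut m₀ δ γ (.dec .root 0 c) r γ₁
          (.dec .sel 0 c) r ∧ γ₁.inp = γ.inp ∧ γ₁.ex = γ.ex ++ [e] := by
        have r1 := h.reach_silent (m₀ := m₀) (.di₁ rfl ⟨hl, rfl⟩)
        have r2 := r1.trans (r1.inv.reach_map .clone)
        exact ⟨_, r2.trans (r2.inv.reach_silent (.di₃ rfl)), rfl,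
          congrArg EMConf.ex (cloned_eq (lvlIn := lvlIn) (lvlOut := lvlOut) he' hc.1)⟩
      have hask := r1.inv.tables.ask_high_zero c hl
      have htell := (r1.inv.tables.tell_high 0 c hl).2 rfl
      have r2 := r1.inv.reach_silent (m₀ := m₀) (.di₄ rfl hask)
      exact ⟨_, r1.trans (r2.trans (r2.inv.reach_silent (.di₆ rfl htell))), i1, by simp [asker],
        by simpa [x1, asker] using hw.concat⟩

/-- MAP decides to send a default item. -/
theorem Inv.reach_decline {i : ℕ} {c : CIn} (h : Inv .di lvlIn lvlOut δ γ (.dec .root i c) r)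
    (hi : i ≠ 0) (hl : lvlIn c = .high) :
    ∃ γ', Reach .di lvlIn lvlOut m₀ δ γ (.dec .root i c) r γ' (.d0 i c) r ∧ γ'.inp = γ.inp ∧
      γ'.ex.length = γ.ex.length := by
  have hw : Waits γ.ex i c := h.map.cond.1
  have hlt : i < γ.ex.length := by obtain ⟨e, he, _⟩ := hw; exact lt_of_getElem? he
  have hask := h.tables.ask_high (by simp) i c hlt hl
  have htell : Priv.tell ∉ γ.tm.priv i c := fun h' => hi ((h.tables.tell_high i c hl).1 h')
  have r1 := h.reach_silent (m₀ := m₀) (.di₂ rfl (by simp [hi]))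
  have r2 := r1.trans (r1.inv.reach_silent (.di₃ rfl))
  have r3 := r2.trans (r2.inv.reach_silent (.di₄ rfl hask))
  exact ⟨_, r3.trans (r3.inv.reach_silent (.di₇ rfl htell)), rfl, rfl⟩

/-- MAP serves a request with an item of the environment. -/
theorem Inv.serve_ask {i : ℕ} {c : CIn} {e : LocalConf CIn COut} {y : Val} {I : Queue CIn}
    (h : Inv K lvlIn lvlOut δ γ .idle r) (hi : γ.ex[i]? = some e) (hc : e.AtInput c)
    (hl : lvlIn c = .low → i = 1) (hK : K = .ri ∨ K = .di ∧ i = asker (lvlIn c))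
    (hI : γ.inp = (c, y) :: I) :
    ∃ γ', Reach K lvlIn lvlOut m₀ δ γ .idle r γ' .idle r ∧ γ'.inp = I ∧
      (i ≠ 0 → γ'.ex.length = γ.ex.length) ∧
      ∃ a, γ'.ex[i]? = some a ∧ a.stt = .executing ∧ Has c a.inp := by
  obtain ⟨γ₁, r1, i1, -, l1, -⟩ := h.reach_activate (m₀ := m₀) hi hc hl
  obtain ⟨γ₂, r2, i2, l2, ⟨a, ha, hac⟩⟩ := r1.inv.reach_ask (m₀ := m₀) hK hl
  obtain ⟨γ₃, r3, i3, l3, x3⟩ := r2.inv.reach_broadcast (m₀ := m₀) (by rw [i2, i1, hI])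
  exact ⟨γ₃, (r1.trans r2).trans r3, i3, fun h0 => by rw [l3, l2 h0, l1], x3 i a ha hac⟩

/-- MAP serves a request with a default item. -/
theorem Inv.serve_default {i : ℕ} {c : CIn} {e : LocalConf CIn COut}
    (h : Inv .di lvlIn lvlOut δ γ .idle r) (hi : γ.ex[i]? = some e) (hc : e.AtInput c)
    (hl : lvlIn c = .high) (h0 : i ≠ 0) :
    ∃ γ', Reach .di lvlIn lvlOut m₀ δ γ .idle r γ' .idle r ∧ γ'.inp = γ.inp ∧
      γ'.ex.length = γ.ex.length ∧
      ∃ a, γ'.ex[i]? = some a ∧ a.stt = .executing ∧ Has c a.inp := by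
  obtain ⟨γ₁, r1, i1, -, l1, -⟩ := h.reach_activate (m₀ := m₀) hi hc (by simp [hl])
  obtain ⟨γ₂, r2, i2, l2⟩ := r1.inv.reach_decline (m₀ := m₀) h0 hl
  obtain ⟨γ₃, r3, i3, l3, x3⟩ := r2.inv.reach_default (m₀ := m₀)
  exact ⟨γ₃, (r1.trans r2).trans r3, by rw [i3, i2, i1], by rw [l3, l2, l1], x3⟩

theorem Inv.reach_red {q : RPt} {i : ℕ} {c : COut} (h : Inv K lvlIn lvlOut δ γ m (.busy q i c))
    (ht : RTrans δ i c γ q r' γ') :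
    Reach K lvlIn lvlOut m₀ δ γ m (.busy q i c) { γ' with redPrg := r'.prog δ } m r' := by
  obtain ⟨h1, h2⟩ := h.redStep ht
  exact ⟨.single (.red (by rw [h.redPrg]; exact ht.step)), h1, h2.frame⟩

/-- The number of steps that REDUCE still has to do, up to optional ones. -/
def RPt.rank : RPt → ℕ
  | .start => 10
  | .askW => 9
  | .ask => 8
  | .fetch => 7
  | .tellW => 6
  | .tell => 5
  | .emit => 4
  | .cleanW => 3
  | .clean => 2
  | .wakeW => 1
  | .wake => 0

omit [DecidableEq CIn] in
/-- REDUCE is never blocked. -/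
theorem RStage.Cond.exists_trans {q : RPt} {i : ℕ} {c : COut}
    (h : (RStage.busy q i c).Cond γ.tr γ.ex γ.redMem) :
    ∃ r' γ', RTrans δ i c γ q r' γ' ∧ γ'.inp = γ.inp ∧ γ'.ex.length = γ.ex.length ∧
      (r' = .idle ∧ (∃ a, γ'.ex[i]? = some a ∧ a.stt = .executing) ∨
        ∃ q', r' = .busy q' i c ∧ q'.rank < q.rank) := by
  obtain ⟨e, he, hs, -, -, -, hout, -, -⟩ := h
  have hasl : γ.Asleep (identical i) := by
    intro j a ha hj
    have : j = i := by simpa [EMConf.sat, identical] using hj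
    subst this
    rw [he] at ha; cases ha; exact hs
  cases q with
  | start => exact ⟨_, _, .start, rfl, rfl, .inr ⟨_, rfl, by simp [RPt.rank]⟩⟩
  | askW => exact ⟨_, _, .askW, rfl, rfl, .inr ⟨_, rfl, by simp [RPt.rank]⟩⟩
  | ask =>
    by_cases hp : Priv.ask ∈ γ.tr.priv i c
    · exact ⟨_, _, .ask₁ hp, rfl, rfl, .inr ⟨_, rfl, by simp [RPt.rank]⟩⟩
    · exact ⟨_, _, .ask₂ hp, rfl, rfl, .inr ⟨_, rfl, by simp [RPt.rank]⟩⟩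
  | fetch =>
    obtain ⟨y, hy, -⟩ := hout rfl
    exact ⟨_, _, .fetch he (by rw [hy]; exact dequeue_cons_self c y []), rfl, rfl,
      .inr ⟨_, rfl, by simp [RPt.rank]⟩⟩
  | tellW => exact ⟨_, _, .tellW, rfl, rfl, .inr ⟨_, rfl, by simp [RPt.rank]⟩⟩
  | tell =>
    by_cases hp : Priv.tell ∈ γ.tr.priv i c
    · exact ⟨_, _, .tell₁ hp, rfl, rfl, .inr ⟨_, rfl, by simp [RPt.rank]⟩⟩
    · exact ⟨_, _, .tell₂ hp, rfl, rfl, .inr ⟨_, rfl, by simp [RPt.rank]⟩⟩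
  | emit => exact ⟨_, _, .emit, rfl, rfl, .inr ⟨_, rfl, by simp [RPt.rank]⟩⟩
  | cleanW => exact ⟨_, _, .cleanW, rfl, rfl, .inr ⟨_, rfl, by simp [RPt.rank]⟩⟩
  | clean => exact ⟨_, _, .clean, rfl, length_modify .., .inr ⟨_, rfl, by simp [RPt.rank]⟩⟩
  | wakeW => exact ⟨_, _, .wakeW, rfl, rfl, .inr ⟨_, rfl, by simp [RPt.rank]⟩⟩
  | wake =>
    refine ⟨_, _, .wake hasl, rfl, length_modify .., .inl ⟨rfl, ?_⟩⟩
    rw [modify_identical he]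
    exact ⟨_, by rw [getElem?_set_of_some he, if_pos rfl], rfl⟩

/-- REDUCE can finish its work. -/
theorem Inv.reach_drain {q : RPt} {i : ℕ} {c : COut}
    (h : Inv K lvlIn lvlOut δ γ m (.busy q i c)) :
    ∃ γ', Reach K lvlIn lvlOut m₀ δ γ m (.busy q i c) γ' m .idle ∧ γ'.inp = γ.inp ∧
      γ'.ex.length = γ.ex.length ∧ ∃ a, γ'.ex[i]? = some a ∧ a.stt = .executing := by
  induction hn : q.rank using Nat.strong_induction_on generalizing q γ with
  | _ n ih =>
  subst hn
  obtain ⟨r', γ₁, ht, hi, hl, ⟨rfl, ha⟩ | ⟨q', rfl, hq⟩⟩ := h.red.cond.exists_trans (δ := δ)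
  · exact ⟨_, h.reach_red ht, hi, hl, ha⟩
  · have r1 := h.reach_red (m₀ := m₀) ht
    obtain ⟨γ₂, r2, i2, l2, x2⟩ := ih _ hq r1.inv rfl
    exact ⟨γ₂, r1.trans r2, i2.trans hi, l2.trans hl, x2⟩

/-- REDUCE serves an output. -/
theorem Inv.serve_output {i : ℕ} {e : LocalConf CIn COut} (h : Inv K lvlIn lvlOut δ γ m .idle)
    (hi : γ.ex[i]? = some e) (hs : e.stt = .sleeping) (hh : e.prg.head = none) :
    ∃ γ', Reach K lvlIn lvlOut m₀ δ γ m .idle γ' m .idle ∧ γ'.inp = γ.inp ∧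
      γ'.ex.length = γ.ex.length ∧ ∃ a, γ'.ex[i]? = some a ∧ a.stt = .executing := by
  rcases (h.red.regular i e hi).of_head_none hs hh with ⟨c, y, hint, -⟩ | ⟨-, hb⟩
  · obtain ⟨h1, h2⟩ := h.redActivate hi hs hint m₀
    obtain ⟨γ₂, r2, i2, l2, x2⟩ := h1.reach_drain (m₀ := m₀)
    refine ⟨γ₂, Reach.trans ⟨.single (.redActivate h.redPrg hi hs hint), h1, h2.frame⟩ r2, i2, ?_, x2⟩
    rw [l2]; simp
  · exact hb.elim

end Steps

end Reachability

/-! ### Running one local execution to its end -/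

section Completion

variable {CIn : Type u} {COut : Type v} [DecidableEq CIn]

/-- The local execution `j` can run to its end, receiving `ins` and sending `outs`, on the items
that it will be given. -/
structure Trace (K : Kind) (lvlIn : CIn → Level) (lvlOut : COut → Level) (δ : Defaults CIn COut)
    (O : Queue COut) (γ : EMConf CIn COut) (m : MStage CIn) (r : RStage COut) (j : ℕ)
    (e : LocalConf CIn COut) (ins : Queue CIn) (outs : Queue COut) : Prop where
  get : γ.ex[j]? = some e
  halts : Halts e.prg e.mem ins outs
  default : HighDefault lvlIn δ ins
  -- How closely a trace must match the items to come depends on who asks for them. The order on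
  -- each channel suffices for items found in the local queue. Execution 1 asks for low items, and
  -- in DI execution 0 for high ones, so there the order on the level must agree. In RI execution 1
  -- asks for everything, but the values it is given on high channels need not be those of the
  -- environment; hence only the channels are compared.
  onChan : ∀ c, lvlIn c = .low ∨ K = .ri ∧ j = 0 →
    Queue.onChan c ins <+: Queue.onChan c (flow δ γ m j e)
  low : j = 1 → Queue.atLevel lvlIn .low ins = Queue.atLevel lvlIn .low (flow δ γ m j e)
  sent : j = 1 → lowSent lvlOut γ r ++ Queue.atLevel lvlOut .low outs = O
  high : K = .di → j = 0 →
    Queue.atLevel lvlIn .high ins = Queue.atLevel lvlIn .high (flow δ γ m j e)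
  chan : K = .ri → j = 1 → ins.map Prod.fst = (flow δ γ m j e).map Prod.fst

/-- All local executions can run to their ends. -/
def Traces (K : Kind) (lvlIn : CIn → Level) (lvlOut : COut → Level) (δ : Defaults CIn COut)
    (O : Queue COut) (γ : EMConf CIn COut) (m : MStage CIn) (r : RStage COut) : Prop :=
  ∀ j, j < γ.ex.length → ∃ e ins outs, Trace K lvlIn lvlOut δ O γ m r j e ins outs

/-- The local execution `j` has terminated. -/
def Done (γ : EMConf CIn COut) (j : ℕ) : Prop :=
  ∃ e, γ.ex[j]? = some e ∧ e.prg = .skip ∧ e.stt = .executing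

/-- The form of the input that allows the local execution `j` to run alone. -/
structure Ordered (K : Kind) (lvlIn : CIn → Level) (j : ℕ) (Q : Queue CIn) : Prop where
  -- In DI execution 1 takes the low items and leaves the high ones to execution 0, so they must not
  -- stand in its way.
  low_first : j = 1 → K = .di → ∃ L H, Q = L ++ H ∧ (∀ q ∈ L, lvlIn q.1 = .low) ∧
    ∀ q ∈ H, lvlIn q.1 = .high
  no_low : j ≠ 1 → Queue.atLevel lvlIn .low Q = []
  empty : j ≠ 1 → K = .ri ∨ j ≠ 0 → Q = []

variable {K : Kind} {lvlIn : CIn → Level} {lvlOut : COut → Level} {m₀ : Mem}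
  {δ : Defaults CIn COut} {O : Queue COut} {γ γ' : EMConf CIn COut} {m m' : MStage CIn}
  {r r' : RStage COut} {j : ℕ} {e e' : LocalConf CIn COut} {ins : Queue CIn}
  {outs outs' : Queue COut} {c : CIn} {y : Val}

omit [DecidableEq CIn] in
theorem Ordered.tail {Q : Queue CIn} (h : Ordered K lvlIn j ((c, y) :: Q)) :
    Ordered K lvlIn j Q := by
  refine ⟨fun h1 h2 => ?_, fun h1 => ?_, fun h1 h2 => ?_⟩
  · obtain ⟨L, H, h3, hL, hH⟩ := h.low_first h1 h2
    cases L with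
    | nil => exact ⟨[], Q, rfl, by simp, fun q hq => hH q (by rw [← List.nil_append H, ← h3]; simp [hq])⟩
    | cons a L =>
      rw [List.cons_append, List.cons.injEq] at h3
      exact ⟨L, H, h3.2, fun q hq => hL q (by simp [hq]), hH⟩
  · exact atLevel_eq_nil_of_subset (fun q hq => by simp [hq]) (h.no_low h1)
  · cases h.empty h1 h2

omit [DecidableEq CIn] in
theorem Halts.of_skip {m : Mem} (h : Halts (.skip : Prog CIn COut) m ins outs) :
    ins = [] ∧ outs = [] := by
  cases h with
  | done => exact ⟨rfl, rfl⟩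
  | tau h => exact h.not_skip.elim
  | inp h => exact h.not_skip.elim
  | out h => exact h.not_skip.elim

theorem Trace.canFinish (h : Trace K lvlIn lvlOut δ O γ m r j e ins outs) :
    CanFinish lvlIn δ j γ m :=
  ⟨e, ins, outs, h.get, h.halts, h.default, fun c hc => h.onChan c (.inl hc)⟩

/-- Clones never consume items of the environment in the constructed runs, so the order on low
channels is all that is asked of them. -/
theorem CanFinish.trace (h : CanFinish lvlIn δ j γ m) (hj : 2 ≤ j) :
    ∃ e ins outs, Trace K lvlIn lvlOut δ O γ m r j e ins outs := by
  obtain ⟨e, ins, outs, h1, h2, h3, h4⟩ := h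
  refine ⟨e, ins, outs, h1, h2, h3, fun c hc => h4 c ?_, ?_, ?_, ?_, ?_⟩
  · rcases hc with hc | hc
    · exact hc
    · omega
  all_goals intros; omega

theorem Trace.frame (h : Trace K lvlIn lvlOut δ O γ m r j e ins outs)
    (hf : CtlFrame K lvlIn lvlOut δ γ m r γ' m' r') :
    ∃ a, Trace K lvlIn lvlOut δ O γ' m' r' j a ins outs ∧ a.prg = e.prg ∧ a.mem = e.mem ∧
      (e.stt = .executing → a.stt = .executing) := by
  obtain ⟨a, ha, e1, e2, e3, f1, f2, f3⟩ := hf.old j e h.get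
  refine ⟨a, ⟨ha, by rw [e1, e2]; exact h.halts, h.default, ?_, ?_, ?_, ?_, ?_⟩, e1, e2, e3⟩
  · rintro c (hc | ⟨hK, rfl⟩)
    · rw [← onChan_atLevel hc (flow δ γ' m' j a), f1, onChan_atLevel hc]
      exact h.onChan c (.inl hc)
    · rw [f2 rfl]
      exact h.onChan c (.inr ⟨hK, rfl⟩)
  · intro hj; rw [f1]; exact h.low hj
  · intro hj; rw [hf.sent]; exact h.sent hj
  · intro hK hj; rw [f2 hj]; exact h.high hK hj
  · intro hK hj; rw [f3 hK]; exact h.chan hK hj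

/-- Executions 0 and 1 exist from the start; whatever MAP adds is a clone, for which `CanFinish` is
enough. -/
theorem Traces.frame (h : Traces K lvlIn lvlOut δ O γ m r) (h2 : 2 ≤ γ.ex.length)
    (hf : CtlFrame K lvlIn lvlOut δ γ m r γ' m' r') :
    Traces K lvlIn lvlOut δ O γ' m' r' := by
  intro k hk
  by_cases hk' : k < γ.ex.length
  · obtain ⟨e, ins, outs, ht⟩ := h k hk'
    obtain ⟨a, ha, -⟩ := ht.frame hf
    exact ⟨a, ins, outs, ha⟩
  · refine (hf.finish (fun i hi => ?_) k hk).trace (by omega)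
    obtain ⟨e, ins, outs, ht⟩ := h i hi
    exact ht.canFinish

theorem Done.frame (h : Done γ j) (hf : CtlFrame K lvlIn lvlOut δ γ m r γ' m' r') :
    Done γ' j := by
  obtain ⟨e, he, hp, hx⟩ := h
  obtain ⟨a, ha, e1, -, e3, -⟩ := hf.old j e he
  exact ⟨a, ha, e1.trans hp, e3 hx⟩

omit [DecidableEq CIn] in
theorem lowSent_set (hi : γ.ex[j]? = some e) (hout : e.out = []) (h1 : j = 1) :
    lowSent lvlOut { γ with ex := γ.ex.set j e' } .idle =
      lowSent lvlOut γ .idle ++ Queue.atLevel lvlOut .low e'.out := by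
  subst h1
  simp [lowSent, pending, RStage.Sent, getElem?_set_of_some hi, hi, hout]

theorem Trace.set_of_ne {k : ℕ} {a : LocalConf CIn COut}
    (h : Trace K lvlIn lvlOut δ O γ m r k a ins outs) (hi : γ.ex[j]? = some e) (hk : j ≠ k) :
    Trace K lvlIn lvlOut δ O { γ with ex := γ.ex.set j e' } m r k a ins outs := by
  refine ⟨?_, h.halts, h.default, h.onChan, h.low, fun h1 => ?_, h.high, h.chan⟩
  · simp only [getElem?_set_of_some hi, if_neg hk, h.get]
  · rw [← h.sent h1]
    subst h1
    simp only [lowSent, pending, getElem?_set_of_some hi, if_neg hk]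

/-- A step of the local execution that receives nothing. -/
theorem Trace.set (h : Trace K lvlIn lvlOut δ O γ m .idle j e ins outs) (hout : e.out = [])
    (hinp : e'.inp = e.inp) (hh : Halts e'.prg e'.mem ins outs')
    (hO : Queue.atLevel lvlOut .low e'.out ++ Queue.atLevel lvlOut .low outs' =
      Queue.atLevel lvlOut .low outs) :
    Trace K lvlIn lvlOut δ O { γ with ex := γ.ex.set j e' } m .idle j e' ins outs' := by
  have hflow : flow δ { γ with ex := γ.ex.set j e' } m j e' = flow δ γ m j e := by
    simp [flow, hinp]
  refine ⟨by simp only [getElem?_set_of_some h.get, if_true], hh, h.default, ?_, ?_, ?_, ?_, ?_⟩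
  · rw [hflow]; exact h.onChan
  · rw [hflow]; exact h.low
  · intro h1
    rw [lowSent_set h.get hout h1, List.append_assoc, hO]
    exact h.sent h1
  · rw [hflow]; exact h.high
  · rw [hflow]; exact h.chan

/-- A configuration in which MAP and REDUCE are idle and from which all local executions can be
completed. -/
structure Quiet (K : Kind) (lvlIn : CIn → Level) (lvlOut : COut → Level)
    (δ : Defaults CIn COut) (O : Queue COut) (γ : EMConf CIn COut) : Prop where
  inv : Inv K lvlIn lvlOut δ γ .idle .idle
  traces : Traces K lvlIn lvlOut δ O γ .idle .idle

/-- What a run of the local execution `j` alone preserves; `S` is a set of terminated ones. -/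
structure Alone (K : Kind) (lvlIn : CIn → Level) (lvlOut : COut → Level)
    (δ : Defaults CIn COut) (O : Queue COut) (S : ℕ → Prop) (n j : ℕ) (γ : EMConf CIn COut) :
    Prop where
  quiet : Quiet K lvlIn lvlOut δ O γ
  ordered : Ordered K lvlIn j γ.inp
  done : ∀ k, S k → Done γ k
  length : j ≠ 0 → γ.ex.length = n

variable {S : ℕ → Prop} {n : ℕ}

theorem Alone.frame (h : Alone K lvlIn lvlOut δ O S n j γ)
    (hi : Inv K lvlIn lvlOut δ γ' .idle .idle)
    (hf : CtlFrame K lvlIn lvlOut δ γ .idle .idle γ' .idle .idle)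
    (ho : Ordered K lvlIn j γ'.inp) (hl : j ≠ 0 → γ'.ex.length = γ.ex.length) :
    Alone K lvlIn lvlOut δ O S n j γ' :=
  ⟨⟨hi, h.quiet.traces.frame h.quiet.inv.tables.two_le hf⟩, ho, fun k hk => (h.done k hk).frame hf,
    fun h0 => (hl h0).trans (h.length h0)⟩

theorem Alone.exec (h : Alone K lvlIn lvlOut δ O S n j γ) (hi : γ.ex[j]? = some e)
    (hs : LocalStep e e') {ins' : Queue CIn}
    (ht : Trace K lvlIn lvlOut δ O { γ with ex := γ.ex.set j e' } .idle .idle j e' ins' outs') :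
    Alone K lvlIn lvlOut δ O S n j { γ with ex := γ.ex.set j e' } := by
  refine ⟨⟨h.quiet.inv.exec hi hs, fun k hk => ?_⟩, h.ordered, fun k hk => ?_, fun h0 => ?_⟩
  · by_cases hjk : j = k
    · subst hjk; exact ⟨e', ins', outs', ht⟩
    · obtain ⟨a, i, o, ha⟩ := h.quiet.traces k (by simpa using hk)
      exact ⟨a, i, o, ha.set_of_ne hi hjk⟩
  · obtain ⟨a, ha, hp, hx⟩ := h.done k hk
    -- A terminated execution has no step.
    have hjk : j ≠ k := by
      rintro rfl
      rw [hi] at ha; cases ha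
      obtain ⟨-, p, s, hs, -⟩ := hs
      rw [hp] at hs; cases hs
    exact ⟨a, by simp only [getElem?_set_of_some hi, if_neg hjk, ha], hp, hx⟩
  · simpa using h.length h0

theorem Inv.not_has_of_atInput (h : Inv K lvlIn lvlOut δ γ .idle r) (hi : γ.ex[j]? = some e)
    (hc : e.AtInput c) : ¬ Has c e.inp := by
  intro hh
  rcases h.map.no_item j e c hi hc hh with h | ⟨w, h⟩
  · exact h
  · cases h

omit [DecidableEq CIn] in
theorem Served.eq_nil {l : Level} (h : Served lvlIn γ.ex m l) (hm : ∀ d, ¬ m.Delivered d)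
    (hi : γ.ex[asker l]? = some e) (hc : e.AtInput c) : Queue.atLevel lvlIn l e.inp = [] := by
  rcases h e hi with h | ⟨x, d, v, -, -, -, h | h⟩
  · exact h
  · exact (hc.not_executing h).elim
  · exact (hm d h).elim

/-- The environment holds the item that a local execution waits for, unless a default one will be
sent. -/
theorem Alone.head_inp (hK : K ≠ .ni) (h : Alone K lvlIn lvlOut δ O S n j γ)
    (ht : Trace K lvlIn lvlOut δ O γ .idle .idle j e ((c, y) :: ins) outs) (hc : e.AtInput c) :
    (K = .di ∧ lvlIn c = .high ∧ j ≠ 0) ∨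
    (lvlIn c = .low → j = 1) ∧ (K = .ri ∨ K = .di ∧ j = asker (lvlIn c)) ∧
      ∃ z I, γ.inp = (c, z) :: I := by
  have hnot := h.quiet.inv.not_has_of_atInput ht.get hc
  -- The trace reads from `c` next and the local queue has no item on `c`, so the environment must
  -- have one.
  have hmem : (lvlIn c = .low ∨ K = .ri ∧ j = 0) → Has c γ.inp := by
    intro h1
    by_contra h2
    have h3 := ht.onChan c h1
    have hf : ¬ Has c (flow δ γ .idle j e) := by simp [flow, MStage.inflight, hnot, h2]
    rw [onChan_eq_nil_of_not_has hf, onChan_cons_self] at h3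
    simp at h3
  cases K with
  | ni => exact (hK rfl).elim
  | ri =>
    have h2 : j < 2 := by
      have := h.quiet.inv.tables.eq_two (by simp)
      have := lt_of_getElem? ht.get
      omega
    by_cases h1 : j = 1
    · refine .inr ⟨fun _ => h1, .inl rfl, ?_⟩
      -- The trace and the unread items visit the same channels in the same order. The local queue
      -- cannot begin with `c`, so it is empty and the environment begins with `c`.
      have h3 := ht.chan rfl h1
      simp only [flow, MStage.inflight, List.append_nil] at h3
      cases he : e.inp with
      | cons q Q =>
        obtain ⟨d, z⟩ := q
        rw [he] at h3
        simp only [List.map_cons, List.cons_append, List.cons.injEq] at h3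
        exact (hnot ⟨z, by rw [he, h3.1]; simp⟩).elim
      | nil =>
        rw [he, List.nil_append] at h3
        cases hI : γ.inp with
        | nil => rw [hI] at h3; simp at h3
        | cons q Q =>
          obtain ⟨d, z⟩ := q
          rw [hI] at h3
          simp only [List.map_cons, List.cons.injEq] at h3
          exact ⟨z, Q, by rw [h3.1]⟩
    · have h0 : j = 0 := by omega
      obtain ⟨z, hz⟩ := hmem (.inr ⟨rfl, h0⟩)
      rw [h.ordered.empty h1 (.inl rfl)] at hz
      simp at hz
  | di =>
    cases hl : lvlIn c with
    | low =>
      have h1 : j = 1 := by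
        by_contra h1
        obtain ⟨z, hz⟩ := hmem (.inl hl)
        have := atLevel_ne_nil_of_mem (lvl := lvlIn) hz
        rw [hl] at this
        exact this (h.ordered.no_low h1)
      subst h1
      refine .inr ⟨fun _ => rfl, .inr ⟨rfl, rfl⟩, ?_⟩
      have h3 := ht.low rfl
      rw [atLevel_cons_of_eq hl] at h3
      -- The asleep execution 1 holds no low item, so the next low item of the trace is the head of
      -- the low block of the environment.
      obtain ⟨L, H, hI, hL, hH⟩ := h.ordered.low_first rfl rfl
      have hL' : Queue.atLevel lvlIn .low L = L := by simpa [Queue.atLevel] using hL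
      have hH' : Queue.atLevel lvlIn .low H = [] := by
        simp only [Queue.atLevel, List.filter_eq_nil_iff, decide_eq_true_eq]
        intro q hq; rw [hH q hq]; simp
      simp only [flow, MStage.inflight, List.append_nil, atLevel_append, hI, hL', hH',
        h.quiet.inv.map.served_low.eq_nil (fun _ h => h) ht.get hc, List.nil_append] at h3
      exact ⟨y, Queue.atLevel lvlIn .low ins ++ H, by rw [hI, ← h3]; rfl⟩
    | high =>
      by_cases h0 : j = 0
      swap
      · exact .inl ⟨rfl, rfl, h0⟩
      subst h0
      refine .inr ⟨by simp, .inr ⟨rfl, rfl⟩, ?_⟩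
      have h3 := ht.high rfl rfl
      rw [atLevel_cons_of_eq hl] at h3
      -- When execution 0 runs, only high items are left, so their order is that of the whole
      -- environment.
      have hI : Queue.atLevel lvlIn .high γ.inp = γ.inp := by
        have := h.ordered.no_low (by simp)
        simp only [Queue.atLevel, List.filter_eq_nil_iff, decide_eq_true_eq,
          List.filter_eq_self] at this ⊢
        exact fun q hq => Level.eq_high_of_ne_low (this q hq)
      simp only [flow, MStage.inflight, List.append_nil, atLevel_append, hI,
        (h.quiet.inv.map.served_high rfl).eq_nil (fun _ h => h) ht.get hc, List.nil_append] at h3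
      exact ⟨y, _, h3.symm⟩

/-- A step of the local execution that receives an item. -/
theorem Alone.trace_inp (hK : K ≠ .ni) (h : Alone K lvlIn lvlOut δ O S n j γ)
    (ht : Trace K lvlIn lvlOut δ O γ .idle .idle j e ((c, y) :: ins) outs) (hout : e.out = [])
    {z : Val} {I : Queue CIn} (hd : dequeue c e.inp = some (z, I)) :
    z = y ∧ ∀ p mm, Halts p mm ins outs →
      Trace K lvlIn lvlOut δ O
        { γ with ex := γ.ex.set j { e with prg := p, mem := mm, inp := I } } .idle .idle j
        { e with prg := p, mem := mm, inp := I } ins outs := by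
  have hinv := h.quiet.inv
  have hmem : (c, z) ∈ e.inp := dequeue_mem hd
  have hserved : ∀ l, lvlIn c = l → j = asker l → Served lvlIn γ.ex .idle l →
      Queue.atLevel lvlIn l e.inp = [(c, z)] ∧ Queue.atLevel lvlIn l I = [] := by
    rintro l hl rfl hs
    rcases hs e ht.get with h0 | ⟨x, d, v, -, -, h0, -⟩
    · have := atLevel_ne_nil_of_mem (lvl := lvlIn) hmem
      rw [hl] at this
      exact (this h0).elim
    · obtain ⟨rfl, rfl, h5⟩ := dequeue_atLevel_of_singleton hd hl h0
      exact ⟨h0, h5⟩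
  have hchan : lvlIn c = .low ∨ K = .ri ∧ j = 0 → z = y := by
    intro h1
    have h2 := ht.onChan c h1
    rw [onChan_cons_self] at h2
    simp only [flow, onChan_append, dequeue_onChan_self hd, List.cons_append,
      List.cons_prefix_cons, Prod.mk.injEq, true_and] at h2
    exact h2.1.symm
  have hhigh : lvlIn c = .high → y = δ.inp c := fun hl => ht.default (c, y) (by simp) hl
  -- The item at hand carries the value that the trace expects: on low channels, and for execution 0
  -- in RI, by the order on the channel; on high channels of other executions because both values
  -- are default; for execution 0 in DI because it holds a single high item.
  have hzy : z = y := by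
    cases hl : lvlIn c with
    | low => exact hchan (.inl hl)
    | high =>
      by_cases h0 : j = 0
      swap
      · rw [hhigh hl]; exact hinv.map.default j e ht.get h0 (c, z) hmem hl
      cases K with
      | ni => exact (hK rfl).elim
      | ri => exact hchan (.inr ⟨rfl, h0⟩)
      | di =>
        have h1 := ht.high rfl h0
        simp only [flow, atLevel_append, (hserved _ hl h0 (hinv.map.served_high rfl)).1,
          atLevel_cons_of_eq hl, List.cons_append, List.cons.injEq, Prod.mk.injEq] at h1
        exact h1.1.2.symm
  subst hzy
  refine ⟨rfl, fun p mm hh => ?_⟩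
  have hlevel : ∀ l, Queue.atLevel lvlIn l ((c, z) :: ins) =
      Queue.atLevel lvlIn l (e.inp ++ γ.inp) →
      (lvlIn c = l → j = asker l ∧ Served lvlIn γ.ex .idle l) →
      Queue.atLevel lvlIn l ins = Queue.atLevel lvlIn l (I ++ γ.inp) := by
    intro l h1 h2
    by_cases hl : lvlIn c = l
    · obtain ⟨h3, h4⟩ := hserved l hl (h2 hl).1 (h2 hl).2
      rw [atLevel_append, h4]
      simpa [atLevel_cons_of_eq hl, atLevel_append, h3] using h1
    · rw [atLevel_append, ← dequeue_atLevel_of_ne hd hl]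
      simpa [atLevel_cons_of_ne hl, atLevel_append] using h1
  have hgetset : (γ.ex.set j { e with prg := p, mem := mm, inp := I })[j]? =
      some { e with prg := p, mem := mm, inp := I } := by
    rw [getElem?_set_of_some ht.get, if_pos rfl]
  refine ⟨hgetset, hh, fun q hq => ht.default q (by simp [hq]), fun d h1 => ?_, fun h1 => ?_,
    fun h1 => ?_, fun hdi h1 => ?_, fun hri h1 => ?_⟩
  · have h2 := ht.onChan d h1
    simp only [flow, onChan_append] at h2 ⊢
    by_cases hcd : c = d
    · subst hcd
      rw [onChan_cons_self, dequeue_onChan_self hd, List.cons_append, List.cons_append] at h2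
      exact (List.prefix_cons_inj _).1 h2
    · rwa [onChan_cons_of_ne hcd, dequeue_onChan_of_ne hd hcd] at h2
  · have h2 := ht.low h1
    simp only [flow, MStage.inflight, List.append_nil] at h2 ⊢
    exact hlevel _ h2 fun _ => ⟨h1, hinv.map.served_low⟩
  · rw [lowSent_set ht.get hout h1]
    simpa [hout] using ht.sent h1
  · have h2 := ht.high hdi h1
    simp only [flow, MStage.inflight, List.append_nil] at h2 ⊢
    exact hlevel _ h2 fun _ => ⟨h1, hinv.map.served_high hdi⟩
  · have h2 := ht.chan hri h1
    simp only [flow, MStage.inflight, List.append_nil] at h2 ⊢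
    cases he : e.inp with
    | nil => rw [he] at hmem; simp at hmem
    | cons q Q =>
      obtain ⟨d, x⟩ := q
      rw [he] at h2 hd
      simp only [List.map_cons, List.cons_append, List.cons.injEq] at h2
      -- The local queue begins with an item on the channel read next, so its head is removed and
      -- the two sequences of channels stay aligned.
      rw [← h2.1, dequeue_cons_self] at hd
      cases hd
      exact h2.2

variable [DecidableEq COut]

/-- A run of the mechanism. -/
abbrev Runs (K : Kind) (lvlIn : CIn → Level) (lvlOut : COut → Level) (m₀ : Mem)
    (δ : Defaults CIn COut) : EMConf CIn COut → EMConf CIn COut → Prop :=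
  Relation.ReflTransGen (EMStep m₀ (K.mech lvlIn lvlOut δ))

theorem Reach.runs (h : Reach K lvlIn lvlOut m₀ δ γ m r γ' m' r') :
    Runs K lvlIn lvlOut m₀ δ γ γ' :=
  h.run.lift id fun _ _ h => EMStep.iff.2 (.inr h)

theorem Alone.reach (h : Alone K lvlIn lvlOut δ O S n j γ)
    (ht : Trace K lvlIn lvlOut δ O γ .idle .idle j e ins outs)
    (hr : Reach K lvlIn lvlOut m₀ δ γ .idle .idle γ' .idle .idle)
    (ho : Ordered K lvlIn j γ'.inp) (hl : j ≠ 0 → γ'.ex.length = γ.ex.length) :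
    Alone K lvlIn lvlOut δ O S n j γ' ∧ ∃ a, Trace K lvlIn lvlOut δ O γ' .idle .idle j a ins outs ∧
      a.prg = e.prg ∧ a.mem = e.mem := by
  obtain ⟨a, ha, e1, e2, -⟩ := ht.frame hr.frame
  exact ⟨h.frame hr.inv hr.frame ho hl, a, ha, e1, e2⟩

/-- The local execution gets the item that it waits for. -/
theorem Alone.request (hK : K ≠ .ni) (h : Alone K lvlIn lvlOut δ O S n j γ)
    (ht : Trace K lvlIn lvlOut δ O γ .idle .idle j e ((c, y) :: ins) outs) (hc : e.AtInput c) :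
    ∃ γ' a, Runs K lvlIn lvlOut m₀ δ γ γ' ∧ Alone K lvlIn lvlOut δ O S n j γ' ∧
      Trace K lvlIn lvlOut δ O γ' .idle .idle j a ((c, y) :: ins) outs ∧ a.prg = e.prg ∧
      a.mem = e.mem ∧ a.stt = .executing ∧ Has c a.inp := by
  have finish : ∀ γ', Reach K lvlIn lvlOut m₀ δ γ .idle .idle γ' .idle .idle →
      Ordered K lvlIn j γ'.inp → (j ≠ 0 → γ'.ex.length = γ.ex.length) →
      (∃ a, γ'.ex[j]? = some a ∧ a.stt = .executing ∧ Has c a.inp) →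
      ∃ γ' a, Runs K lvlIn lvlOut m₀ δ γ γ' ∧ Alone K lvlIn lvlOut δ O S n j γ' ∧
        Trace K lvlIn lvlOut δ O γ' .idle .idle j a ((c, y) :: ins) outs ∧ a.prg = e.prg ∧
        a.mem = e.mem ∧ a.stt = .executing ∧ Has c a.inp := by
    rintro γ' hr ho hl ⟨a, ha, hx, hh⟩
    obtain ⟨h1, b, hb, e1, e2⟩ := h.reach ht hr ho hl
    have := hb.get
    rw [ha] at this; cases this
    exact ⟨γ', a, hr.runs, h1, hb, e1, e2, hx, hh⟩
  rcases h.head_inp hK ht hc with ⟨rfl, hl, h0⟩ | ⟨hl, hk, z, I, hI⟩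
  · obtain ⟨γ', hr, i1, l1, x1⟩ := h.quiet.inv.serve_default (m₀ := m₀) ht.get hc hl h0
    exact finish γ' hr (by rw [i1]; exact h.ordered) (fun _ => l1) x1
  · obtain ⟨γ', hr, i1, l1, x1⟩ := h.quiet.inv.serve_ask (m₀ := m₀) ht.get hc hl hk hI
    have ho := h.ordered
    rw [hI] at ho
    exact finish γ' hr (by rw [i1]; exact ho.tail) l1 x1

/-- The output of a sleeping local execution is served. -/
theorem Alone.wake (h : Alone K lvlIn lvlOut δ O S n j γ)
    (ht : Trace K lvlIn lvlOut δ O γ .idle .idle j e ins outs) (hh : ∀ c, ¬ e.AtInput c) :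
    ∃ γ' a, Runs K lvlIn lvlOut m₀ δ γ γ' ∧ Alone K lvlIn lvlOut δ O S n j γ' ∧
      Trace K lvlIn lvlOut δ O γ' .idle .idle j a ins outs ∧ a.prg = e.prg ∧
      a.mem = e.mem ∧ a.stt = .executing := by
  rcases h.quiet.inv.red.regular j e ht.get with hx | ⟨c, hc, -⟩ | ⟨hs, hn, -⟩
  · exact ⟨γ, e, .refl, h, ht, rfl, rfl, hx.1⟩
  · exact (hh c hc).elim
  · obtain ⟨γ', hr, i1, l1, a, ha, hx⟩ := h.quiet.inv.serve_output (m₀ := m₀) ht.get hs hn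
    obtain ⟨h1, b, hb, e1, e2⟩ := h.reach ht hr (by rw [i1]; exact h.ordered) (fun _ => l1)
    have := hb.get
    rw [ha] at this; cases this
    exact ⟨γ', a, hr.runs, h1, hb, e1, e2, hx⟩

omit [DecidableEq COut] in
theorem Alone.regular (h : Alone K lvlIn lvlOut δ O S n j γ) (hi : γ.ex[j]? = some e)
    (hx : e.stt = .executing) : e.int = none ∧ e.out = [] :=
  (h.quiet.inv.red.regular j e hi).of_executing hx

/-- The local execution `j` runs to its end while the other ones rest. -/
theorem Alone.run (hK : K ≠ .ni) (h : Alone K lvlIn lvlOut δ O S n j γ)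
    (ht : Trace K lvlIn lvlOut δ O γ .idle .idle j e ins outs) :
    ∃ γ', Runs K lvlIn lvlOut m₀ δ γ γ' ∧ Alone K lvlIn lvlOut δ O S n j γ' ∧ Done γ' j := by
  have hh := ht.halts
  generalize hp : e.prg = p at hh
  generalize hm : e.mem = mm at hh
  induction hh generalizing γ e with
  | done =>
    -- The program may have ended with an output that REDUCE still has to serve.
    obtain ⟨γ', a, hr, h', ht', e1, -, hx⟩ := h.wake (m₀ := m₀) ht
      fun c hc => hc.head_ne (by rw [hp]; rfl)
    exact ⟨γ', hr, h', a, ht'.get, e1.trans hp, hx⟩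
  | @tau p mm p' mm' i o hs hh ih =>
    obtain ⟨γ', a, hr, h', ht', e1, e2, hx⟩ := h.wake (m₀ := m₀) ht
      fun c hc => hc.head_ne (by rw [hp]; exact hs.head_tau)
    rw [← hp, ← hm, ← e1, ← e2] at hs
    have hout := (h'.regular ht'.get hx).2
    have hst : LocalStep a _ := ⟨hx, _, _, LocalConf.step_tau hs, rfl⟩
    have ht₂ := ht'.set hout (e' := { a with prg := p', mem := mm' }) rfl hh (by simp [hout])
    obtain ⟨γ'', hr', h''⟩ := ih (h'.exec ht'.get hst ht₂) ht₂ rfl rfl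
    exact ⟨γ'', (hr.tail (.exec ht'.get hst)).trans hr', h''⟩
  | @out p mm p' mm' c y i o hs hh ih =>
    obtain ⟨⟨x, hx⟩, -, rfl⟩ := hs.head_out
    obtain ⟨γ', a, hr, h', ht', e1, e2, hx⟩ := h.wake (m₀ := m₀) ht (by
      rintro d ⟨-, z, hz⟩
      rw [hp, hx] at hz; cases hz)
    rw [← hp, ← hm, ← e1, ← e2] at hs
    obtain ⟨hint, hout⟩ := h'.regular ht'.get hx
    have hst : LocalStep a _ := ⟨hx, _, _, LocalConf.step_out hs hint, rfl⟩
    have ht₂ := ht'.set hout (e' := { a with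
      stt := .sleeping, int := some (.out c), out := a.out ++ [(c, y)], prg := p' }) rfl
      (by simpa [e2, hm] using hh) (by
        simp only [hout, List.nil_append]
        rw [← atLevel_append, List.singleton_append])
    obtain ⟨γ'', hr', h''⟩ := ih (h'.exec ht'.get hst ht₂) ht₂ rfl (e2.trans hm)
    exact ⟨γ'', (hr.tail (.exec ht'.get hst)).trans hr', h''⟩
  | @inp p mm p' mm' c y i o hs hh ih =>
    obtain ⟨x, hx⟩ := hs.head_inp
    obtain ⟨γ', a, hr, h', ht', e1, e2, hxa, hha⟩ : ∃ γ' a, Runs K lvlIn lvlOut m₀ δ γ γ' ∧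
        Alone K lvlIn lvlOut δ O S n j γ' ∧
        Trace K lvlIn lvlOut δ O γ' .idle .idle j a ((c, y) :: i) o ∧ a.prg = e.prg ∧
        a.mem = e.mem ∧ a.stt = .executing ∧ Has c a.inp := by
      cases hst : e.stt with
      | sleeping => exact h.request hK ht ⟨hst, x, by rw [hp, hx]⟩
      | executing =>
        by_cases hhas : Has c e.inp
        · exact ⟨γ, e, .refl, h, ht, rfl, rfl, hst, hhas⟩
        · obtain ⟨hint, hout⟩ := h.regular ht.get hst
          rw [← hp, ← hm] at hs
          -- Without an item the execution has to fall asleep itself, since only this raises the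
          -- signal that MAP answers.
          have hsl : LocalStep e _ := ⟨hst, _, _,
            LocalConf.step_sleep hs (dequeue_eq_none.2 hhas) hint, rfl⟩
          have ht₂ := ht.set hout (e' := { e with
            stt := .sleeping, int := some (.inp c) }) rfl ht.halts (by simp [hout])
          obtain ⟨γ', a, hr, h', ht', e1, e2, h3⟩ := (h.exec ht.get hsl ht₂).request hK ht₂
            ⟨rfl, x, by rw [hp, hx]⟩
          exact ⟨γ', a, .head (.exec ht.get hsl) hr, h', ht', e1, e2, h3⟩
    rw [← hp, ← hm, ← e1, ← e2] at hs
    obtain ⟨z, I, hd⟩ := exists_dequeue hha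
    obtain ⟨rfl, ht₂⟩ := h'.trace_inp hK ht' (h'.regular ht'.get hxa).2 hd
    have hst : LocalStep a _ := ⟨hxa, _, _, LocalConf.step_inp hs hd, rfl⟩
    have ht₂ := ht₂ _ _ hh
    obtain ⟨γ'', hr', h''⟩ := ih (h'.exec ht'.get hst ht₂) ht₂ rfl rfl
    exact ⟨γ'', (hr.tail (.exec ht'.get hst)).trans hr', h''⟩

end Completion

/-! ### Completing the mechanism; RI and DI -/

section Soundness

variable {CIn : Type u} {COut : Type v} [DecidableEq CIn] [DecidableEq COut]
  {K : Kind} {lvlIn : CIn → Level} {lvlOut : COut → Level} {m₀ : Mem}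
  {δ : Defaults CIn COut} {O : Queue COut} {γ γ' : EMConf CIn COut} {m : MStage CIn}
  {r : RStage COut} {j : ℕ}

-- The trace of a terminated program is empty, so the clauses of `Trace` become statements that the
-- items to come are used up and the low output is complete.
omit [DecidableEq COut] in
theorem Quiet.trace_of_done (h : Quiet K lvlIn lvlOut δ O γ) (hd : Done γ j) :
    ∃ e, Trace K lvlIn lvlOut δ O γ .idle .idle j e [] [] ∧ e.stt = .executing := by
  obtain ⟨e, he, hp, hx⟩ := hd
  obtain ⟨a, ins, outs, ht⟩ := h.traces j (lt_of_getElem? he)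
  have hea := ht.get
  rw [he] at hea; cases hea
  have hh := ht.halts
  rw [hp] at hh
  obtain ⟨rfl, rfl⟩ := hh.of_skip
  exact ⟨e, ht, hx⟩

theorem Quiet.run (hK : K ≠ .ni) {S : ℕ → Prop} (h : Quiet K lvlIn lvlOut δ O γ)
    (ho : Ordered K lvlIn j γ.inp) (hS : ∀ k, S k → Done γ k) (hj : j < γ.ex.length) :
    ∃ γ', Runs K lvlIn lvlOut m₀ δ γ γ' ∧
      Alone K lvlIn lvlOut δ O S γ.ex.length j γ' ∧ Done γ' j := by
  obtain ⟨e, ins, outs, ht⟩ := h.traces j hj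
  exact Alone.run hK (⟨h, ho, hS, fun _ => rfl⟩ : Alone K lvlIn lvlOut δ O S _ j γ) ht

omit [DecidableEq CIn] [DecidableEq COut] in
theorem eq_nil_of_atLevel {Q : Queue CIn} (hl : Queue.atLevel lvlIn .low Q = [])
    (hh : Queue.atLevel lvlIn .high Q = []) : Q = [] := by
  cases Q with
  | nil => rfl
  | cons q Q =>
    obtain ⟨c, y⟩ := q
    cases hc : lvlIn c with
    | low => rw [atLevel_cons_of_eq hc] at hl; cases hl
    | high => rw [atLevel_cons_of_eq hc] at hh; cases hh

/-- The mechanism can run to its end: first the local execution 1, then 0, then the clones. -/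
theorem Quiet.finish (hK : K ≠ .ni) (h : Quiet K lvlIn lvlOut δ O γ)
    (ho : Ordered K lvlIn 1 γ.inp) :
    ∃ γ', Runs K lvlIn lvlOut m₀ δ γ γ' ∧ γ'.Final ∧ Queue.atLevel lvlOut .low γ'.out = O := by
  have hlen := h.inv.tables.two_le
  obtain ⟨γ₁, r₁, a₁, d₁⟩ := h.run (m₀ := m₀) hK (S := fun _ => False) ho (fun _ h => h.elim)
    (j := 1) (by omega)
  -- Execution 1 has consumed all low items, and in RI all items whatsoever.
  have h₁ : Queue.atLevel lvlIn .low γ₁.inp = [] ∧ (K = .ri → γ₁.inp = []) := by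
    obtain ⟨e, ht, -⟩ := a₁.quiet.trace_of_done d₁
    refine ⟨?_, fun hri => ?_⟩
    · have := ht.low rfl
      simp only [flow, atLevel_append, atLevel_nil] at this
      exact (List.append_eq_nil_iff.1 this.symm).2
    · have := ht.chan hri rfl
      simp only [flow, List.map_append, List.map_nil] at this
      simpa using (List.append_eq_nil_iff.1 this.symm).2
  have hlen₁ := a₁.quiet.inv.tables.two_le
  obtain ⟨γ₂, r₂, a₂, d₂⟩ := a₁.quiet.run (m₀ := m₀) hK (S := fun k => k = 1) (j := 0)
    ⟨by simp, fun _ => h₁.1, fun _ h => h₁.2 (by simpa using h)⟩ (fun k hk => hk ▸ d₁) (by omega)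
  -- In DI the high items were left to execution 0, whose empty trace shows that they are consumed
  -- too.
  have h₂ : γ₂.inp = [] := by
    by_cases hri : K = .ri
    · exact a₂.ordered.empty (by simp) (.inl hri)
    · have hdi : K = .di := by cases K <;> simp_all
      obtain ⟨e, ht, -⟩ := a₂.quiet.trace_of_done d₂
      have := ht.high hdi rfl
      simp only [flow, atLevel_append, atLevel_nil] at this
      exact eq_nil_of_atLevel (a₂.ordered.no_low (by simp)) (List.append_eq_nil_iff.1 this.symm).2
  -- The length of the stack stays fixed here, because only requests of execution 0 create clones;
  -- the induction exhausts them.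
  have hclones : ∀ n, n + 2 ≤ γ₂.ex.length → ∃ γ', Runs K lvlIn lvlOut m₀ δ γ₂ γ' ∧
      Quiet K lvlIn lvlOut δ O γ' ∧ γ'.inp = [] ∧ γ'.ex.length = γ₂.ex.length ∧
      ∀ k, k < n + 2 → Done γ' k := by
    intro n
    induction n with
    | zero =>
      refine fun _ => ⟨γ₂, .refl, a₂.quiet, h₂, rfl, fun k hk => ?_⟩
      rcases k with _ | _ | k
      · exact d₂
      · exact a₂.done 1 rfl
      · omega
    | succ n ih =>
      intro hn
      obtain ⟨γ', r', q', i', l', hd⟩ := ih (by omega)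
      obtain ⟨γ'', r'', a'', d''⟩ := q'.run (m₀ := m₀) hK (S := fun k => k < n + 2) (j := n + 2)
        ⟨by simp, fun _ => by rw [i']; rfl, fun _ _ => i'⟩ hd (by omega)
      refine ⟨γ'', r'.trans r'', a''.quiet, a''.ordered.empty (by simp) (.inr (by simp)),
        (a''.length (by simp)).trans l', fun k hk => ?_⟩
      by_cases hkn : k = n + 2
      · exact hkn ▸ d''
      · exact a''.done k (show k < n + 2 by omega)
  have hlen₂ := a₂.quiet.inv.tables.two_le
  obtain ⟨γ', r', q', i', l', hd⟩ := hclones (γ₂.ex.length - 2) (by omega)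
  refine ⟨γ', (r₁.trans r₂).trans r', ⟨i', q'.inv.mapPrg, q'.inv.redPrg, fun e he => ?_⟩, ?_⟩
  · obtain ⟨k, hk⟩ := List.mem_iff_getElem?.1 he
    obtain ⟨a, ha, hp, hx⟩ := hd k (by have := lt_of_getElem? hk; omega)
    rw [hk] at ha; cases ha
    exact ⟨hp, hx⟩
  · obtain ⟨e, ht, hx⟩ := q'.trace_of_done (hd 1 (by omega))
    have hout := ((q'.inv.red.regular 1 e ht.get).of_executing hx).2
    simpa [lowSent, pending_of_out_nil ht.get hout] using ht.sent rfl

/-- The new input is the sequence `ins` that execution 1 has read in the given run. Its high items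
are default, so both executions can follow the same trace on it, whether or not they are told high
values. -/
theorem sound_ri (lvlIn : CIn → Level) (lvlOut : COut → Level) (m₀ : Mem) :
    Sound m₀ (mechRI lvlIn lvlOut) (RI (COut := COut) lvlIn lvlOut) := by
  intro π I δ O h
  obtain ⟨ins, outs, hh, hd, hI, hO, hn⟩ := emBehaviour_halts (K := .ri) h
  have hinv := Inv.init .ri lvlIn lvlOut m₀ δ π ins
  have hq : Quiet .ri lvlIn lvlOut δ (Queue.atLevel lvlOut .low outs)
      (EMConf.init m₀ (Kind.ri.mech lvlIn lvlOut δ) π ins) := by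
    refine ⟨hinv, fun j hj => ?_⟩
    have hget : (EMConf.init m₀ (Kind.ri.mech lvlIn lvlOut δ) π ins).ex[j]? = some
        { stt := .executing, int := none, prg := π, mem := m₀, inp := [], out := [] } := by
      exact List.getElem?_replicate_of_lt (by simpa [EMConf.init] using hj)
    refine ⟨_, ins, outs, hget, hh, hd, fun c _ => List.prefix_refl _, fun _ => rfl,
      fun h1 => ?_, fun hk => (by cases hk), fun _ _ => rfl⟩
    rw [h1] at hget
    rw [lowSent, pending_of_out_nil hget rfl]
    rfl
  obtain ⟨γ', hr, hF, hout⟩ := hq.finish (m₀ := m₀) (by simp)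
    ⟨fun _ h => (by cases h), fun h => (h rfl).elim, fun h => (h rfl).elim⟩
  refine ⟨ins, γ'.out, hI, fun q hq => ?_, hn rfl, ⟨γ', hr, hF, rfl⟩, hout.trans hO⟩
  simp only [Queue.atLevel, List.mem_filter, decide_eq_true_eq] at hq
  exact hd q hq.1 hq.2

-- The invariant never mentions the items of the environment, so they may be exchanged in the middle
-- of a run.
omit [DecidableEq COut] in
theorem Inv.inp (h : Inv K lvlIn lvlOut δ γ m r) (Q : Queue CIn) :
    Inv K lvlIn lvlOut δ { γ with inp := Q } m r :=
  ⟨h.mapPrg, h.redPrg, h.tables, h.map, h.red⟩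

omit [DecidableEq COut] in
/-- Only one instruction of MAP depends on the items of the environment. -/
theorem MTrans.inp {m' : MStage CIn} (h : MTrans K lvlIn lvlOut δ γ m m' γ') :
    (γ'.inp = γ.inp ∧ ∀ Q, MTrans K lvlIn lvlOut δ { γ with inp := Q } m m' { γ' with inp := Q }) ∨
    ∃ i c y, m = .b0 i c ∧ γ.inp = (c, y) :: γ'.inp ∧
      ∀ Q, MTrans K lvlIn lvlOut δ { γ with inp := (c, y) :: Q } m m' { γ' with inp := Q } := by
  cases h with
  | silent h => exact .inl ⟨rfl, fun Q => .silent h⟩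
  | clone => exact .inl ⟨rfl, fun Q => .clone⟩
  | input h => exact .inr ⟨_, _, _, rfl, h, fun Q => .input rfl⟩
  | tell => exact .inl ⟨rfl, fun Q => .tell⟩
  | hide => exact .inl ⟨rfl, fun Q => .hide⟩
  | wake => exact .inl ⟨rfl, fun Q => .wake⟩
  | default => exact .inl ⟨rfl, fun Q => .default⟩
  | wakeOne => exact .inl ⟨rfl, fun Q => .wakeOne⟩

omit [DecidableEq CIn] in
theorem RTrans.inp {q : RPt} {i : ℕ} {c : COut} {r' : RStage COut}
    (h : RTrans δ i c γ q r' γ') :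
    γ'.inp = γ.inp ∧ ∀ Q : Queue CIn, RTrans δ i c { γ with inp := Q } q r' { γ' with inp := Q } := by
  cases h with
  | start => exact ⟨rfl, fun Q => .start⟩
  | askW => exact ⟨rfl, fun Q => .askW⟩
  | ask₁ h => exact ⟨rfl, fun Q => .ask₁ h⟩
  | ask₂ h => exact ⟨rfl, fun Q => .ask₂ h⟩
  | fetch he h => exact ⟨rfl, fun Q => .fetch he h⟩
  | tellW => exact ⟨rfl, fun Q => .tellW⟩
  | tell₁ h => exact ⟨rfl, fun Q => .tell₁ h⟩
  | tell₂ h => exact ⟨rfl, fun Q => .tell₂ h⟩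
  | emit => exact ⟨rfl, fun Q => .emit⟩
  | cleanW => exact ⟨rfl, fun Q => .cleanW⟩
  | clean => exact ⟨rfl, fun Q => .clean⟩
  | wakeW => exact ⟨rfl, fun Q => .wakeW⟩
  | wake h => exact ⟨rfl, fun Q => .wake h⟩

/-- A step of the mechanism keeps the invariant; it either ignores the items of the environment or
consumes the first one. -/
theorem Inv.step (h : Inv K lvlIn lvlOut δ γ m r)
    (hs : EMStep m₀ (K.mech lvlIn lvlOut δ) γ γ') :
    (∃ m' r', Inv K lvlIn lvlOut δ γ' m' r') ∧
    ((γ'.inp = γ.inp ∧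
      ∀ Q, EMStep m₀ (K.mech lvlIn lvlOut δ) { γ with inp := Q } { γ' with inp := Q }) ∨
    ∃ i c y, m = .b0 i c ∧ γ.inp = (c, y) :: γ'.inp ∧
      ∀ Q, EMStep m₀ (K.mech lvlIn lvlOut δ) { γ with inp := (c, y) :: Q } { γ' with inp := Q }) := by
  constructor
  · rcases EMStep.iff.1 hs with ⟨i, hs⟩ | hs
    · cases hs with
      | mk hi hl => exact ⟨m, r, h.exec hi hl⟩
    · obtain ⟨m', r', h', -⟩ := h.ctl hs
      exact ⟨m', r', h'⟩
  · rcases EMStep.iff.1 hs with ⟨i, hs⟩ | hs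
    · cases hs with
      | mk hi hl => exact .inl ⟨rfl, fun Q => .exec hi hl⟩
    · cases hs with
      | map hl =>
        rw [h.mapPrg] at hl
        obtain ⟨m', rfl, ht⟩ := hl.inv h.map.cond
        have hstep : ∀ {Q γ₁}, MTrans K lvlIn lvlOut δ { γ with inp := Q } m m' γ₁ →
            EMStep m₀ (K.mech lvlIn lvlOut δ) { γ with inp := Q }
              { γ₁ with mapPrg := m'.prog K lvlIn lvlOut δ } := by
          intro Q γ₁ ht
          refine .map ?_
          have := ht.step (h.inp Q).map.cond
          rwa [← h.mapPrg] at this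
        rcases ht.inp with ⟨h1, h2⟩ | ⟨i, c, y, h1, h2, h3⟩
        · exact .inl ⟨h1, fun Q => hstep (h2 Q)⟩
        · exact .inr ⟨i, c, y, h1, h2, fun Q => hstep (h3 Q)⟩
      | red hl =>
        rw [h.redPrg] at hl
        obtain ⟨q, i, c, r', rfl, rfl, ht⟩ := hl.inv
        refine .inl ⟨ht.inp.1, fun Q => ?_⟩
        have := (ht.inp.2 Q).step
        rw [← h.redPrg] at this
        exact .red (γ := { γ with inp := Q }) this
      | mapActivate hp hi hc hint =>
        obtain ⟨hs, x, hx⟩ := hc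
        exact .inl ⟨rfl, fun Q => .mapActivate hp hi hs hint hx⟩
      | redActivate hp hi hx hint => exact .inl ⟨rfl, fun Q => .redActivate hp hi hx hint⟩

/-- A run that consumes all items passes a configuration in which MAP is about to consume a given
one, and reaches it independently of the items to come. -/
theorem Inv.split {γf : EMConf CIn COut} {I₁ I₂ : Queue CIn} {c : CIn} {y : Val}
    (hr : Runs K lvlIn lvlOut m₀ δ γ γf) (hf : γf.inp = [])
    (h : Inv K lvlIn lvlOut δ γ m r) (hI : γ.inp = I₁ ++ (c, y) :: I₂) :
    ∃ γ' i r', (∀ Q, Runs K lvlIn lvlOut m₀ δ { γ with inp := I₁ ++ Q } { γ' with inp := Q }) ∧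
      Inv K lvlIn lvlOut δ γ' (.b0 i c) r' ∧ γ'.inp = (c, y) :: I₂ ∧
      Runs K lvlIn lvlOut m₀ δ γ' γf := by
  induction hr using Relation.ReflTransGen.head_induction_on generalizing I₁ m r with
  | refl => rw [hf] at hI; simp at hI
  | @head γ₁ γ₂ hs hr ih =>
    obtain ⟨⟨m', r', h'⟩, ⟨h1, h2⟩ | ⟨i, d, z, rfl, h1, h2⟩⟩ := h.step hs
    · obtain ⟨γ', i, r'', g1, g2⟩ := ih h' (h1.trans hI)
      exact ⟨γ', i, r'', fun Q => .head (h2 _) (g1 Q), g2⟩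
    -- The consumed item is either the wanted one, and the run is cut before this step, or it
    -- belongs to the common part `I₁`.
    · cases I₁ with
      | nil =>
        have hI' := hI
        rw [h1, List.nil_append, List.cons.injEq, Prod.mk.injEq] at hI'
        obtain ⟨⟨rfl, -⟩, -⟩ := hI'
        exact ⟨γ₁, i, r, fun Q => .refl, h, hI, .head hs hr⟩
      | cons q I₁ =>
        rw [h1, List.cons_append, List.cons.injEq] at hI
        obtain ⟨rfl, hI⟩ := hI
        obtain ⟨γ', i, r'', g1, g2⟩ := ih h' hI
        exact ⟨γ', i, r'', fun Q => .head (h2 _) (g1 Q), g2⟩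

omit [DecidableEq CIn] [DecidableEq COut] in
theorem Halts.of_head_input {p : Prog CIn COut} {mm : Mem} {ins : Queue CIn} {outs : Queue COut}
    {x : Var} {c : CIn} (h : Halts p mm ins outs) (hp : p.head = some (.input x c)) :
    ∃ y ins', ins = (c, y) :: ins' := by
  cases h with
  | done => cases hp
  | tau h => rw [h.head_tau] at hp; cases hp
  | inp h =>
    obtain ⟨z, hz⟩ := h.head_inp
    rw [hp] at hz; cases hz
    exact ⟨_, _, rfl⟩
  | out h =>
    obtain ⟨⟨z, hz⟩, -⟩ := h.head_out
    rw [hp] at hz; cases hz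

/-- Execution 0 changes its future to that of its clone. The new input agrees with the old one up to
the item replaced, so the given run can be reused up to that point. -/
theorem sound_di (lvlIn : CIn → Level) (lvlOut : COut → Level) (m₀ : Mem) :
    Sound m₀ (mechDI lvlIn lvlOut) (DI (COut := COut) lvlIn lvlOut) := by
  rintro π I δ O I₁ I₂ c y rfl hc hI₂ ⟨γf, hr, hF, rfl⟩
  obtain ⟨γ, i, r, hpre, hinv, hI, hpost⟩ := Inv.split (K := .di) hr hF.1
    (Inv.init .di lvlIn lvlOut m₀ δ π _) rfl
  obtain ⟨hw, -, hcond⟩ := hinv.map.cond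
  -- DI broadcasts only for a requester that may be told the item, and for a high item this is
  -- execution 0.
  obtain rfl : i = 0 := (hinv.tables.tell_high i c hc).1 (hcond rfl).1
  obtain ⟨k, e₀, e, d, hk, h0, hek, hd0, hde, hp, hm, hinp⟩ := (hcond rfl).2 hc
  obtain rfl : d = c := by
    obtain ⟨a, ha, hac⟩ := hw
    rw [h0] at ha; cases ha
    exact hd0.unique hac
  obtain ⟨hcomp, hfin⟩ := hinv.completes hpost hF
  -- The clone terminates in the given run. It is not execution 0, so all high values of its trace
  -- are default.
  obtain ⟨e', ins, outs, he', hh, hdef, hpref⟩ := hfin k (by omega) (lt_of_getElem? hek)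
  rw [hek] at he'; cases he'
  obtain ⟨x, hx⟩ := hde.2
  obtain ⟨y₀, ins, rfl⟩ := hh.of_head_input hx
  -- The clone waits for `d`, so its trace begins with the default item that replaces the given one.
  obtain rfl : y₀ = δ.inp d := hdef (d, y₀) (by simp) hc
  -- Low items stand first for execution 1; behind them come the high items that execution 0
  -- requests when it follows the clone, the first of these being supplied separately in front of
  -- `J`.
  set J : Queue CIn := Queue.atLevel lvlIn .low I₂ ++ Queue.atLevel lvlIn .high ins with hJ
  have hlowJ : Queue.atLevel lvlIn .low J = Queue.atLevel lvlIn .low I₂ := by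
    rw [hJ, atLevel_append, atLevel_atLevel_self, atLevel_atLevel_of_ne _ (by simp), List.append_nil]
  have hhighJ : Queue.atLevel lvlIn .high J = Queue.atLevel lvlIn .high ins := by
    rw [hJ, atLevel_append, atLevel_atLevel_self, atLevel_atLevel_of_ne _ (by simp), List.nil_append]
  have hne : lvlIn d ≠ .low := by simp [hc]
  have hlow : ∀ j a, Queue.atLevel lvlIn .low
      (flow δ { γ with inp := (d, δ.inp d) :: J } (.b0 0 d) j a) =
      Queue.atLevel lvlIn .low (flow δ γ (.b0 0 d) j a) := by
    intro j a
    simp only [flow, MStage.inflight, hI, atLevel_append, atLevel_cons_of_ne hne, hlowJ]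
  have hchan : ∀ j a c, lvlIn c = .low → Queue.onChan c
      (flow δ { γ with inp := (d, δ.inp d) :: J } (.b0 0 d) j a) =
      Queue.onChan c (flow δ γ (.b0 0 d) j a) := by
    intro j a c hc
    rw [← onChan_atLevel hc, hlow, onChan_atLevel hc]
  have htr : Traces .di lvlIn lvlOut δ (Queue.atLevel lvlOut .low γf.out)
      { γ with inp := (d, δ.inp d) :: J } (.b0 0 d) r := by
    intro j hj
    rcases j with _ | _ | j
    · refine ⟨e₀, _, outs, h0, by rw [← hp, ← hm]; exact hh, hdef, fun c h => ?_, by simp, by simp,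
        fun _ _ => ?_, by simp⟩
      · rcases h with h | ⟨h, -⟩
        · rw [hchan _ _ _ h]
          have := hpref c h
          simpa only [flow, MStage.inflight, hinp] using this
        · cases h
      -- Execution 0 sleeps with no high item in its queue, so the high items to come for it are
      -- exactly those of the clone's trace.
      · have := (hinv.map.served_high rfl).eq_nil (fun _ h => h) h0 hd0
        simp only [flow, MStage.inflight, atLevel_append, this, List.nil_append, atLevel_nil,
          atLevel_cons_of_eq hc, hhighJ]
    · obtain ⟨a, i, o, h1, h2, h3, h4, h5, -⟩ := hcomp
      refine ⟨a, i, o, h1, h2, h3, fun c h => ?_, fun _ => h4.trans (hlow 1 a).symm, fun _ => h5,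
        by simp, by simp⟩
      rcases h with h | ⟨h, -⟩
      · rw [hchan _ _ _ h, ← onChan_atLevel h, h4, onChan_atLevel h]
      · cases h
    · obtain ⟨a, i, o, h1, h2, h3, h4⟩ := hfin (j + 2) (by omega) (by simpa using hj)
      refine CanFinish.trace ⟨a, i, o, h1, h2, h3, fun c h => ?_⟩ (by omega)
      rw [hchan _ _ _ h]
      exact h4 c h
  obtain ⟨γ₁, r₁, i₁, -, -⟩ := (hinv.inp ((d, δ.inp d) :: J)).reach_broadcast (m₀ := m₀) rfl
  -- The cut may fall in the middle of a REDUCE program, which is run to its end.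
  obtain ⟨γ₂, r₂, i₂⟩ : ∃ γ₂, Reach .di lvlIn lvlOut m₀ δ γ₁ .idle r γ₂ .idle .idle ∧
      γ₂.inp = γ₁.inp := by
    cases r with
    | idle => exact ⟨γ₁, .refl r₁.inv, rfl⟩
    | busy q i c =>
      obtain ⟨γ₂, h1, h2, -⟩ := r₁.inv.reach_drain (m₀ := m₀)
      exact ⟨γ₂, h1, h2⟩
  have hreach := r₁.trans r₂
  have hq : Quiet .di lvlIn lvlOut δ (Queue.atLevel lvlOut .low γf.out) γ₂ :=
    ⟨hreach.inv, htr.frame hinv.tables.two_le hreach.frame⟩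
  obtain ⟨γ', hr', hF', hout⟩ := hq.finish (m₀ := m₀) (by simp) (by
    rw [i₂, i₁]
    refine ⟨fun _ _ => ⟨_, _, hJ, ?_, ?_⟩, fun h => (h rfl).elim, fun h => (h rfl).elim⟩ <;>
    · intro q hq
      simp only [Queue.atLevel, List.mem_filter, decide_eq_true_eq] at hq
      exact hq.2)
  refine ⟨I₁ ++ [(d, δ.inp d)] ++ J, _, J, γ'.out, rfl, rfl, ?_, ?_, ⟨γ', ?_, hF', rfl⟩, hout⟩
  · simp only [LowEq, atLevel_append, atLevel_cons_of_ne hne, hlowJ, atLevel_nil, List.append_nil]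
  · rw [hhighJ]
    intro q hq
    simp only [Queue.atLevel, List.mem_filter, decide_eq_true_eq] at hq
    exact hdef q (by simp [hq.1]) hq.2
  · rw [List.append_assoc]
    exact ((hpre ((d, δ.inp d) :: J)).trans hreach.runs).trans hr'

end Soundness

end MapReduce

theorem theorem1 {CIn : Type*} {COut : Type*} [DecidableEq CIn] [DecidableEq COut]
    (lvlIn : CIn → MapReduce.Level) (lvlOut : COut → MapReduce.Level) (m₀ : MapReduce.Mem) :
    MapReduce.Sound m₀ (MapReduce.mechRI lvlIn lvlOut) (MapReduce.RI lvlIn lvlOut) ∧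
    MapReduce.Sound m₀ (MapReduce.mechDI lvlIn lvlOut) (MapReduce.DI lvlIn lvlOut) ∧
    MapReduce.Sound m₀ (MapReduce.mechNI lvlIn lvlOut) (MapReduce.TINI lvlIn lvlOut) :=
  ⟨MapReduce.sound_ri lvlIn lvlOut m₀, MapReduce.sound_di lvlIn lvlOut m₀,
    MapReduce.sound_tini lvlIn lvlOut m₀⟩
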